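/- \textbf{Setting.} Let $s\in\mathbb Z$. For $R\in SO(3)$ let $(\vartheta_R,\varphi_R)$ be the spherical coordinates on $U_R=\mathbb S^2\setminus\{\pm R\mathbf N\}$ rotated by $R$, let $\rho_R(p)$ be the unit tangent vector at $p$ in the direction of increasing $\varphi_R$, and let $\psi_{pR_2R_1}$ be the oriented angle in the tangent plane from $\rho_{R_1}(p)$ to $\rho_{R_2}(p)$, the rotation by $+\pi/2$ being $v\mapsto v\times p$. The Hilbert space $L^2_s$ consists of the families $F=(F_R)_{R\in SO(3)}$ of functions in $L^2(\mathbb S^2)$ (surface measure) with $F_{R_2}(p)=e^{is\psi_{pR_2R_1}}F_{R_1}(p)$ for almost every $p$, for all $R_1,R_2$; its inner product is $\langle F,G\rangle=\langle F_I,G_I\rangle$ (linear in the first variable). Let $Y_{lm}$ ($l\ge 0$, $|m|\le l$) be the standard spherical harmonics, and for $l\ge|s|$ let $Y_{lm,s}\in L^2_s$ be the spin spherical harmonics, $$Y_{lm,s}=\Big\{\tfrac{(l-s)!}{(l+s)!}\Big\}^{1/2}\eth^{s}Y_{lm}\ (s\ge0),\qquad Y_{lm,s}=\Big\{\tfrac{(l+s)!}{(l-s)!}\Big\}^{1/2}(-\overline\eth)^{-s}Y_{lm}\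 (s<0),$$ where on spin $r$ functions, in each chart, $$\eth F=-(\sin\vartheta)^{r}\Big[\tfrac{\partial}{\partial\vartheta}+\tfrac{i}{\sin\vartheta}\tfrac{\partial}{\partial\varphi}\Big](\sin\vartheta)^{-r}F,\qquad \overline\eth F=-(\sin\vartheta)^{-r}\Big[\tfrac{\partial}{\partial\vartheta}-\tfrac{i}{\sin\vartheta}\tfrac{\partial}{\partial\varphi}\Big](\sin\vartheta)^{r}F.$$ Put $e_{ls}=(l-|s|)(l+|s|+1)$. Let $\mathcal H_{|s|,s}$ be the span of the $Y_{|s|m,s}$, $|m|\le|s|$, let $P$ be the orthogonal projection of $L^2_s$ onto $\mathcal H_{|s|,s}$, let $\mathcal H_l\subset L^2(\mathbb S^2)$ be the span of the $Y_{lm}$, $|m|\le l$, and $\mathcal H^s=\bigoplus_{l\ge|s|}\mathcal H_l$ (Hilbert sum). Let $B>0$, and let $\phi:\mathbb R\to[0,1]$ be $C^\infty$, even, non-increasing on $[0,\infty)$, zero for $|\xi|>1$ and equal to $1$ for $|\xi|\le 1/B$ (such $\phi$ exists only if $B>1$). Let $b:\mathbb R\to\mathbb R$ satisfy $b(\xi)^2=\phi(\xi/B)-\phi(\xi)$.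 For $j\in\mathbb Z$ let $L_j$ be the largest integer $l\ge|s|$ with $e_{ls}\le B^{2(j+1)}$. \textbf{Claim.} (a) For every $j\in\mathbb Z$ there are finitely many points $\xi_{jk}\in\mathbb S^2$ and weights $\lambda_{jk}\ge0$ with $\int_{\mathbb S^2}q=\sum_k\lambda_{jk}q(\xi_{jk})$ for every real polynomial $q$ in three variables of degree at most $2L_j$. (b) There is a unitary map $U$ of $\mathcal H^s$ onto $L^2_s$ with $U(Y_{lm})=Y_{lm,s}$ for all $l\ge|s|$, $|m|\le l$. (c) For every choice of points and weights as in (a), put $$\eta_{jk}=\sqrt{\lambda_{jk}}\sum_{l\ge|s|}b\Big(\frac{\sqrt{e_{ls}}}{B^j}\Big)\sum_{m=-l}^{l}\overline{Y_{lm}(\xi_{jk})}\,Y_{lm},\qquad \psi_{jk,s\mathcal M}=\sqrt{\lambda_{jk}}\sum_{l\ge|s|}b\Big(\frac{\sqrt{e_{ls}}}{B^j}\Big)\sum_{m=-l}^{l}\overline{Y_{lm}(\xi_{jk})}\,Y_{lm,s}$$ (finite sums; $\psi_{jk,s\mathcal M}$ are the \emph{mixed needlets}). Then $\psi_{jk,s\mathcal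 M}=U\eta_{jk}$, and $\psi_{jk,s\mathcal M}\in(I-P)L^2_s$. For $F\in L^2_s$ the coefficients $\beta_{jk,s\mathcal M}=\langle F,\psi_{jk,s\mathcal M}\rangle$ satisfy $$\beta_{jk,s\mathcal M}=\sqrt{\lambda_{jk}}\sum_{l\ge|s|}b\Big(\frac{\sqrt{e_{ls}}}{B^j}\Big)\sum_{m=-l}^{l}\langle F,Y_{lm,s}\rangle Y_{lm}(\xi_{jk}).$$ The mixed needlets form a tight frame with constant $1$ for $(I-P)L^2_s$: for every $F\in(I-P)L^2_s$, $$\|F\|^2=\sum_{j\in\mathbb Z}\sum_k|\beta_{jk,s\mathcal M}|^2,\qquad F=\sum_{j\in\mathbb Z}\sum_k\beta_{jk,s\mathcal M}\,\psi_{jk,s\mathcal M},$$ the last series converging unconditionally in $L^2_s$. -/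

import Mathlib

open MeasureTheory
open scoped Matrix InnerProductSpace ContDiff

namespace MixedNeedlets

noncomputable section

/-! ### The sphere, rotations and rotated spherical coordinates -/

/-- The unit sphere in Euclidean three-space. -/
abbrev S2 : Type := Metric.sphere (0 : EuclideanSpace ℝ (Fin 3)) 1

/-- The rotation group. -/
abbrev SO3 : Type := Matrix.specialOrthogonalGroup (Fin 3) ℝ

/-- Surface measure on the sphere (total mass `4π`). -/
abbrev surf : Measure S2 := (volume : Measure (EuclideanSpace ℝ (Fin 3))).toSphere

/-- The Hilbert space of (classes of) square integrable complex functions on the sphere. -/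
abbrev ScalarL2 : Type := Lp ℂ 2 surf

theorem mem_S2_iff (x : EuclideanSpace ℝ (Fin 3)) :
    x ∈ Metric.sphere (0 : EuclideanSpace ℝ (Fin 3)) 1 ↔ x.ofLp ⬝ᵥ x.ofLp = 1 := by
  rw [mem_sphere_zero_iff_norm, EuclideanSpace.norm_eq, Real.sqrt_eq_one]
  simp [dotProduct, sq]

theorem SO3.transpose_mul (R : SO3) : R.1ᵀ * R.1 = 1 := by
  have h := (Matrix.mem_specialOrthogonalGroup_iff.1 R.2).1
  exact (Matrix.mem_orthogonalGroup_iff' (Fin 3) ℝ).1 h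

theorem SO3.dot (R : SO3) (x y : Fin 3 → ℝ) : (R.1 *ᵥ x) ⬝ᵥ (R.1 *ᵥ y) = x ⬝ᵥ y := by
  rw [Matrix.dotProduct_mulVec, ← Matrix.mulVec_transpose, Matrix.mulVec_mulVec,
    SO3.transpose_mul, Matrix.one_mulVec]

/-- The action of a rotation on the sphere. -/
def rot (R : SO3) (p : S2) : S2 :=
  ⟨WithLp.toLp 2 (R.1 *ᵥ p.1.ofLp), by
    rw [mem_S2_iff]
    exact (SO3.dot R _ _).trans ((mem_S2_iff p.1).1 p.2)⟩

/-- The point with colatitude `θ` and longitude `φ`, as a vector. -/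
def sphVec (θ φ : ℝ) : Fin 3 → ℝ :=
  ![Real.sin θ * Real.cos φ, Real.sin θ * Real.sin φ, Real.cos θ]

/-- The point with colatitude `θ` and longitude `φ`. -/
def spherePt (θ φ : ℝ) : S2 :=
  ⟨WithLp.toLp 2 (sphVec θ φ), by
    rw [mem_S2_iff]
    simp only [sphVec, dotProduct, Fin.sum_univ_three, Matrix.cons_val]
    linear_combination Real.sin_sq_add_cos_sq θ +
      Real.sin θ ^ 2 * Real.sin_sq_add_cos_sq φ⟩

/-- The point whose coordinates in the chart rotated by `R` are `(θ, φ)`. -/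
def chartPt (R : SO3) (θ φ : ℝ) : S2 := rot R (spherePt θ φ)

/-- The rotated colatitude `ϑ_R`. -/
def colat (R : SO3) (p : S2) : ℝ := Real.arccos ((rot R⁻¹ p).1 2)

/-- The rotated longitude `φ_R` (normalized to `(-π, π]`; only its value modulo `2π` matters). -/
def lon (R : SO3) (p : S2) : ℝ := Complex.arg ⟨(rot R⁻¹ p).1 0, (rot R⁻¹ p).1 1⟩

/-- The reference direction `ρ_R(p)`: the unit tangent vector at `p` to the circle
`ϑ_R = constant`, pointing in the direction of increasing `φ_R`. It is meaningful on the chart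
`U_R = S² \ {±R N}`; the two excluded points are a null set. -/
def refDir (R : SO3) (p : S2) : Fin 3 → ℝ :=
  R.1 *ᵥ ![-Real.sin (lon R p), Real.cos (lon R p), 0]

/-- The oriented angle `ψ_{p R₂ R₁}` (modulo `2π`) from `ρ_{R₁}(p)` to `ρ_{R₂}(p)` in the tangent
plane at `p`, oriented so that at the south pole `(0,0,-1)` the angle from `i` to `j` is `π/2` and
at the north pole the angle from `j` to `i` is `π/2`: the rotation of a tangent vector `v` by `π/2`
is `(-p) × v = v × p`. -/
def spinAngle (p : S2) (R₂ R₁ : SO3) : ℝ :=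
  Complex.arg ⟨refDir R₁ p ⬝ᵥ refDir R₂ p, (refDir R₁ p ⨯₃ p.1.ofLp) ⬝ᵥ refDir R₂ p⟩

/-! ### Square integrable spin functions -/

/-- Families `(F_R)` of square integrable functions, indexed by the rotations `R`, with
`F_{R₂} = e^{i s ψ} F_{R₁}` almost everywhere, `ψ = ψ_{p R₂ R₁}`. -/
def spinSubmodule (s : ℤ) : Submodule ℂ (SO3 → ScalarL2) where
  carrier := {F | ∀ R₁ R₂ : SO3, ∀ᵐ p ∂surf,
    F R₂ p = Complex.exp (Complex.I * s * spinAngle p R₂ R₁) * F R₁ p}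
  zero_mem' := by
    intro R₁ R₂
    filter_upwards [Lp.coeFn_zero ℂ 2 surf] with p hp
    simp only [Pi.zero_apply, hp, mul_zero]
  add_mem' := by
    intro F G hF hG R₁ R₂
    filter_upwards [hF R₁ R₂, hG R₁ R₂, Lp.coeFn_add (F R₁) (G R₁),
      Lp.coeFn_add (F R₂) (G R₂)] with p h1 h2 h3 h4
    simp only [Pi.add_apply] at h3 h4 ⊢
    rw [h3, h4, h1, h2, mul_add]
  smul_mem' := by
    intro c F hF R₁ R₂
    filter_upwards [hF R₁ R₂, Lp.coeFn_smul c (F R₁), Lp.coeFn_smul c (F R₂)] with p h1 h3 h4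
    simp only [Pi.smul_apply] at h3 h4 ⊢
    rw [h3, h4, h1, smul_eq_mul, smul_eq_mul, mul_left_comm]

/-- The space `L²_s` of square integrable spin `s` functions on the sphere. -/
def SpinL2 (s : ℤ) : Type := spinSubmodule s

instance (s : ℤ) : AddCommGroup (SpinL2 s) := inferInstanceAs (AddCommGroup (spinSubmodule s))

instance (s : ℤ) : Module ℂ (SpinL2 s) := inferInstanceAs (Module ℂ (spinSubmodule s))

/-- The component `F_R` of a spin function. -/
def SpinL2.comp {s : ℤ} (R : SO3) : SpinL2 s →ₗ[ℂ] ScalarL2 :=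
  (LinearMap.proj R).comp (spinSubmodule s).subtype

theorem SpinL2.comp_one_injective (s : ℤ) :
    Function.Injective (SpinL2.comp (s := s) 1) := by
  rw [← LinearMap.ker_eq_bot, LinearMap.ker_eq_bot']
  intro F hF
  apply Subtype.ext
  funext R
  have hF' : F.1 1 = 0 := hF
  change F.1 R = 0
  rw [Lp.eq_zero_iff_ae_eq_zero] at hF' ⊢
  filter_upwards [F.2 1 R, hF'] with p h1 h2
  rw [h1, h2]
  simp

/-- The norm of `L²_s`: `‖F‖ = ‖F_I‖`. -/
instance (s : ℤ) : NormedAddCommGroup (SpinL2 s) :=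
  NormedAddCommGroup.induced (SpinL2 s) ScalarL2 (SpinL2.comp (s := s) 1)
    (SpinL2.comp_one_injective s)

/-- The inner product of `L²_s`: `⟨F, G⟩ = ⟨F_I, G_I⟩`, (conjugate-linear in the first variable,
as usual in Mathlib). -/
instance (s : ℤ) : InnerProductSpace ℂ (SpinL2 s) where
  inner F G := ⟪SpinL2.comp 1 F, SpinL2.comp 1 G⟫_ℂ
  norm_smul_le c F := by
    change ‖SpinL2.comp 1 (c • F)‖ ≤ ‖c‖ * ‖SpinL2.comp 1 F‖
    rw [map_smul, norm_smul]
  norm_sq_eq_re_inner F := norm_sq_eq_re_inner (𝕜 := ℂ) (SpinL2.comp 1 F)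
  conj_inner_symm F G := inner_conj_symm _ _
  add_left F G H := by rw [map_add, inner_add_left]
  smul_left F G c := by rw [map_smul, inner_smul_left]

/-! ### Spherical harmonics -/

/-- The scalar spherical harmonic `Y_{lm}`, `-l ≤ m ≤ l`: with `(x, y, z) = p` and
`x + i y = sin ϑ e^{iφ}`, `z = cos ϑ`, it is
`(-1)^m √((2l+1)/(4π) · (l-m)!/(l+m)!) P_l^m(cos ϑ) e^{imφ}` for `m ≥ 0`, where
`P_l^m(z) = (1-z²)^{m/2} (2^l l!)⁻¹ (d/dz)^{l+m} (z²-1)^l`, and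
`Y_{l,-m} = (-1)^m` times the complex conjugate of `Y_{lm}`. -/
def scalarHarmonic (l : ℕ) (m : ℤ) (p : S2) : ℂ :=
  ((√((2 * l + 1) / (4 * Real.pi) * ((l - m.natAbs).factorial / (l + m.natAbs).factorial)) /
      (2 ^ l * l.factorial) : ℝ) : ℂ) *
    (if 0 ≤ m then (-((p.1 0 : ℂ) + Complex.I * (p.1 1 : ℂ))) ^ m.natAbs
      else ((p.1 0 : ℂ) - Complex.I * (p.1 1 : ℂ)) ^ m.natAbs) *
    (((Polynomial.derivative^[l + m.natAbs] ((Polynomial.X ^ 2 - 1) ^ l : Polynomial ℝ)).eval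
      (p.1 2) : ℝ) : ℂ)

/-- The spin-raising operator `ð` on spin `s` functions, in the chart rotated by `R`. -/
def eth (s : ℤ) (R : SO3) (f : S2 → ℂ) (p : S2) : ℂ :=
  -((Real.sin (colat R p) : ℂ) ^ s) *
    (deriv (fun t : ℝ => (Real.sin t : ℂ) ^ (-s) * f (chartPt R t (lon R p))) (colat R p) +
      Complex.I / (Real.sin (colat R p) : ℂ) *
        deriv (fun u : ℝ => (Real.sin (colat R p) : ℂ) ^ (-s) * f (chartPt R (colat R p) u))
          (lon R p))

/-- The spin-lowering operator `ð̄` on spin `s` functions, in the chart rotated by `R`. -/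
def ethBar (s : ℤ) (R : SO3) (f : S2 → ℂ) (p : S2) : ℂ :=
  -((Real.sin (colat R p) : ℂ) ^ (-s)) *
    (deriv (fun t : ℝ => (Real.sin t : ℂ) ^ s * f (chartPt R t (lon R p))) (colat R p) -
      Complex.I / (Real.sin (colat R p) : ℂ) *
        deriv (fun u : ℝ => (Real.sin (colat R p) : ℂ) ^ s * f (chartPt R (colat R p) u))
          (lon R p))

/-- `ð^n` applied to a scalar function, in the chart rotated by `R`. -/
def ethPow (R : SO3) (f : S2 → ℂ) : ℕ → S2 → ℂ
  | 0 => f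
  | n + 1 => eth n R (ethPow R f n)

/-- `(-ð̄)^n` applied to a scalar function, in the chart rotated by `R`. -/
def negEthBarPow (R : SO3) (f : S2 → ℂ) : ℕ → S2 → ℂ
  | 0 => f
  | n + 1 => -ethBar (-n) R (negEthBarPow R f n)

/-- The component in the chart rotated by `R` of the spin `s` spherical harmonic `Y_{lm,s}`, for
`l ≥ |s|` and `-l ≤ m ≤ l`: `{(l-s)!/(l+s)!}^{1/2} ð^s Y_{lm}` if `s ≥ 0`, and
`{(l+s)!/(l-s)!}^{1/2} (-ð̄)^{-s} Y_{lm}` if `s < 0`. -/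
def spinHarmonicFun (s : ℤ) (l : ℕ) (m : ℤ) (R : SO3) (p : S2) : ℂ :=
  ((√((l - s.natAbs).factorial / (l + s.natAbs).factorial) : ℝ) : ℂ) *
    (if 0 ≤ s then ethPow R (scalarHarmonic l m) s.natAbs p
      else negEthBarPow R (scalarHarmonic l m) s.natAbs p)

/-! ### Spherical harmonics are square integrable and transform correctly -/

/-- The frame vector `∂_ϑ` at the point with coordinates `(θ, φ)`. -/
def thVec (θ φ : ℝ) : Fin 3 → ℝ :=
  ![Real.cos θ * Real.cos φ, Real.cos θ * Real.sin φ, -Real.sin θ]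

/-- The unit vector in the direction of `∂_φ`. -/
def phVec (φ : ℝ) : Fin 3 → ℝ := ![-Real.sin φ, Real.cos φ, 0]

/-- The point `p` with coordinates `(θ, φ)` in the rotated chart together with the complex tangent
vector `∂_ϑ + ε i (sin ϑ)⁻¹ ∂_φ` (`ε = ±1`) at `p`. -/
def frameVec (ε : ℝ) (R : SO3) (θ φ : ℝ) : Fin 3 ⊕ Fin 3 → ℂ :=
  Sum.elim (fun i => ((R.1 *ᵥ sphVec θ φ) i : ℂ))
    (fun i => ((R.1 *ᵥ thVec θ φ) i : ℂ) + Complex.I * ε * ((R.1 *ᵥ phVec φ) i : ℂ))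

/-- Differentiation in the point along the tangent vector. -/
def derivD : Derivation ℂ (MvPolynomial (Fin 3 ⊕ Fin 3) ℂ) (MvPolynomial (Fin 3 ⊕ Fin 3) ℂ) :=
  MvPolynomial.mkDerivation ℂ (Sum.elim (fun i => MvPolynomial.X (Sum.inr i)) (fun _ => 0))

/-- The Euler derivation in the tangent vector. -/
def derivE : Derivation ℂ (MvPolynomial (Fin 3 ⊕ Fin 3) ℂ) (MvPolynomial (Fin 3 ⊕ Fin 3) ℂ) :=
  MvPolynomial.mkDerivation ℂ (Sum.elim (fun _ => 0) (fun i => MvPolynomial.X (Sum.inr i)))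

/-- An ambient polynomial extending the scalar spherical harmonic. -/
def harmonicPoly (l : ℕ) (m : ℤ) : MvPolynomial (Fin 3 ⊕ Fin 3) ℂ :=
  MvPolynomial.rename Sum.inl
    (MvPolynomial.C ((√((2 * l + 1) / (4 * Real.pi) *
        ((l - m.natAbs).factorial / (l + m.natAbs).factorial)) / (2 ^ l * l.factorial) : ℝ) : ℂ) *
      (if 0 ≤ m then (-(MvPolynomial.X 0 + MvPolynomial.C Complex.I * MvPolynomial.X 1)) ^ m.natAbs
        else (MvPolynomial.X 0 - MvPolynomial.C Complex.I * MvPolynomial.X 1) ^ m.natAbs) *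
      Polynomial.aeval (MvPolynomial.X 2)
        (Polynomial.derivative^[l + m.natAbs] ((Polynomial.X ^ 2 - 1) ^ l : Polynomial ℝ)))

theorem harmonicPoly_eval (l : ℕ) (m : ℤ) (p : S2) (v : Fin 3 → ℂ) :
    MvPolynomial.eval (Sum.elim (fun i => (p.1 i : ℂ)) v) (harmonicPoly l m) =
      scalarHarmonic l m p := by
  have h : ∀ q : Polynomial ℝ, MvPolynomial.eval (fun i => (p.1 i : ℂ))
      (Polynomial.aeval (MvPolynomial.X 2 : MvPolynomial (Fin 3) ℂ) q) =
      ((q.eval (p.1 2) : ℝ) : ℂ) := by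
    intro q
    induction q using Polynomial.induction_on' with
    | add a b ha hb => simp [ha, hb]
    | monomial n a =>
      simp [Polynomial.aeval_monomial, IsScalarTower.algebraMap_apply ℝ ℂ (MvPolynomial (Fin 3) ℂ),
        MvPolynomial.algebraMap_eq]
  rw [harmonicPoly, MvPolynomial.eval_rename, Sum.elim_comp_inl, map_mul, map_mul, h,
    scalarHarmonic]
  congr 2
  · simp
  · split_ifs <;> simp

theorem derivE_rename (q : MvPolynomial (Fin 3) ℂ) :
    derivE (MvPolynomial.rename Sum.inl q) = 0 := by
  induction q using MvPolynomial.induction_on with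
  | C a => simp [derivE]
  | add a b ha hb => simp [ha, hb]
  | mul_X a i ha =>
    rw [map_mul, MvPolynomial.rename_X, Derivation.leibniz, ha]
    simp [derivE]

theorem derivE_harmonicPoly (l : ℕ) (m : ℤ) : derivE (harmonicPoly l m) = 0 :=
  derivE_rename _

theorem derivE_derivD (F : MvPolynomial (Fin 3 ⊕ Fin 3) ℂ) :
    derivE (derivD F) = derivD (derivE F) + derivD F := by
  have h : (⁅derivE, derivD⁆ : Derivation ℂ (MvPolynomial (Fin 3 ⊕ Fin 3) ℂ)
      (MvPolynomial (Fin 3 ⊕ Fin 3) ℂ)) = derivD := by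
    apply MvPolynomial.derivation_ext
    rintro (i | i) <;> simp [Derivation.commutator_apply, derivE, derivD]
  have h2 := congrArg (fun d => d F) h
  simp only [Derivation.commutator_apply] at h2
  rw [← sub_eq_iff_eq_add', h2]

theorem derivE_iter (l : ℕ) (m : ℤ) (n : ℕ) :
    derivE (derivD^[n] (harmonicPoly l m)) = (n : ℂ) • derivD^[n] (harmonicPoly l m) := by
  induction n with
  | zero => simp [derivE_harmonicPoly]
  | succ n ih =>
    rw [Function.iterate_succ_apply', derivE_derivD, ih, Derivation.map_smul, Nat.cast_succ, add_smul,
      one_smul]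

theorem hasDerivAt_eval (F : MvPolynomial (Fin 3 ⊕ Fin 3) ℂ) (v : ℝ → Fin 3 ⊕ Fin 3 → ℂ)
    (w : Fin 3 ⊕ Fin 3 → ℂ) (t : ℝ) (h : ∀ i, HasDerivAt (fun x => v x i) (w i) t) :
    HasDerivAt (fun x => MvPolynomial.eval (v x) F)
      (∑ i, w i * MvPolynomial.eval (v t) (MvPolynomial.pderiv i F)) t := by
  induction F using MvPolynomial.induction_on with
  | C a => simpa using hasDerivAt_const t a
  | add a b ha hb =>
    simp only [map_add, mul_add, Finset.sum_add_distrib]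
    exact ha.add hb
  | mul_X a i ha =>
    simp only [map_mul, MvPolynomial.eval_X]
    refine (ha.mul (h i)).congr_deriv ?_
    have : ∀ j, w j * MvPolynomial.eval (v t) (MvPolynomial.pderiv j (a * MvPolynomial.X i)) =
        w j * MvPolynomial.eval (v t) (MvPolynomial.pderiv j a) * v t i +
        if j = i then MvPolynomial.eval (v t) a * w i else 0 := by
      intro j
      classical
      by_cases hj : j = i
      · subst hj
        simp
        ring
      · simp [MvPolynomial.pderiv_X_of_ne (Ne.symm hj), hj]
        ring
    simp only [this, Finset.sum_add_distrib, Finset.sum_mul]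
    simp

theorem derivation_eq_sum
    (d : Derivation ℂ (MvPolynomial (Fin 3 ⊕ Fin 3) ℂ) (MvPolynomial (Fin 3 ⊕ Fin 3) ℂ))
    (F : MvPolynomial (Fin 3 ⊕ Fin 3) ℂ) :
    d F = ∑ i, d (MvPolynomial.X i) * MvPolynomial.pderiv i F := by
  induction F using MvPolynomial.induction_on with
  | C a => simp [← MvPolynomial.algebraMap_eq]
  | add a b ha hb => simp only [map_add, ha, hb, mul_add, Finset.sum_add_distrib]
  | mul_X a i ha =>
    classical
    simp only [Derivation.leibniz, ha, MvPolynomial.pderiv_X, Pi.single_apply, smul_eq_mul,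
      mul_add, Finset.sum_add_distrib, Finset.mul_sum]
    congr 1
    · simp [mul_comm]
    · exact Finset.sum_congr rfl fun j _ => by ring

theorem hasDerivAt_frameVec_th (ε : ℝ) (R : SO3) (θ φ : ℝ) (i : Fin 3 ⊕ Fin 3) :
    HasDerivAt (fun t => frameVec ε R t φ i)
      (Sum.elim (fun i => ((R.1 *ᵥ thVec θ φ) i : ℂ))
        (fun i => -((R.1 *ᵥ sphVec θ φ) i : ℂ)) i) θ := by
  have hs := Real.hasDerivAt_sin θ
  have hc := Real.hasDerivAt_cos θ
  rcases i with i | i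
  · simp only [frameVec, Sum.elim_inl]
    refine HasDerivAt.ofReal_comp ?_
    simp only [Matrix.mulVec, dotProduct, Fin.sum_univ_three, sphVec, thVec, Matrix.cons_val]
    refine (((((hs.mul_const _).const_mul _).add ((hs.mul_const _).const_mul _)).add
      (hc.const_mul _))).congr_deriv (by ring)
  · simp only [frameVec, Sum.elim_inr, ← Complex.ofReal_neg]
    refine HasDerivAt.add_const _ (HasDerivAt.ofReal_comp ?_)
    simp only [Matrix.mulVec, dotProduct, Fin.sum_univ_three, sphVec, thVec, Matrix.cons_val]
    refine (((((hc.mul_const _).const_mul _).add ((hc.mul_const _).const_mul _)).add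
      (hs.neg.const_mul _))).congr_deriv (by ring)

theorem hasDerivAt_frameVec_ph (ε : ℝ) (R : SO3) (θ φ : ℝ) (i : Fin 3 ⊕ Fin 3) :
    HasDerivAt (fun u => frameVec ε R θ u i)
      (Sum.elim (fun i => (Real.sin θ : ℂ) * ((R.1 *ᵥ phVec φ) i : ℂ))
        (fun i => (Real.cos θ : ℂ) * ((R.1 *ᵥ phVec φ) i : ℂ) - Complex.I * ε *
          ((Real.sin θ : ℂ) * ((R.1 *ᵥ sphVec θ φ) i : ℂ) +
            (Real.cos θ : ℂ) * ((R.1 *ᵥ thVec θ φ) i : ℂ))) i) φ := by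
  have hs := Real.hasDerivAt_sin φ
  have hc := Real.hasDerivAt_cos φ
  rcases i with i | i
  · simp only [frameVec, Sum.elim_inl, ← Complex.ofReal_mul]
    refine HasDerivAt.ofReal_comp ?_
    simp only [Matrix.mulVec, dotProduct, Fin.sum_univ_three, sphVec, phVec, Matrix.cons_val]
    refine (((((hc.const_mul _).const_mul _).add ((hs.const_mul _).const_mul _)).add_const
      _)).congr_deriv (by ring)
  · simp only [frameVec, Sum.elim_inr, ← Complex.ofReal_mul, ← Complex.ofReal_add]
    rw [sub_eq_add_neg, ← mul_neg, ← Complex.ofReal_neg]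
    refine HasDerivAt.add (HasDerivAt.ofReal_comp ?_)
      (HasDerivAt.const_mul _ (HasDerivAt.ofReal_comp ?_))
    · simp only [Matrix.mulVec, dotProduct, Fin.sum_univ_three, thVec, phVec, Matrix.cons_val]
      refine (((((hc.const_mul _).const_mul _).add ((hs.const_mul _).const_mul _)).add_const
        _)).congr_deriv (by ring)
    · simp only [Matrix.mulVec, dotProduct, Fin.sum_univ_three, sphVec, thVec, phVec,
        Matrix.cons_val]
      refine (((((hs.neg.const_mul _)).add (hc.const_mul _)).add_const
        _)).congr_deriv ?_
      linear_combination (R.1 i 0 * Real.cos φ + R.1 i 1 * Real.sin φ) *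
        Real.sin_sq_add_cos_sq θ

/-- Action of `∂_ϑ + ε i (sin ϑ)⁻¹ ∂_φ` on a polynomial in the point and the tangent vector. -/
theorem edth_frame (ε : ℝ) (hε : ε ^ 2 = 1) (R : SO3) (n : ℕ) (c : ℂ) (f : S2 → ℂ)
    (F : MvPolynomial (Fin 3 ⊕ Fin 3) ℂ) (hF : derivE F = (n : ℂ) • F)
    (hf : ∀ t ∈ Set.Ioo 0 Real.pi, ∀ u,
      f (chartPt R t u) = c * MvPolynomial.eval (frameVec ε R t u) F)
    (θ φ : ℝ) (hθ : θ ∈ Set.Ioo 0 Real.pi) :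
    -((Real.sin θ : ℂ) ^ (n : ℤ)) *
      (deriv (fun t : ℝ => (Real.sin t : ℂ) ^ (-(n : ℤ)) * f (chartPt R t φ)) θ +
        ε * Complex.I / (Real.sin θ : ℂ) *
          deriv (fun u : ℝ => (Real.sin θ : ℂ) ^ (-(n : ℤ)) * f (chartPt R θ u)) φ) =
      -c * MvPolynomial.eval (frameVec ε R θ φ) (derivD F) := by
  have hs0 : (Real.sin θ : ℂ) ≠ 0 :=
    Complex.ofReal_ne_zero.2 (Real.sin_pos_of_mem_Ioo hθ).ne'
  have h1 := hasDerivAt_eval F _ _ θ (hasDerivAt_frameVec_th ε R θ φ)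
  have h2 := hasDerivAt_eval F _ _ φ (hasDerivAt_frameVec_ph ε R θ φ)
  have hp : HasDerivAt (fun t : ℝ => (Real.sin t : ℂ) ^ (-(n : ℤ)))
      (((-(n : ℤ) : ℤ) : ℂ) * (Real.sin θ : ℂ) ^ (-(n : ℤ) - 1) * (Real.cos θ : ℂ)) θ :=
    HasDerivAt.comp (h₂ := fun z : ℂ => z ^ (-(n : ℤ))) (h := fun t : ℝ => (Real.sin t : ℂ)) θ
      (hasDerivAt_zpow (-(n : ℤ)) (Real.sin θ : ℂ) (Or.inl hs0))
      (Real.hasDerivAt_sin θ).ofReal_comp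
  have e1 : (fun t : ℝ => (Real.sin t : ℂ) ^ (-(n : ℤ)) * f (chartPt R t φ)) =ᶠ[nhds θ]
      (fun t : ℝ => (Real.sin t : ℂ) ^ (-(n : ℤ)) *
        (c * MvPolynomial.eval (frameVec ε R t φ) F)) := by
    filter_upwards [isOpen_Ioo.mem_nhds hθ] with t ht
    rw [hf t ht]
  have e2 : (fun u : ℝ => (Real.sin θ : ℂ) ^ (-(n : ℤ)) * f (chartPt R θ u)) =
      (fun u : ℝ => (Real.sin θ : ℂ) ^ (-(n : ℤ)) *
        (c * MvPolynomial.eval (frameVec ε R θ u) F)) := by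
    funext u
    rw [hf θ hθ]
  have e3 := (hp.fun_mul (h1.const_mul c)).deriv
  have e4 := ((h2.const_mul c).const_mul ((Real.sin θ : ℂ) ^ (-(n : ℤ)))).deriv
  have hEF := congrArg (MvPolynomial.eval (frameVec ε R θ φ)) hF
  have hE := congrArg (MvPolynomial.eval (frameVec ε R θ φ)) (derivation_eq_sum derivE F)
  have hD := congrArg (MvPolynomial.eval (frameVec ε R θ φ)) (derivation_eq_sum derivD F)
  rw [hEF] at hE
  simp only [derivE, derivD, map_sum, Fintype.sum_sum_type, map_mul, MvPolynomial.mkDerivation_X,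
    Sum.elim_inl, Sum.elim_inr, MvPolynomial.eval_X, zero_mul, Finset.sum_const_zero,
    zero_add, add_zero, MvPolynomial.smul_eval] at hE hD
  simp only [derivD]
  rw [e1.deriv_eq, e2, e3, e4, hD]
  have hε' : (ε : ℂ) ^ 2 = 1 := by exact_mod_cast hε
  have key : (∑ i, Sum.elim (fun i => ((R.1 *ᵥ thVec θ φ) i : ℂ))
        (fun i => -((R.1 *ᵥ sphVec θ φ) i : ℂ)) i *
          MvPolynomial.eval (frameVec ε R θ φ) (MvPolynomial.pderiv i F)) +
      ε * Complex.I / (Real.sin θ : ℂ) * (∑ i, Sum.elim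
        (fun i => (Real.sin θ : ℂ) * ((R.1 *ᵥ phVec φ) i : ℂ))
        (fun i => (Real.cos θ : ℂ) * ((R.1 *ᵥ phVec φ) i : ℂ) - Complex.I * ε *
          ((Real.sin θ : ℂ) * ((R.1 *ᵥ sphVec θ φ) i : ℂ) +
            (Real.cos θ : ℂ) * ((R.1 *ᵥ thVec θ φ) i : ℂ))) i *
          MvPolynomial.eval (frameVec ε R θ φ) (MvPolynomial.pderiv i F)) =
      (∑ x, frameVec ε R θ φ (Sum.inr x) *
        MvPolynomial.eval (frameVec ε R θ φ) (MvPolynomial.pderiv (Sum.inl x) F)) +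
      (Real.cos θ : ℂ) / (Real.sin θ : ℂ) *
        ((n : ℂ) * MvPolynomial.eval (frameVec ε R θ φ) F) := by
    rw [hE]
    simp only [Fintype.sum_sum_type, Sum.elim_inl, Sum.elim_inr, mul_add, Finset.mul_sum]
    rw [add_add_add_comm, ← Finset.sum_add_distrib, ← Finset.sum_add_distrib]
    congr 1
    · refine Finset.sum_congr rfl fun i _ => ?_
      simp only [frameVec, Sum.elim_inr]
      field_simp
    · refine Finset.sum_congr rfl fun i _ => ?_
      generalize MvPolynomial.eval (frameVec ε R θ φ) (MvPolynomial.pderiv (Sum.inr i) F) = x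
      simp only [frameVec, Sum.elim_inr]
      field_simp
      linear_combination (-(Complex.I ^ 2) * x *
        ((Real.sin θ : ℂ) * ((R.1 *ᵥ sphVec θ φ) i : ℂ) +
            (Real.cos θ : ℂ) * ((R.1 *ᵥ thVec θ φ) i : ℂ))) * hε' -
        (x * ((Real.sin θ : ℂ) * ((R.1 *ᵥ sphVec θ φ) i : ℂ) +
            (Real.cos θ : ℂ) * ((R.1 *ᵥ thVec θ φ) i : ℂ))) * Complex.I_sq
  rw [← eq_sub_iff_add_eq] at key
  rw [key, zpow_sub_one₀ hs0, zpow_neg, zpow_natCast]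
  have hsn : (Real.sin θ : ℂ) ^ n ≠ 0 := pow_ne_zero _ hs0
  field_simp
  push_cast
  ring

theorem rot_inv_rot (R : SO3) (p : S2) : rot R⁻¹ (rot R p) = p := by
  apply Subtype.ext
  change WithLp.toLp 2 ((R⁻¹).1 *ᵥ (R.1 *ᵥ p.1.ofLp)) = p.1
  rw [Matrix.mulVec_mulVec]
  have h : (R⁻¹).1 * R.1 = 1 := congrArg Subtype.val (inv_mul_cancel R)
  rw [h, Matrix.one_mulVec]

theorem rot_rot_inv (R : SO3) (p : S2) : rot R (rot R⁻¹ p) = p := by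
  have h := rot_inv_rot R⁻¹ p
  rwa [inv_inv] at h

theorem spherePt_angles (x : S2) :
    sphVec (Real.arccos (x.1 2)) (Complex.arg ⟨x.1 0, x.1 1⟩) = x.1.ofLp := by
  have hx := (mem_S2_iff x.1).1 x.2
  simp only [dotProduct, Fin.sum_univ_three] at hx
  have hn : ‖(⟨x.1 0, x.1 1⟩ : ℂ)‖ = Real.sin (Real.arccos (x.1 2)) := by
    rw [Real.sin_arccos, Complex.norm_def, Complex.normSq_mk]
    congr 1
    linarith
  have h1 := Complex.norm_mul_cos_arg ⟨x.1 0, x.1 1⟩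
  have h2 := Complex.norm_mul_sin_arg ⟨x.1 0, x.1 1⟩
  rw [hn] at h1 h2
  funext i
  fin_cases i
  · exact h1
  · exact h2
  · exact Real.cos_arccos (by nlinarith) (by nlinarith)

theorem mulVec_sphVec_colat_lon (R : SO3) (p : S2) :
    R.1 *ᵥ sphVec (colat R p) (lon R p) = p.1.ofLp := by
  rw [colat, lon, spherePt_angles]
  exact congrArg (fun q : S2 => q.1.ofLp) (rot_rot_inv R p)

theorem chartPt_colat_lon (R : SO3) (p : S2) : chartPt R (colat R p) (lon R p) = p := by
  apply Subtype.ext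
  change WithLp.toLp 2 (R.1 *ᵥ sphVec (colat R p) (lon R p)) = p.1
  rw [mulVec_sphVec_colat_lon]

theorem angles_chartPt (R : SO3) (θ φ : ℝ) (hθ : θ ∈ Set.Ioo 0 Real.pi) :
    colat R (chartPt R θ φ) = θ ∧ Real.cos (lon R (chartPt R θ φ)) = Real.cos φ ∧
      Real.sin (lon R (chartPt R θ φ)) = Real.sin φ := by
  have hs := Real.sin_pos_of_mem_Ioo hθ
  have hz : (⟨Real.sin θ * Real.cos φ, Real.sin θ * Real.sin φ⟩ : ℂ) =
      (Real.sin θ : ℂ) * (Complex.cos φ + Complex.sin φ * Complex.I) := by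
    apply Complex.ext <;> simp [← Complex.ofReal_cos, ← Complex.ofReal_sin]
  have hl : lon R (chartPt R θ φ) = Complex.arg ⟨Real.sin θ * Real.cos φ,
      Real.sin θ * Real.sin φ⟩ := by
    rw [lon, chartPt, rot_inv_rot]
    rfl
  have hn : ‖(⟨Real.sin θ * Real.cos φ, Real.sin θ * Real.sin φ⟩ : ℂ)‖ = Real.sin θ := by
    rw [Complex.norm_def, Complex.normSq_mk, Real.sqrt_eq_iff_mul_self_eq_of_pos hs]
    linear_combination -(Real.sin θ) ^ 2 * Real.sin_sq_add_cos_sq φ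
  refine ⟨?_, ?_, ?_⟩
  · rw [colat, chartPt, rot_inv_rot]
    exact Real.arccos_cos hθ.1.le hθ.2.le
  · have h1 := Complex.norm_mul_cos_arg ⟨Real.sin θ * Real.cos φ, Real.sin θ * Real.sin φ⟩
    rw [hn] at h1
    rw [hl]
    exact mul_left_cancel₀ hs.ne' h1
  · have h1 := Complex.norm_mul_sin_arg ⟨Real.sin θ * Real.cos φ, Real.sin θ * Real.sin φ⟩
    rw [hn] at h1
    rw [hl]
    exact mul_left_cancel₀ hs.ne' h1

theorem frameVec_congr (ε : ℝ) (R : SO3) (θ φ φ' : ℝ) (hc : Real.cos φ' = Real.cos φ)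
    (hs : Real.sin φ' = Real.sin φ) : frameVec ε R θ φ' = frameVec ε R θ φ := by
  simp only [frameVec, sphVec, thVec, phVec, hc, hs]

theorem ethPow_chartPt (l : ℕ) (m : ℤ) (R : SO3) (n : ℕ) :
    ∀ t ∈ Set.Ioo 0 Real.pi, ∀ u, ethPow R (scalarHarmonic l m) n (chartPt R t u) =
      (-1) ^ n * MvPolynomial.eval (frameVec 1 R t u) (derivD^[n] (harmonicPoly l m)) := by
  induction n with
  | zero =>
    intro t _ u
    rw [pow_zero, one_mul]
    exact (harmonicPoly_eval l m (chartPt R t u) _).symm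
  | succ n ih =>
    intro t ht u
    obtain ⟨h1, h2, h3⟩ := angles_chartPt R t u ht
    have h := edth_frame 1 (one_pow 2) R n _ _ _ (derivE_iter l m n) ih t
      (lon R (chartPt R t u)) ht
    rw [frameVec_congr 1 R t _ _ h2 h3] at h
    rw [ethPow, eth, h1, Function.iterate_succ_apply', pow_succ, mul_neg_one, ← h,
      Complex.ofReal_one, one_mul]

theorem negEthBarPow_chartPt (l : ℕ) (m : ℤ) (R : SO3) (n : ℕ) :
    ∀ t ∈ Set.Ioo 0 Real.pi, ∀ u, negEthBarPow R (scalarHarmonic l m) n (chartPt R t u) =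
      MvPolynomial.eval (frameVec (-1) R t u) (derivD^[n] (harmonicPoly l m)) := by
  induction n with
  | zero =>
    intro t _ u
    exact (harmonicPoly_eval l m (chartPt R t u) _).symm
  | succ n ih =>
    intro t ht u
    obtain ⟨h1, h2, h3⟩ := angles_chartPt R t u ht
    have h := edth_frame (-1) (by norm_num) R n 1 _ _ (derivE_iter l m n)
      (fun t ht u => (ih t ht u).trans (one_mul _).symm) t (lon R (chartPt R t u)) ht
    rw [frameVec_congr (-1) R t _ _ h2 h3, neg_one_mul, eq_comm, neg_eq_iff_eq_neg] at h
    rw [negEthBarPow, Pi.neg_apply, ethBar, h1, Function.iterate_succ_apply', h, neg_neg]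
    push_cast
    ring

/-- The frame at a point of the sphere, in the coordinates of the chart rotated by `R`. -/
def frameAt (ε : ℝ) (R : SO3) (p : S2) : Fin 3 ⊕ Fin 3 → ℂ := frameVec ε R (colat R p) (lon R p)

/-- A bounded measurable representative of the spin harmonic, given by differentiating an ambient
polynomial along the complex tangent vector. -/
def spinHarmonicRep (s : ℤ) (l : ℕ) (m : ℤ) (R : SO3) (p : S2) : ℂ :=
  ((√((l - s.natAbs).factorial / (l + s.natAbs).factorial) : ℝ) : ℂ) *
    (if 0 ≤ s then (-1) ^ s.natAbs *
        MvPolynomial.eval (frameAt 1 R p) (derivD^[s.natAbs] (harmonicPoly l m))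
      else MvPolynomial.eval (frameAt (-1) R p) (derivD^[s.natAbs] (harmonicPoly l m)))

theorem surf_singleton (p : S2) : surf {p} = 0 := by
  rw [Measure.toSphere_apply' _ (measurableSet_singleton p), Set.image_singleton]
  have h : (volume : Measure (EuclideanSpace ℝ (Fin 3)))
      (Submodule.span ℝ {(p : EuclideanSpace ℝ (Fin 3))}) = 0 := by
    apply Measure.addHaar_submodule
    intro h
    have h1 := finrank_span_le_card (R := ℝ) {(p : EuclideanSpace ℝ (Fin 3))}
    rw [h, finrank_top] at h1
    simp at h1
  rw [measure_mono_null _ h, mul_zero]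
  rintro _ ⟨r, _, _, rfl, rfl⟩
  exact Submodule.smul_mem _ _ (Submodule.mem_span_singleton_self _)

theorem ae_colat (R : SO3) : ∀ᵐ p ∂surf, colat R p ∈ Set.Ioo 0 Real.pi := by
  have h1 : ∀ θ₀ : ℝ, Real.sin θ₀ = 0 → ∀ᵐ p ∂surf, colat R p ≠ θ₀ := by
    intro θ₀ h0
    rw [ae_iff]
    refine measure_mono_null ?_ (surf_singleton (chartPt R θ₀ 0))
    intro p hp
    have hp' : colat R p = θ₀ := by simpa using hp
    have h2 := chartPt_colat_lon R p
    rw [hp'] at h2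
    rw [Set.mem_singleton_iff, ← h2]
    apply Subtype.ext
    change WithLp.toLp 2 (R.1 *ᵥ sphVec _ _) = WithLp.toLp 2 (R.1 *ᵥ sphVec _ _)
    simp [sphVec, h0]
  filter_upwards [h1 0 Real.sin_zero, h1 Real.pi Real.sin_pi] with p h2 h3
  exact ⟨lt_of_le_of_ne (Real.arccos_nonneg _) (Ne.symm h2),
    lt_of_le_of_ne (Real.arccos_le_pi _) h3⟩

theorem spinHarmonicFun_ae_eq (s : ℤ) (l : ℕ) (m : ℤ) (R : SO3) :
    spinHarmonicFun s l m R =ᵐ[surf] spinHarmonicRep s l m R := by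
  filter_upwards [ae_colat R] with p hp
  have h1 := ethPow_chartPt l m R s.natAbs _ hp (lon R p)
  have h2 := negEthBarPow_chartPt l m R s.natAbs _ hp (lon R p)
  rw [chartPt_colat_lon] at h1 h2
  rw [spinHarmonicFun, spinHarmonicRep, h1, h2]
  rfl

theorem continuous_frameVec (ε : ℝ) (R : SO3) :
    Continuous fun x : ℝ × ℝ => frameVec ε R x.1 x.2 := by
  rw [continuous_pi_iff]
  rintro (i | i) <;>
    simp only [frameVec, Sum.elim_inl, Sum.elim_inr, Matrix.mulVec, dotProduct,
      Fin.sum_univ_three, sphVec, thVec, phVec, Matrix.cons_val] <;>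
    fun_prop

theorem measurable_rot (R : SO3) (i : Fin 3) : Measurable fun p : S2 => (rot R p).1 i := by
  apply Continuous.measurable
  change Continuous fun p : S2 => (R.1 *ᵥ p.1.ofLp) i
  simp only [Matrix.mulVec, dotProduct]
  fun_prop

theorem measurable_colat (R : SO3) : Measurable (colat R) :=
  Real.continuous_arccos.measurable.comp (measurable_rot R⁻¹ 2)

theorem measurable_lon (R : SO3) : Measurable (lon R) := by
  refine Complex.measurable_arg.comp ?_
  have : (fun p : S2 => (⟨(rot R⁻¹ p).1 0, (rot R⁻¹ p).1 1⟩ : ℂ)) =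
      fun p => ((rot R⁻¹ p).1 0 : ℂ) + ((rot R⁻¹ p).1 1 : ℂ) * Complex.I := by
    funext p
    exact Complex.mk_eq_add_mul_I _ _
  rw [this]
  exact (Complex.measurable_ofReal.comp (measurable_rot R⁻¹ 0)).add
    ((Complex.measurable_ofReal.comp (measurable_rot R⁻¹ 1)).mul_const _)

theorem measurable_frameAt (ε : ℝ) (R : SO3) : Measurable (frameAt ε R) :=
  Measurable.comp (g := fun x : ℝ × ℝ => frameVec ε R x.1 x.2)
    (f := fun p => (colat R p, lon R p)) (continuous_frameVec ε R).measurable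
    ((measurable_colat R).prodMk (measurable_lon R))

theorem norm_frameAt_le (ε : ℝ) (R : SO3) : ∃ C : ℝ, ∀ p, ‖frameAt ε R p‖ ≤ C := by
  have hc := continuous_frameVec ε R
  obtain ⟨C, hC⟩ := ((isCompact_Icc (a := (0 : ℝ)) (b := Real.pi)).prod
    (isCompact_Icc (a := -Real.pi) (b := Real.pi))).exists_bound_of_continuousOn hc.continuousOn
  exact ⟨C, fun p => hC (colat R p, lon R p) ⟨⟨Real.arccos_nonneg _, Real.arccos_le_pi _⟩,
    ⟨(Complex.neg_pi_lt_arg _).le, Complex.arg_le_pi _⟩⟩⟩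

theorem memLp_eval_frameAt (ε : ℝ) (R : SO3) (F : MvPolynomial (Fin 3 ⊕ Fin 3) ℂ) :
    MemLp (fun p => MvPolynomial.eval (frameAt ε R p) F) 2 surf := by
  have hc : Continuous fun v : Fin 3 ⊕ Fin 3 → ℂ => MvPolynomial.eval v F :=
    MvPolynomial.continuous_eval F
  obtain ⟨C, hC⟩ := norm_frameAt_le ε R
  obtain ⟨K, hK⟩ := (isCompact_closedBall (0 : Fin 3 ⊕ Fin 3 → ℂ) C).exists_bound_of_continuousOn
    hc.continuousOn
  refine MemLp.of_bound (hc.measurable.comp (measurable_frameAt ε R)).aestronglyMeasurable K ?_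
  exact Filter.Eventually.of_forall fun p => hK _ (by simpa using hC p)

theorem memLp_spinHarmonicFun (s : ℤ) (l : ℕ) (m : ℤ) (R : SO3) :
    MemLp (spinHarmonicFun s l m R) 2 surf := by
  refine MemLp.ae_eq (spinHarmonicFun_ae_eq s l m R).symm ?_
  unfold spinHarmonicRep
  refine MemLp.const_mul ?_ _
  split_ifs
  · exact (memLp_eval_frameAt 1 R _).const_mul _
  · exact memLp_eval_frameAt (-1) R _

theorem continuous_scalarHarmonic (l : ℕ) (m : ℤ) : Continuous (scalarHarmonic l m) := by
  have h : scalarHarmonic l m = fun p : S2 =>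
      MvPolynomial.eval (Sum.elim (fun i => (p.1 i : ℂ)) (fun _ => 0)) (harmonicPoly l m) := by
    funext p
    exact (harmonicPoly_eval l m p _).symm
  rw [h]
  refine (MvPolynomial.continuous_eval (harmonicPoly l m)).comp ?_
  rw [continuous_pi_iff]
  rintro (i | i)
  · simp only [Sum.elim_inl]
    fun_prop
  · exact continuous_const

theorem memLp_scalarHarmonic (l : ℕ) (m : ℤ) : MemLp (scalarHarmonic l m) 2 surf := by
  obtain ⟨K, hK⟩ := isCompact_univ.exists_bound_of_continuousOn
    (continuous_scalarHarmonic l m).continuousOn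
  exact MemLp.of_bound (continuous_scalarHarmonic l m).measurable.aestronglyMeasurable K
    (Filter.Eventually.of_forall fun p => hK p (Set.mem_univ p))

theorem SO3.cross (R : SO3) (a b : Fin 3 → ℝ) :
    (R.1 *ᵥ a) ⨯₃ (R.1 *ᵥ b) = R.1 *ᵥ (a ⨯₃ b) := by
  have hdet : R.1.det = 1 := (Matrix.mem_specialOrthogonalGroup_iff.1 R.2).2
  have hadj : R.1.adjugate = R.1ᵀ := by
    have h := Matrix.adjugate_mul R.1
    have h2 : R.1 * R.1ᵀ = 1 := by
      have h := SO3.transpose_mul R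
      rwa [mul_eq_one_comm] at h
    calc R.1.adjugate = R.1.adjugate * (R.1 * R.1ᵀ) := by rw [h2, mul_one]
      _ = R.1ᵀ := by rw [← mul_assoc, h, hdet, one_smul, one_mul]
  have e : ∀ i j, R.1.adjugate j i = R.1 i j := fun i j => by rw [hadj]; rfl
  rw [Matrix.adjugate_fin_three] at e
  have e00 := e 0 0
  have e01 := e 0 1
  have e02 := e 0 2
  have e10 := e 1 0
  have e11 := e 1 1
  have e12 := e 1 2
  have e20 := e 2 0
  have e21 := e 2 1
  have e22 := e 2 2
  simp only [Matrix.of_apply, Matrix.cons_val] at e00 e01 e02 e10 e11 e12 e20 e21 e22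
  rw [cross_apply, cross_apply]
  funext i
  fin_cases i <;>
    simp only [Matrix.mulVec, dotProduct, Fin.sum_univ_three, Matrix.cons_val, Fin.zero_eta,
      Fin.mk_one, Fin.reduceFinMk]
  · linear_combination (a 1 * b 2 - a 2 * b 1) * e00 + (a 2 * b 0 - a 0 * b 2) * e01 +
      (a 0 * b 1 - a 1 * b 0) * e02
  · linear_combination (a 1 * b 2 - a 2 * b 1) * e10 + (a 2 * b 0 - a 0 * b 2) * e11 +
      (a 0 * b 1 - a 1 * b 0) * e12
  · linear_combination (a 1 * b 2 - a 2 * b 1) * e20 + (a 2 * b 0 - a 0 * b 2) * e21 +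
      (a 0 * b 1 - a 1 * b 0) * e22

theorem mulVec_thVec (R : SO3) (p : S2) :
    R.1 *ᵥ thVec (colat R p) (lon R p) = refDir R p ⨯₃ p.1.ofLp := by
  have h : thVec (colat R p) (lon R p) = phVec (lon R p) ⨯₃ sphVec (colat R p) (lon R p) := by
    rw [cross_apply]
    funext i
    fin_cases i <;> simp only [thVec, phVec, sphVec, Matrix.cons_val, Fin.zero_eta,
      Fin.mk_one, Fin.reduceFinMk]
    · ring
    · ring
    · linear_combination Real.sin (colat R p) * Real.sin_sq_add_cos_sq (lon R p)
  rw [h, ← SO3.cross, mulVec_sphVec_colat_lon]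
  rfl

theorem refDir_dot_self (R : SO3) (p : S2) : refDir R p ⬝ᵥ refDir R p = 1 := by
  rw [refDir, SO3.dot]
  simp only [dotProduct, Fin.sum_univ_three, Matrix.cons_val]
  linear_combination Real.sin_sq_add_cos_sq (lon R p)

theorem refDir_dot_point (R : SO3) (p : S2) : refDir R p ⬝ᵥ p.1.ofLp = 0 := by
  rw [← mulVec_sphVec_colat_lon R p, refDir, SO3.dot]
  simp only [dotProduct, Fin.sum_univ_three, sphVec, Matrix.cons_val]
  ring

theorem refDir_eq (R₁ R₂ : SO3) (p : S2) :
    refDir R₂ p = (refDir R₁ p ⬝ᵥ refDir R₂ p) • refDir R₁ p +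
      ((refDir R₁ p ⨯₃ p.1.ofLp) ⬝ᵥ refDir R₂ p) • (refDir R₁ p ⨯₃ p.1.ofLp) := by
  have hp := (mem_S2_iff p.1).1 p.2
  have h1 := refDir_dot_self R₁ p
  have h1p := refDir_dot_point R₁ p
  have h2p := refDir_dot_point R₂ p
  generalize refDir R₁ p = u at *
  generalize refDir R₂ p = v at *
  generalize p.1.ofLp = q at *
  have e1 := cross_cross_eq_smul_sub_smul' u v u
  have e2 := cross_cross_eq_smul_sub_smul' q v u
  have e3 := cross_cross_eq_smul_sub_smul' q q (v ⨯₃ u)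
  rw [dotProduct_comm q u, h1p, h2p, zero_smul, zero_smul, sub_zero] at e2
  rw [e2, map_zero, hp, one_smul, eq_comm, sub_eq_zero] at e3
  rw [← e3, map_smul, h1, one_smul, eq_sub_iff_add_eq] at e1
  have e4 : q ⬝ᵥ v ⨯₃ u = (u ⨯₃ q) ⬝ᵥ v := by
    rw [← triple_product_permutation, ← triple_product_permutation, dotProduct_comm]
  rw [e4, add_comm] at e1
  rw [dotProduct_comm u v]
  exact e1.symm

theorem frameAt_inr (ε : ℝ) (R : SO3) (p : S2) (i : Fin 3) :
    frameAt ε R p (Sum.inr i) =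
      ((refDir R p ⨯₃ p.1.ofLp) i : ℂ) + Complex.I * ε * (refDir R p i : ℂ) := by
  rw [← mulVec_thVec]
  rfl

theorem frameAt_inl (ε : ℝ) (R : SO3) (p : S2) (i : Fin 3) :
    frameAt ε R p (Sum.inl i) = (p.1 i : ℂ) := by
  change (((R.1 *ᵥ sphVec (colat R p) (lon R p)) i : ℝ) : ℂ) = _
  rw [mulVec_sphVec_colat_lon]

theorem exp_spinAngle (R₁ R₂ : SO3) (p : S2) :
    Complex.exp (Complex.I * spinAngle p R₂ R₁) =
      ⟨refDir R₁ p ⬝ᵥ refDir R₂ p, (refDir R₁ p ⨯₃ p.1.ofLp) ⬝ᵥ refDir R₂ p⟩ := by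
  have hn : ‖(⟨refDir R₁ p ⬝ᵥ refDir R₂ p, (refDir R₁ p ⨯₃ p.1.ofLp) ⬝ᵥ refDir R₂ p⟩ : ℂ)‖ = 1 := by
    rw [Complex.norm_def, Complex.normSq_mk, Real.sqrt_eq_one]
    have h := congrArg (fun v => v ⬝ᵥ refDir R₂ p) (refDir_eq R₁ R₂ p)
    simp only [add_dotProduct, smul_dotProduct, smul_eq_mul, refDir_dot_self] at h
    exact h.symm
  have h := Complex.norm_mul_exp_arg_mul_I
    ⟨refDir R₁ p ⬝ᵥ refDir R₂ p, (refDir R₁ p ⨯₃ p.1.ofLp) ⬝ᵥ refDir R₂ p⟩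
  rw [hn, Complex.ofReal_one, one_mul] at h
  rw [spinAngle, mul_comm, h]

theorem frameAt_change (ε : ℝ) (hε : ε = 1 ∨ ε = -1) (R₁ R₂ : SO3) (p : S2) (i : Fin 3) :
    frameAt ε R₂ p (Sum.inr i) =
      Complex.exp (ε * (Complex.I * spinAngle p R₂ R₁)) * frameAt ε R₁ p (Sum.inr i) := by
  have h := refDir_eq R₁ R₂ p
  have hz := exp_spinAngle R₁ R₂ p
  have hp := (mem_S2_iff p.1).1 p.2
  have h1p := refDir_dot_point R₁ p
  rw [frameAt_inr, frameAt_inr]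
  rw [Complex.mk_eq_add_mul_I] at hz
  generalize refDir R₁ p ⬝ᵥ refDir R₂ p = a at *
  generalize (refDir R₁ p ⨯₃ p.1.ofLp) ⬝ᵥ refDir R₂ p = b at *
  have hx : refDir R₂ p ⨯₃ p.1.ofLp = a • (refDir R₁ p ⨯₃ p.1.ofLp) - b • refDir R₁ p := by
    rw [h, map_add, map_smul, map_smul, LinearMap.add_apply, LinearMap.smul_apply,
      LinearMap.smul_apply, cross_cross_eq_smul_sub_smul, h1p, hp, zero_smul, one_smul, zero_sub,
      smul_neg, sub_eq_add_neg]
  have hexp : Complex.exp (ε * (Complex.I * spinAngle p R₂ R₁)) = a + ε * b * Complex.I := by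
    rcases hε with rfl | rfl
    · simpa using hz
    · have h2 := congrArg (starRingEnd ℂ) hz
      rw [← Complex.exp_conj] at h2
      simpa [← sub_eq_add_neg] using h2
  have hε2 : (ε : ℂ) ^ 2 = 1 := by rcases hε with rfl | rfl <;> norm_num
  have hxi := congrFun hx i
  have hi := congrFun h i
  simp only [Pi.add_apply, Pi.sub_apply, Pi.smul_apply, smul_eq_mul] at hxi hi
  rw [hexp, hxi, hi]
  push_cast
  linear_combination (-(b : ℂ) * (refDir R₁ p i : ℂ) * Complex.I ^ 2) * hε2 -
    (b : ℂ) * (refDir R₁ p i : ℂ) * Complex.I_sq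

theorem eval_scale (z : ℂ) (v w : Fin 3 ⊕ Fin 3 → ℂ) (h1 : ∀ i, w (Sum.inl i) = v (Sum.inl i))
    (h2 : ∀ i, w (Sum.inr i) = z * v (Sum.inr i)) (l : ℕ) (m : ℤ) (n : ℕ) :
    MvPolynomial.eval w (derivD^[n] (harmonicPoly l m)) =
      z ^ n * MvPolynomial.eval v (derivD^[n] (harmonicPoly l m)) := by
  let σ : MvPolynomial (Fin 3 ⊕ Fin 3) ℂ →ₐ[ℂ] MvPolynomial (Fin 3 ⊕ Fin 3) ℂ :=
    MvPolynomial.aeval (Sum.elim (fun i => MvPolynomial.X (Sum.inl i))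
      (fun i => MvPolynomial.C z * MvPolynomial.X (Sum.inr i)))
  have hσ : ∀ F, MvPolynomial.eval w F = MvPolynomial.eval v (σ F) := by
    intro F
    induction F using MvPolynomial.induction_on with
    | C a => simp [σ, MvPolynomial.algebraMap_eq]
    | add a b ha hb => simp [ha, hb]
    | mul_X a i ha => rcases i with i | i <;> simp [ha, σ, h1, h2]
  have hD : ∀ F, σ (derivD F) = MvPolynomial.C z * derivD (σ F) := by
    intro F
    induction F using MvPolynomial.induction_on with
    | C a => simp [σ, MvPolynomial.algebraMap_eq, derivD]
    | add a b ha hb => simp [ha, hb, mul_add]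
    | mul_X a i ha =>
      rw [Derivation.leibniz, map_mul, Derivation.leibniz, map_add, smul_eq_mul, smul_eq_mul,
        smul_eq_mul, smul_eq_mul, map_mul, map_mul, ha]
      rcases i with i | i <;> simp [σ, derivD] <;> ring
  have h0 : σ (harmonicPoly l m) = harmonicPoly l m := by
    rw [harmonicPoly]
    exact DFunLike.congr_fun (MvPolynomial.algHom_ext
      (f := σ.comp (MvPolynomial.rename Sum.inl)) (g := MvPolynomial.rename Sum.inl)
      (fun i => by simp [σ])) _
  have hn : σ (derivD^[n] (harmonicPoly l m)) =
      MvPolynomial.C (z ^ n) * derivD^[n] (harmonicPoly l m) := by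
    induction n with
    | zero => simp [h0]
    | succ n ih =>
      rw [Function.iterate_succ_apply', hD, ih, Derivation.leibniz,
        MvPolynomial.derivation_C, pow_succ', MvPolynomial.C_mul]
      simp only [smul_eq_mul, mul_zero, add_zero, mul_assoc]
  rw [hσ, hn, map_mul, MvPolynomial.eval_C]

theorem spinHarmonicRep_change (s : ℤ) (l : ℕ) (m : ℤ) (R₁ R₂ : SO3) (p : S2) :
    spinHarmonicRep s l m R₂ p =
      Complex.exp (Complex.I * s * spinAngle p R₂ R₁) * spinHarmonicRep s l m R₁ p := by
  have h : ∀ ε : ℝ, (ε = 1 ∨ ε = -1) → MvPolynomial.eval (frameAt ε R₂ p)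
      (derivD^[s.natAbs] (harmonicPoly l m)) =
      Complex.exp (ε * (Complex.I * spinAngle p R₂ R₁)) ^ s.natAbs *
        MvPolynomial.eval (frameAt ε R₁ p) (derivD^[s.natAbs] (harmonicPoly l m)) := fun ε hε =>
    eval_scale _ _ _ (fun i => by rw [frameAt_inl, frameAt_inl])
      (frameAt_change ε hε R₁ R₂ p) l m _
  unfold spinHarmonicRep
  rw [h 1 (Or.inl rfl), h (-1) (Or.inr rfl), ← Complex.exp_nat_mul, ← Complex.exp_nat_mul]
  split_ifs with hs
  · have e : (s.natAbs : ℂ) = s := by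
      rw [← Int.cast_natCast, Int.natAbs_of_nonneg hs]
    rw [e, Complex.ofReal_one, one_mul, mul_comm Complex.I (s : ℂ), mul_assoc]
    ring
  · have e : (s.natAbs : ℂ) = -s := by
      rw [← Int.cast_natCast, Int.ofNat_natAbs_of_nonpos (by omega), Int.cast_neg]
    rw [e]
    push_cast
    have e2 : -(s : ℂ) * (-1 * (Complex.I * spinAngle p R₂ R₁)) =
      Complex.I * s * spinAngle p R₂ R₁ := by ring
    rw [e2]
    ring

/-- The spin spherical harmonic `Y_{lm,s}` as an element of `L²_s`. -/
def spinHarmonic (s : ℤ) (l : ℕ) (m : ℤ) : SpinL2 s :=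
  ⟨fun R => (memLp_spinHarmonicFun s l m R).toLp _, by
    intro R₁ R₂
    filter_upwards [(memLp_spinHarmonicFun s l m R₁).coeFn_toLp,
      (memLp_spinHarmonicFun s l m R₂).coeFn_toLp, spinHarmonicFun_ae_eq s l m R₁,
      spinHarmonicFun_ae_eq s l m R₂] with p h1 h2 h3 h4
    rw [h1, h2, h3, h4, spinHarmonicRep_change]⟩

/-- The scalar spherical harmonic `Y_{lm}` as an element of `L²`. -/
def scalarHarmonicL2 (l : ℕ) (m : ℤ) : ScalarL2 := (memLp_scalarHarmonic l m).toLp _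

/-! ### Eigenvalues and eigenspaces -/

/-- The eigenvalue `e_{ls} = (l - |s|)(l + |s| + 1)` of the spin spherical Laplacian. -/
def eigenvalue (l : ℕ) (s : ℤ) : ℝ := ((l : ℝ) - |(s : ℝ)|) * ((l : ℝ) + |(s : ℝ)| + 1)

/-- `H_{ls}`, the span in `L²_s` of the `Y_{lm,s}`, `-l ≤ m ≤ l` (for `l ≥ |s|`). -/
def spinEigenspace (s : ℤ) (l : ℕ) : Submodule ℂ (SpinL2 s) :=
  Submodule.span ℂ ((fun m : ℤ => spinHarmonic s l m) '' Set.Icc (-(l : ℤ)) l)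

/-- `(I - P) L²_s`, where `P` is the orthogonal projection onto `H_{|s|,s}`. -/
def spinHighFreq (s : ℤ) : Submodule ℂ (SpinL2 s) := (spinEigenspace s s.natAbs)ᗮ

/-- `H_l`, the space of scalar spherical harmonics of degree `l`, in `L²`. -/
def scalarEigenspace (l : ℕ) : Submodule ℂ ScalarL2 :=
  Submodule.span ℂ ((fun m : ℤ => scalarHarmonicL2 l m) '' Set.Icc (-(l : ℤ)) l)

/-- `H^s`, the Hilbert space direct sum of the `H_l`, `l ≥ |s|`, in `L²`. -/
def scalarHighDegree (s : ℤ) : Submodule ℂ ScalarL2 :=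
  (⨆ l : Set.Ici s.natAbs, scalarEigenspace l).topologicalClosure

/-! ### Windows, cubature, needlets -/

/-- `φ` is smooth, even, non-increasing on `[0, ∞)`, supported in `[-1, 1]`, with values in `[0, 1]`
and equal to `1` on `[-1/B, 1/B]`; and `b² = φ(·/B) - φ`. -/
structure IsNeedletWindow (B : ℝ) (φ b : ℝ → ℝ) : Prop where
  smooth : ContDiff ℝ ∞ φ
  even : ∀ x, φ (-x) = φ x
  antitone : AntitoneOn φ (Set.Ici 0)
  supp : ∀ x, 1 < |x| → φ x = 0
  nonneg : ∀ x, 0 ≤ φ x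
  le_one : ∀ x, φ x ≤ 1
  eq_one : ∀ x, |x| ≤ 1 / B → φ x = 1
  sq_eq : ∀ x, b x ^ 2 = φ (x / B) - φ x

/-- `L_j`: the largest integer `l` (`≥ |s|`) with `e_{ls} ≤ B^{2(j+1)}`. -/
def needletDegree (B : ℝ) (s j : ℤ) : ℕ :=
  sSup {l : ℕ | s.natAbs ≤ l ∧ eigenvalue l s ≤ B ^ (2 * (j + 1))}

/-- Points `ξ_k` of the sphere and weights `w_k ≥ 0`, `k < n`, that integrate exactly every
polynomial of degree at most `d`. -/
structure IsCubature (d : ℕ) {n : ℕ} (ξ : Fin n → S2) (w : Fin n → ℝ) : Prop where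
  weight_nonneg : ∀ k, 0 ≤ w k
  exact_poly : ∀ q : MvPolynomial (Fin 3) ℝ, q.totalDegree ≤ d →
    ∫ p, MvPolynomial.eval p.1.ofLp q ∂surf = ∑ k, w k * MvPolynomial.eval (ξ k).1.ofLp q

/-- The scalar needlet at scale `j` with cubature point `ξ` and weight `w`. -/
def scalarNeedlet (s : ℤ) (B : ℝ) (b : ℝ → ℝ) (j : ℤ) (ξ : S2) (w : ℝ) : ScalarL2 :=
  ((√w : ℝ) : ℂ) • ∑' l : Set.Ici s.natAbs, ((b (√(eigenvalue l s) / B ^ j) : ℝ) : ℂ) •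
    ∑ m ∈ Finset.Icc (-(l : ℤ)) l,
      (starRingEnd ℂ) (scalarHarmonic l m ξ) • scalarHarmonicL2 l m

/-- The mixed needlet at scale `j` with cubature point `ξ` and weight `w`; for a needlet window `b`
only finitely many terms of the sum over `l ≥ |s|` are non-zero. -/
def mixedNeedlet (s : ℤ) (B : ℝ) (b : ℝ → ℝ) (j : ℤ) (ξ : S2) (w : ℝ) : SpinL2 s :=
  ((√w : ℝ) : ℂ) • ∑' l : Set.Ici s.natAbs, ((b (√(eigenvalue l s) / B ^ j) : ℝ) : ℂ) •
    ∑ m ∈ Finset.Icc (-(l : ℤ)) l,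
      (starRingEnd ℂ) (scalarHarmonic l m ξ) • spinHarmonic s l m

end

end MixedNeedlets

open MixedNeedlets

/-! Three facts give the tight frame. The `Y_{lm,s}` with `l ≥ |s|` form a Hilbert basis of `L²_s`
(`spinBasis`). The cubature formula reproduces inner products of scalar harmonics of degree at most
`L_j`, since a product of two of them has degree at most `2 L_j` (`IsCubature.sum_scalarHarmonic`).
The squares `b(x / B^j)²` telescope to `1` over `j` for `x > 0` (`IsNeedletWindow.hasSum_sq`). A
mixed needlet pairs scalar values `Y_{lm}(ξ)` with spin vectors `Y_{lm,s}`, so only products of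
scalar harmonics are ever discretised. Hence the energy of the coefficients at scale `j` is the sum
of `b² |⟨F, Y_{lm,s}⟩|²`. Summing over `j` gives `‖F‖²`, once the level `l = |s|` is removed: its
eigenvalue is `0` and `b(0) = 0`. The Parseval identity says that the analysis operator `T` is an
isometry, and `T* T = 1` is the reconstruction formula. The unitary map exists because the scalar
and the spin harmonics are Hilbert bases with the same index set.

The main work is the Hilbert basis. In the standard chart put `T = sin ϑ / (1 + σ cos ϑ)`, `σ = ±1`.
For the right sign, `e^{imφ} T^{|m|}` is annihilated by `∂_ϑ ± i (sin ϑ)⁻¹ ∂_φ`, so `ð` acts on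
`e^{imφ} sin^n ϑ T^{|m|} g(cos ϑ)` by replacing `g` with `g'` and `n` with `n + 1` (`edth_profile`).
The profile of `Y_{lm,s}` is therefore governed by the `|s|`-th derivative of one explicit
polynomial, which solves a second order equation. Its Sturm–Liouville form yields orthogonality and
the norms (`profileInt_succ`). For completeness, the polynomial factors belonging to a fixed `m`
have degrees `0, 1, 2, …` and hence span all polynomials; the Weierstrass and Stone–Weierstrass
theorems do the rest.

Cubature formulas exist by Tchakaloff's argument: the mean of the vector of monomials lies in the
convex hull of its values. -/

namespace MixedNeedlets

noncomputable section

/-! ### Integration over the sphere -/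

/-- A rotation as a linear isometry of Euclidean space. -/
def SO3.isometry (R : SO3) : EuclideanSpace ℝ (Fin 3) ≃ₗᵢ[ℝ] EuclideanSpace ℝ (Fin 3) :=
  LinearIsometry.toLinearIsometryEquiv
    ⟨Matrix.toEuclideanLin R.1, fun x => by
      rw [EuclideanSpace.norm_eq, EuclideanSpace.norm_eq]
      congr 1
      have h := SO3.dot R x.ofLp x.ofLp
      simp only [dotProduct, ← sq] at h
      simpa [Matrix.toLpLin_apply] using h⟩ rfl

theorem SO3.isometry_coe (R : SO3) (p : S2) : R.isometry p.1 = (rot R p).1 := rfl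

theorem continuous_rot (R : SO3) : Continuous (rot R) :=
  (R.isometry.continuous.comp continuous_subtype_val).subtype_mk _

-- Surface measure is a multiple of the volume of the cone over a set, and a rotation maps cones to
-- cones and preserves volume.
open scoped Pointwise in
theorem measurePreserving_rot (R : SO3) : MeasurePreserving (rot R) surf surf := by
  refine ⟨(continuous_rot R).measurable, Measure.ext fun t ht => ?_⟩
  rw [Measure.map_apply (continuous_rot R).measurable ht,
    Measure.toSphere_apply' _ ((continuous_rot R).measurable ht), Measure.toSphere_apply' _ ht,
    ← R.isometry.measurePreserving.measure_preimage_equiv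
      (f := R.isometry.toHomeomorph.toMeasurableEquiv) (Set.Ioo (0 : ℝ) 1 • (Subtype.val '' t))]
  congr 2
  ext x
  simp only [Set.mem_smul, Set.mem_preimage, Set.mem_image]
  constructor
  · rintro ⟨r, hr, _, ⟨p, hp, rfl⟩, rfl⟩
    exact ⟨r, hr, _, ⟨rot R p, hp, rfl⟩, (R.isometry.map_smul r p.1).symm⟩
  · rintro ⟨r, hr, _, ⟨p, hp, rfl⟩, h⟩
    refine ⟨r, hr, _, ⟨rot R⁻¹ p, by rwa [rot_rot_inv], rfl⟩, ?_⟩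
    apply R.isometry.injective
    rw [map_smul, SO3.isometry_coe, rot_rot_inv]
    exact h

/-- Polar coordinates carry Lebesgue measure to the product of surface measure and `r² dr`. The
value `0` at the origin is immaterial, the origin being a null set. -/
theorem integral_polar (f : S2 → ℝ) (g : ℝ → ℝ) :
    ∫ x : EuclideanSpace ℝ (Fin 3), (if h : x ≠ 0 then
      f ⟨‖x‖⁻¹ • x, by simp [norm_smul, h]⟩ else 0) * g ‖x‖ =
    (∫ p, f p ∂surf) * ∫ r in Set.Ioi (0 : ℝ), r ^ 2 * g r := by
  have hfr : Module.finrank ℝ (EuclideanSpace ℝ (Fin 3)) - 1 = 2 := by simp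
  have h := (volume : Measure (EuclideanSpace ℝ (Fin 3))).measurePreserving_homeomorphUnitSphereProd
    |>.integral_comp (Homeomorph.measurableEmbedding _) (fun z => f z.1 * g z.2)
  rw [integral_prod_mul (f := f) (g := fun r : Set.Ioi (0 : ℝ) => g r), hfr] at h
  rw [← restrict_compl_singleton (μ := volume) (0 : EuclideanSpace ℝ (Fin 3)),
    ← integral_subtype_comap (measurableSet_singleton _).compl]
  have h2 : ∫ r, g r ∂(Measure.volumeIoiPow 2) = ∫ r in Set.Ioi (0 : ℝ), r ^ 2 * g r := by
    simp only [Measure.volumeIoiPow, ENNReal.ofReal]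
    rw [integral_withDensity_eq_integral_smul,
      integral_subtype_comap measurableSet_Ioi fun a ↦ Real.toNNReal (a ^ 2) • g a,
      setIntegral_congr_fun measurableSet_Ioi fun x hx ↦ ?_]
    · simp only [NNReal.smul_def, Real.coe_toNNReal _ (sq_nonneg _), smul_eq_mul]
    · exact (measurable_subtype_coe.pow_const _).real_toNNReal
  rw [← h2, ← h]
  refine integral_congr_ae (Filter.Eventually.of_forall fun x => ?_)
  have hx : x.1 ≠ 0 := x.2
  simp only [ne_eq, hx, not_false_eq_true, dite_true]
  congr 2
  · exact Subtype.ext (homeomorphUnitSphereProd_apply_fst_coe _ _).symm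
  · exact (homeomorphUnitSphereProd_apply_snd_coe _ _).symm

theorem integral_pow_mul_exp_neg_sq_Ioi (n : ℕ) :
    ∫ r in Set.Ioi (0 : ℝ), r ^ n * Real.exp (-r ^ 2) = Real.Gamma ((n + 1) / 2) / 2 := by
  have h := integral_rpow_mul_exp_neg_rpow (p := 2) (q := n) two_pos
    (by linarith [n.cast_nonneg (α := ℝ)])
  simp only [Real.rpow_natCast, Real.rpow_ofNat] at h
  rw [h]
  ring

theorem integral_pow_mul_exp_neg_sq (n : ℕ) :
    ∫ r : ℝ, r ^ n * Real.exp (-r ^ 2) =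
      (1 + (-1) ^ n) * (Real.Gamma ((n + 1) / 2) / 2) := by
  rcases n.even_or_odd with hn | hn
  · have h := integral_comp_abs (f := fun r : ℝ => r ^ n * Real.exp (-r ^ 2))
    simp only [hn.pow_abs, sq_abs] at h
    rw [h, integral_pow_mul_exp_neg_sq_Ioi, hn.neg_one_pow]
    ring
  · have h := integral_neg_eq_self (fun r : ℝ => r ^ n * Real.exp (-r ^ 2)) volume
    simp only [hn.neg_pow, neg_mul, integral_neg, even_two.neg_pow] at h
    rw [hn.neg_one_pow]
    linarith

/-- The integral of `z^n e^{-|x|²}` over three-space is computed in Cartesian and in polar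
coordinates. Both contain `Γ((n+1)/2)`, which cancels and leaves the moment. -/
theorem integral_coord_two_pow (n : ℕ) :
    ∫ p : S2, p.1 2 ^ n ∂surf = 2 * Real.pi * ((1 + (-1) ^ n) / (n + 1)) := by
  have h := integral_polar (fun p => p.1 2 ^ n) (fun r => r ^ n * Real.exp (-r ^ 2))
  have h1 : ∫ x : EuclideanSpace ℝ (Fin 3), x 2 ^ n * Real.exp (-‖x‖ ^ 2) =
      Real.pi * ((1 + (-1) ^ n) * (Real.Gamma ((n + 1) / 2) / 2)) := by
    rw [← (EuclideanSpace.volume_preserving_symm_measurableEquiv_toLp (Fin 3)).symm.integral_comp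
      (MeasurableEquiv.measurableEmbedding _)]
    have h2 := integral_fintype_prod_volume_eq_prod (ι := Fin 3)
      (fun i (x : ℝ) => (if i = 2 then x ^ n else 1) * Real.exp (-x ^ 2))
    have h3 : ∫ x : ℝ, Real.exp (-x ^ 2) = √Real.pi := by
      simpa using integral_gaussian 1
    simp only [Fin.prod_univ_three, Fin.reduceEq, if_false, if_true, one_mul, h3,
      integral_pow_mul_exp_neg_sq, Real.mul_self_sqrt Real.pi_pos.le] at h2
    rw [← h2]
    refine integral_congr_ae (Filter.Eventually.of_forall fun x => ?_)
    simp only [EuclideanSpace.norm_sq_eq, Real.norm_eq_abs, sq_abs, Fin.sum_univ_three, neg_add,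
      Real.exp_add]
    change x 2 ^ n * (Real.exp (-x 0 ^ 2) * Real.exp (-x 1 ^ 2) * Real.exp (-x 2 ^ 2)) = _
    ring
  have h2 : ∀ x : EuclideanSpace ℝ (Fin 3), x ≠ 0 → (‖x‖⁻¹ • x) 2 ^ n * ‖x‖ ^ n = x 2 ^ n := by
    intro x hx
    have : ‖x‖ ≠ 0 := norm_ne_zero_iff.2 hx
    rw [← mul_pow]
    congr 1
    simp only [PiLp.smul_apply, smul_eq_mul]
    field_simp
  have h3 : ∫ x : EuclideanSpace ℝ (Fin 3), x 2 ^ n * Real.exp (-‖x‖ ^ 2) =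
      (∫ p : S2, p.1 2 ^ n ∂surf) * ∫ r in Set.Ioi (0 : ℝ), r ^ 2 * (r ^ n * Real.exp (-r ^ 2)) := by
    rw [← h]
    refine integral_congr_ae ?_
    filter_upwards [measure_eq_zero_iff_ae_notMem.1 (measure_singleton (0 : EuclideanSpace ℝ (Fin 3)))]
      with x hx
    have hx : x ≠ 0 := hx
    rw [dif_pos hx, ← mul_assoc, h2 x hx]
  have h4 : (fun r : ℝ => r ^ 2 * (r ^ n * Real.exp (-r ^ 2))) =
      fun r => r ^ (n + 2) * Real.exp (-r ^ 2) := by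
    funext r
    ring
  have hn : (0 : ℝ) < (n + 1) / 2 := by positivity
  have hG := Real.Gamma_pos_of_pos hn
  have h5 : Real.Gamma (((n + 2 : ℕ) + 1 : ℝ) / 2) = (n + 1) / 2 * Real.Gamma ((n + 1) / 2) := by
    rw [← Real.Gamma_add_one hn.ne']
    congr 1
    push_cast
    ring
  rw [h1, h4, integral_pow_mul_exp_neg_sq_Ioi, h5] at h3
  generalize (∫ p : S2, p.1 2 ^ n ∂surf) = c at *
  have hn1 : (n : ℝ) + 1 ≠ 0 := by positivity
  field_simp at h3 ⊢
  linarith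

theorem continuous_coord (i : Fin 3) : Continuous fun p : S2 => p.1 i := by fun_prop

theorem integrable_of_continuous {E : Type*} [NormedAddCommGroup E] [SecondCountableTopology E]
    {f : S2 → E} (hf : Continuous f) : Integrable f surf :=
  hf.integrable_of_hasCompactSupport (HasCompactSupport.of_compactSpace f)

/-- Archimedes' theorem, for polynomials. -/
theorem integral_eval_coord_two (q : Polynomial ℝ) :
    ∫ p : S2, q.eval (p.1 2) ∂surf = 2 * Real.pi * ∫ z in (-1 : ℝ)..1, q.eval z := by
  induction q using Polynomial.induction_on' with
  | add a b ha hb =>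
    simp only [Polynomial.eval_add]
    rw [integral_add (integrable_of_continuous (by fun_prop))
      (integrable_of_continuous (by fun_prop)), ha, hb, intervalIntegral.integral_add
      (a.continuous.intervalIntegrable _ _) (b.continuous.intervalIntegrable _ _), mul_add]
  | monomial n a =>
    simp only [Polynomial.eval_monomial]
    rw [integral_const_mul, integral_coord_two_pow, intervalIntegral.integral_const_mul,
      integral_pow, one_pow, pow_succ]
    ring

/-! ### Polynomial profiles of spin harmonics -/

open Polynomial in
/-- `(d/dz)^{l+k} (z² - 1)^l`. -/
def legendreDeriv (l k : ℕ) : ℝ[X] := derivative^[l + k] ((X ^ 2 - 1) ^ l)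

open Polynomial in
/-- The polynomial `(1 + σ z)^k (d/dz)^{l+k} (z² - 1)^l`. -/
def profilePoly (σ : ℝ) (k l : ℕ) : ℝ[X] := (1 + C σ * X) ^ k * legendreDeriv l k

section ProfilePoly
open Polynomial

/-- The function `u = (z² - 1)^l` satisfies `(z² - 1) u' = 2 l z u`; this is differentiated `i + 1`
times. -/
theorem iterate_derivative_sq_sub_one_pow_ode (l i : ℕ) :
    (X ^ 2 - 1) * derivative^[i + 2] ((X ^ 2 - 1 : ℝ[X]) ^ l) +
      (2 * ((i : ℝ[X]) + 1) - 2 * (l : ℝ[X])) * X * derivative^[i + 1] ((X ^ 2 - 1 : ℝ[X]) ^ l) +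
      (((i : ℝ[X]) + 1) * (i : ℝ[X]) - 2 * (l : ℝ[X]) * ((i : ℝ[X]) + 1)) * derivative^[i] ((X ^ 2 - 1 : ℝ[X]) ^ l) = 0 := by
  have h0 : (X ^ 2 - 1) * derivative ((X ^ 2 - 1 : ℝ[X]) ^ l) - 2 * (l : ℝ[X]) * X * (X ^ 2 - 1) ^ l = 0 := by
    cases l with
    | zero => simp
    | succ l =>
      simp only [derivative_pow, derivative_sub, derivative_one, derivative_X, Nat.add_sub_cancel]
      push_cast
      simp [map_ofNat]
      ring
  induction i with
  | zero =>
    have h := congrArg derivative h0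
    simp only [derivative_sub, derivative_mul, derivative_zero, derivative_X, derivative_natCast,
      derivative_ofNat, derivative_X_pow, derivative_one, map_ofNat, Nat.cast_ofNat,
      Nat.reduceSub, pow_one] at h
    simp only [zero_add, Function.iterate_succ_apply', Function.iterate_zero, id]
    push_cast at h ⊢
    linear_combination h
  | succ i ih =>
    have h := congrArg derivative ih
    simp only [derivative_add, derivative_sub, derivative_mul, derivative_zero, derivative_X,
      derivative_natCast, derivative_ofNat, derivative_X_pow, derivative_one, map_ofNat,
      Nat.cast_ofNat, Nat.reduceSub, pow_one,
      ← Function.iterate_succ_apply'] at h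
    push_cast at h ⊢
    linear_combination h

theorem legendreDeriv_ode (l k : ℕ) :
    (1 - X ^ 2) * derivative (derivative (legendreDeriv l k)) -
      2 * ((k : ℝ[X]) + 1) * X * derivative (legendreDeriv l k) +
      ((l : ℝ[X]) * ((l : ℝ[X]) + 1) - (k : ℝ[X]) * ((k : ℝ[X]) + 1)) * legendreDeriv l k = 0 := by
  have h := iterate_derivative_sq_sub_one_pow_ode l (l + k)
  rw [legendreDeriv]
  rw [Function.iterate_succ_apply', Function.iterate_succ_apply'] at h
  push_cast at h
  linear_combination -h

/-- The factor `(1 + σ z)^k` replaces the drift `2 (k+1) z` of the equation for `legendreDeriv` by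
`2 z + 2 σ k` and makes the eigenvalue `l (l+1)` independent of `k`. -/
theorem profilePoly_ode (σ : ℝ) (hσ : σ ^ 2 = 1) (k l : ℕ) :
    (1 - X ^ 2) * derivative (derivative (profilePoly σ k l)) -
      (2 * X + 2 * C σ * (k : ℝ[X])) * derivative (profilePoly σ k l) +
      (l : ℝ[X]) * ((l : ℝ[X]) + 1) * profilePoly σ k l = 0 := by
  have hs : (C σ : ℝ[X]) ^ 2 = 1 := by rw [← C_pow, hσ, C_1]
  have hQ := legendreDeriv_ode l k
  unfold profilePoly
  generalize legendreDeriv l k = Q at *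
  set A : ℝ[X] := 1 + C σ * X with hA
  have hA0 : A ≠ 0 := by
    intro h
    have h1 := congrArg (eval 0) h
    simp [hA] at h1
  have hA1 : derivative A = C σ := by simp [hA]
  have h1 : A * derivative (A ^ k) = (k : ℝ[X]) * C σ * A ^ k := by
    cases k with
    | zero => simp
    | succ k =>
      rw [derivative_pow, hA1, Nat.add_sub_cancel]
      simp
      ring
  have h2 := congrArg derivative h1
  simp only [derivative_mul, hA1, derivative_natCast, derivative_C] at h2
  simp only [derivative_mul, derivative_add]
  generalize A ^ k = E at *
  generalize derivative (derivative E) = E2 at *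
  generalize derivative E = E1 at *
  generalize derivative (derivative Q) = Q2 at *
  generalize derivative Q = Q1 at *
  have h3 : A ^ 2 * E2 = (k : ℝ[X]) * ((k : ℝ[X]) - 1) * E := by
    generalize (k : ℝ[X]) = κ at *
    linear_combination A * h2 + ((κ - 1) * C σ) * h1 + (κ * (κ - 1) * E) * hs
  -- The square of `1 + σ X` clears the denominators of the first two derivatives of `(1 + σ X)^k`,
  -- so that what remains is a polynomial identity modulo `σ² = 1`.
  apply mul_left_cancel₀ (pow_ne_zero 2 hA0)
  generalize (k : ℝ[X]) = κ at *
  linear_combination (A ^ 2 * E) * hQ + ((1 - X ^ 2) * Q) * h3 +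
    (2 * (1 - X ^ 2) * Q1 * A - (2 * X + 2 * C σ * κ) * Q * A) * h1 +
    (κ * E * Q * (-2 * κ - 2 * κ * C σ * X + (κ - 1) * X ^ 2) -
      2 * A * κ * E * X * Q1) * hs

end ProfilePoly

/-! ### Derivatives of the profiles and their Sturm–Liouville form -/

section ProfilePoly
open Polynomial

theorem iterate_derivative_profilePoly_ode (σ : ℝ) (hσ : σ ^ 2 = 1) (k l n : ℕ) :
    (1 - X ^ 2) * derivative^[n + 2] (profilePoly σ k l) -
      (2 * ((n : ℝ[X]) + 1) * X + 2 * C σ * (k : ℝ[X])) * derivative^[n + 1] (profilePoly σ k l) +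
      ((l : ℝ[X]) * ((l : ℝ[X]) + 1) - (n : ℝ[X]) * ((n : ℝ[X]) + 1)) *
        derivative^[n] (profilePoly σ k l) = 0 := by
  induction n with
  | zero =>
    simp only [Function.iterate_succ_apply', zero_add, Function.iterate_zero, id]
    push_cast
    linear_combination profilePoly_ode σ hσ k l
  | succ n ih =>
    have h := congrArg derivative ih
    simp only [derivative_add, derivative_sub, derivative_mul, derivative_zero, derivative_X,
      derivative_C, derivative_natCast, derivative_ofNat, derivative_X_pow, derivative_one,
      map_ofNat, Nat.cast_ofNat, Nat.reduceSub, pow_one, ← Function.iterate_succ_apply'] at h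
    push_cast at h ⊢
    linear_combination h

theorem exists_iterate_derivative_profilePoly (σ : ℝ) (k l n : ℕ) :
    ∃ q : ℝ[X], derivative^[n] (profilePoly σ k l) = (1 + C σ * X) ^ (k - n) * q :=
  pow_sub_dvd_iterate_derivative_of_pow_dvd n (Dvd.intro _ rfl)

/-- The quotient of the `n`-th derivative of the profile by the forced power of `1 + σ z`. -/
def profileQuot (σ : ℝ) (k l n : ℕ) : ℝ[X] := (exists_iterate_derivative_profilePoly σ k l n).choose

theorem iterate_derivative_profilePoly (σ : ℝ) (k l n : ℕ) :
    derivative^[n] (profilePoly σ k l) = (1 + C σ * X) ^ (k - n) * profileQuot σ k l n :=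
  (exists_iterate_derivative_profilePoly σ k l n).choose_spec

theorem one_add_C_mul_X_ne_zero (σ : ℝ) : (1 + C σ * X : ℝ[X]) ≠ 0 := by
  intro h
  have h1 := congrArg (eval 0) h
  simp at h1

theorem profileQuot_zero (σ : ℝ) (k l : ℕ) : profileQuot σ k l 0 = legendreDeriv l k := by
  have h := iterate_derivative_profilePoly σ k l 0
  exact (mul_left_cancel₀ (pow_ne_zero k (one_add_C_mul_X_ne_zero σ)) h).symm

theorem profileQuot_of_zero (σ : ℝ) (l n : ℕ) : profileQuot σ 0 l n = legendreDeriv l n := by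
  have h := iterate_derivative_profilePoly σ 0 l n
  rw [Nat.zero_sub, pow_zero, one_mul] at h
  rw [← h, profilePoly, pow_zero, one_mul, legendreDeriv, legendreDeriv,
    ← Function.iterate_add_apply, add_zero, add_comm]

/-- The product of two profiles of spin harmonics. -/
def profileProd (σ : ℝ) (k n l l' : ℕ) : ℝ[X] :=
  (1 - X ^ 2) ^ ((n - k) + (k - n)) * (1 - C σ * X) ^ (2 * min n k) *
    (profileQuot σ k l n * profileQuot σ k l' n)

theorem profileProd_comm (σ : ℝ) (k n l l' : ℕ) :
    profileProd σ k n l l' = profileProd σ k n l' l := by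
  rw [profileProd, profileProd, mul_comm (profileQuot σ k l n)]

theorem one_add_mul_one_sub (σ : ℝ) (hσ : σ ^ 2 = 1) :
    (1 - X ^ 2 : ℝ[X]) = (1 + C σ * X) * (1 - C σ * X) := by
  have hs : (C σ : ℝ[X]) ^ 2 = 1 := by rw [← C_pow, hσ, C_1]
  linear_combination X ^ 2 * hs

/-- Since `T² = (1 - σ z) / (1 + σ z)`, this identifies `profileProd` with `sin^{2n} T^{2k}` times
the product of the two `n`-th derivatives, cleared of its denominator. The definition shows that the
product is a polynomial; this form can be differentiated. -/
theorem pow_mul_profileProd (σ : ℝ) (hσ : σ ^ 2 = 1) (k n l l' : ℕ) :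
    (1 + C σ * X) ^ k * profileProd σ k n l l' = (1 - X ^ 2) ^ n * (1 - C σ * X) ^ k *
      (derivative^[n] (profilePoly σ k l) * derivative^[n] (profilePoly σ k l')) := by
  rw [iterate_derivative_profilePoly, iterate_derivative_profilePoly, profileProd,
    one_add_mul_one_sub σ hσ]
  rcases le_total k n with h | h
  · obtain ⟨d, rfl⟩ := Nat.exists_eq_add_of_le h
    rw [Nat.sub_eq_zero_of_le h, Nat.add_sub_cancel_left, min_eq_right h]
    generalize (1 + C σ * X : ℝ[X]) = A
    generalize (1 - C σ * X : ℝ[X]) = B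
    ring
  · obtain ⟨d, rfl⟩ := Nat.exists_eq_add_of_le h
    rw [Nat.sub_eq_zero_of_le h, Nat.add_sub_cancel_left, min_eq_left h]
    generalize (1 + C σ * X : ℝ[X]) = A
    generalize (1 - C σ * X : ℝ[X]) = B
    ring

/-- Sturm–Liouville identity: `(1 - X²)^{n+1} ((1 - σ X) / (1 + σ X))^k` is the integrating factor
of the profile equation differentiated `n` times, whose zeroth order coefficient is `l(l+1) - n(n+1)
= (l-n)(l+n+1)`. The factor `1 - X²` of the primitive makes the boundary terms at `±1` vanish. -/
theorem exists_profileProd_primitive (σ : ℝ) (hσ : σ ^ 2 = 1) (k n l l' : ℕ) :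
    ∃ S : ℝ[X], derivative ((1 - X ^ 2) * S) = profileProd σ k (n + 1) l l' -
      C (((l : ℝ) - n) * (l + n + 1)) * profileProd σ k n l l' := by
  have hs : (C σ : ℝ[X]) ^ 2 = 1 := by rw [← C_pow, hσ, C_1]
  have hf := one_add_mul_one_sub σ hσ
  have h1 := pow_mul_profileProd σ hσ k (n + 1) l l'
  have h2 := pow_mul_profileProd σ hσ k n l l'
  have hode := iterate_derivative_profilePoly_ode σ hσ k l n
  -- The quotient is a polynomial. If `k ≤ n`, the power `(1 - X²)^n` already contains `k` factors
  -- `1 + σ X`. If `k > n`, the two derivatives supply `(k-n-1) + (k-n)` more, in total `2k - n - 1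
  -- ≥ k`.
  obtain ⟨S, hS⟩ : ∃ S : ℝ[X], (1 + C σ * X) ^ k * S = (1 - X ^ 2) ^ n * (1 - C σ * X) ^ k *
      (derivative^[n + 1] (profilePoly σ k l) * derivative^[n] (profilePoly σ k l')) := by
    rw [iterate_derivative_profilePoly, iterate_derivative_profilePoly, hf]
    rcases le_or_gt k n with h | h
    · obtain ⟨d, rfl⟩ := Nat.exists_eq_add_of_le h
      refine ⟨(1 + C σ * X) ^ d * (1 - C σ * X) ^ (k + d) * (1 - C σ * X) ^ k *
        (profileQuot σ k l (k + d + 1) * profileQuot σ k l' (k + d)), ?_⟩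
      rw [Nat.sub_eq_zero_of_le h, Nat.sub_eq_zero_of_le (by omega)]
      generalize (1 + C σ * X : ℝ[X]) = A
      generalize (1 - C σ * X : ℝ[X]) = B
      ring
    · obtain ⟨d, rfl⟩ := Nat.exists_eq_add_of_lt h
      refine ⟨(1 + C σ * X) ^ d * (1 - C σ * X) ^ n * (1 - C σ * X) ^ (n + d + 1) *
        (profileQuot σ (n + d + 1) l (n + 1) * profileQuot σ (n + d + 1) l' n), ?_⟩
      rw [show n + d + 1 - (n + 1) = d by omega, show n + d + 1 - n = d + 1 by omega]
      generalize (1 + C σ * X : ℝ[X]) = A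
      generalize (1 - C σ * X : ℝ[X]) = B
      ring
  refine ⟨S, ?_⟩
  have hA0 := one_add_C_mul_X_ne_zero σ
  have hD : (1 + C σ * X) ^ k * ((1 - X ^ 2) * S) = (1 - X ^ 2) ^ (n + 1) * (1 - C σ * X) ^ k *
      (derivative^[n + 1] (profilePoly σ k l) * derivative^[n] (profilePoly σ k l')) := by
    linear_combination (1 - X ^ 2) * hS
  have hpow : ∀ (a : ℝ[X]) (j : ℕ), a * derivative (a ^ j) = (j : ℝ[X]) * derivative a * a ^ j := by
    intro a j
    cases j with
    | zero => simp
    | succ j =>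
      rw [derivative_pow, Nat.add_sub_cancel, map_natCast]
      ring
  have hA := hpow (1 + C σ * X) k
  have hB := hpow (1 - C σ * X) k
  have hZ := hpow (1 - X ^ 2) (n + 1)
  have hDD := congrArg derivative hD
  simp only [derivative_mul (f := ((1 : ℝ[X]) + C σ * X) ^ k),
    derivative_mul (f := ((1 : ℝ[X]) - X ^ 2) ^ (n + 1) * (1 - C σ * X) ^ k),
    derivative_mul (f := ((1 : ℝ[X]) - X ^ 2) ^ (n + 1)),
    derivative_mul (f := derivative^[n + 1] (profilePoly σ k l)),
    ← Function.iterate_succ_apply'] at hDD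
  simp only [derivative_add, derivative_sub, derivative_one, derivative_X_pow, derivative_mul,
    derivative_C, derivative_X, zero_mul, zero_add, mul_one, zero_sub, Nat.cast_ofNat, map_ofNat,
    Nat.reduceSub, pow_one] at hA hB hZ
  rw [show (n + 1).succ = n + 2 from rfl] at hDD
  have hc : (C (((l : ℝ) - n) * (l + n + 1)) : ℝ[X]) =
    ((l : ℝ[X]) - (n : ℝ[X])) * ((l : ℝ[X]) + (n : ℝ[X]) + 1) := by simp
  rw [hc]
  rw [pow_succ (1 - X ^ 2) n] at h1 hD hZ hDD
  -- Multiplication by `(1 + σ X)^k`, and below by `1 - X²`, clears the denominators in the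
  -- logarithmic derivative of the weight.
  apply mul_left_cancel₀ (pow_ne_zero k hA0)
  rw [mul_sub, h1, mul_left_comm _ _ (profileProd σ k n l l'), h2]
  push_cast at *
  generalize derivative (((1 : ℝ[X]) - X ^ 2) * S) = T at *
  generalize derivative (((1 : ℝ[X]) - X ^ 2) ^ n * ((1 : ℝ[X]) - X ^ 2)) = Z1 at *
  generalize derivative (((1 : ℝ[X]) + C σ * X) ^ k) = A1 at *
  generalize derivative (((1 : ℝ[X]) - C σ * X) ^ k) = B1 at *
  generalize derivative^[n + 2] (profilePoly σ k l) = g2 at *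
  generalize derivative^[n + 1] (profilePoly σ k l) = g1 at *
  generalize derivative^[n] (profilePoly σ k l) = g0 at *
  generalize derivative^[n + 1] (profilePoly σ k l') = h1' at *
  generalize derivative^[n] (profilePoly σ k l') = h0' at *
  have hZ0 : (1 - X ^ 2 : ℝ[X]) ≠ 0 := by
    intro h
    have h1 := congrArg (eval 0) h
    simp at h1
  have hA' : (1 - X ^ 2) * A1 = (k : ℝ[X]) * C σ * (1 - C σ * X) * (1 + C σ * X) ^ k := by
    rw [hf]
    linear_combination (1 - C σ * X) * hA
  have hB' : (1 - X ^ 2) * B1 = -(k : ℝ[X]) * C σ * (1 + C σ * X) * (1 - C σ * X) ^ k := by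
    rw [hf]
    linear_combination (1 + C σ * X) * hB
  apply mul_left_cancel₀ hZ0
  generalize (1 - C σ * X : ℝ[X]) ^ k = Bk at *
  generalize (1 - X ^ 2 : ℝ[X]) ^ n = Zn at *
  generalize (1 + C σ * X : ℝ[X]) ^ k = Ak at *
  generalize (k : ℝ[X]) = κ at *
  generalize (n : ℝ[X]) = ν at *
  linear_combination (1 - X ^ 2) * hDD - (S * (1 - X ^ 2)) * hA' 
    + (Zn * (1 - X ^ 2) * g1 * h0') * hB' + (Bk * g1 * h0') * hZ
    - (κ * C σ * (1 - C σ * X) ) * hD + ((1 - X ^ 2) * Zn * Bk * h0') * hode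

end ProfilePoly

/-! ### Orthogonality, norms and degrees of the profiles on `[-1, 1]` -/

section ProfileIntegral
open Polynomial

/-- The integral of the product of two profiles. -/
def profileInt (σ : ℝ) (k n l l' : ℕ) : ℝ :=
  ∫ z in (-1 : ℝ)..1, (profileProd σ k n l l').eval z

theorem integral_derivative_eval (S : ℝ[X]) :
    ∫ z in (-1 : ℝ)..1, (derivative S).eval z = S.eval 1 - S.eval (-1) :=
  intervalIntegral.integral_eq_sub_of_hasDerivAt (fun x _ => S.hasDerivAt x)
    ((derivative S).continuous.intervalIntegrable _ _)

theorem profileInt_comm (σ : ℝ) (k n l l' : ℕ) : profileInt σ k n l l' = profileInt σ k n l' l := by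
  rw [profileInt, profileInt, profileProd_comm]

theorem profileInt_succ (σ : ℝ) (hσ : σ ^ 2 = 1) (k n l l' : ℕ) :
    profileInt σ k (n + 1) l l' = (l - n) * (l + n + 1) * profileInt σ k n l l' := by
  obtain ⟨S, hS⟩ := exists_profileProd_primitive σ hσ k n l l'
  have h := integral_derivative_eval ((1 - X ^ 2) * S)
  rw [hS] at h
  simp only [eval_sub, eval_mul, eval_C, eval_one, eval_pow, eval_X] at h
  rw [intervalIntegral.integral_sub ((Polynomial.continuous _).intervalIntegrable _ _)
    (((Polynomial.continuous _).const_mul _).intervalIntegrable _ _),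
    intervalIntegral.integral_const_mul] at h
  rw [profileInt, profileInt]
  linarith

/-- Symmetry in `l` and `l'` of the step from level `0` to level `1` gives `l(l+1) I = l'(l'+1) I`,
the usual argument for distinct eigenvalues. The recursion carries the vanishing to every `n`. -/
theorem profileInt_of_ne (σ : ℝ) (hσ : σ ^ 2 = 1) (k n : ℕ) {l l' : ℕ} (h : l ≠ l') :
    profileInt σ k n l l' = 0 := by
  induction n with
  | zero =>
    have h1 := profileInt_succ σ hσ k 0 l l'
    have h2 := profileInt_succ σ hσ k 0 l' l
    rw [profileInt_comm, h2, profileInt_comm σ k 0 l' l] at h1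
    have h3 : ((l' : ℝ) - l) * (l + l' + 1) * profileInt σ k 0 l l' = 0 := by
      push_cast at h1
      linear_combination h1
    have h4 : ((l' : ℝ) - l) ≠ 0 := sub_ne_zero.2 (by exact_mod_cast h.symm)
    have h5 : (l + l' + 1 : ℝ) ≠ 0 := by positivity
    simpa [h4, h5] using h3
  | succ n ih => rw [profileInt_succ σ hσ, ih, mul_zero]

theorem profileInt_factorial (σ : ℝ) (hσ : σ ^ 2 = 1) (k l l' n : ℕ) (hn : n ≤ l) :
    (l - n).factorial * profileInt σ k n l l' = (l + n).factorial * profileInt σ k 0 l l' := by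
  induction n with
  | zero => rfl
  | succ n ih =>
    have ih := ih (by omega)
    obtain ⟨d, rfl⟩ := Nat.exists_eq_add_of_le hn
    rw [show n + 1 + d - n = d + 1 by omega, Nat.factorial_succ] at ih
    rw [profileInt_succ σ hσ, show n + 1 + d - (n + 1) = d by omega,
      show n + 1 + d + (n + 1) = (n + 1 + d + n) + 1 by ring, Nat.factorial_succ]
    push_cast at ih ⊢
    linear_combination (2 * (n : ℝ) + d + 2) * ih

/-- Integrating the derivative of `z (1 - z²)^{l+1}`, which vanishes at `±1`, gives the recursion
`(2l+3) I_{l+1} = (2l+2) I_l`. -/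
theorem integral_one_sub_sq_pow (l : ℕ) :
    (2 * l + 1).factorial * ∫ z in (-1 : ℝ)..1, (1 - z ^ 2) ^ l =
      2 * (2 ^ l * l.factorial : ℝ) ^ 2 := by
  induction l with
  | zero => norm_num
  | succ l ih =>
    have h := integral_derivative_eval (X * (1 - X ^ 2) ^ (l + 1))
    have h1 : derivative (X * (1 - X ^ 2) ^ (l + 1) : ℝ[X]) =
        C (2 * l + 3 : ℝ) * (1 - X ^ 2) ^ (l + 1) - C (2 * l + 2 : ℝ) * (1 - X ^ 2) ^ l := by
      simp only [derivative_mul, derivative_X, derivative_pow, derivative_sub, derivative_one,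
        Nat.add_sub_cancel, C_add, C_mul, map_natCast, map_ofNat]
      push_cast
      ring
    rw [h1] at h
    simp only [eval_sub, eval_mul, eval_C, eval_one, eval_pow, eval_X] at h
    rw [intervalIntegral.integral_sub (Continuous.intervalIntegrable (by fun_prop) _ _)
      (Continuous.intervalIntegrable (by fun_prop) _ _),
      intervalIntegral.integral_const_mul, intervalIntegral.integral_const_mul] at h
    rw [show 2 * (l + 1) + 1 = (2 * l + 1) + 1 + 1 by ring, Nat.factorial_succ (2 * l + 1 + 1),
      Nat.factorial_succ (2 * l + 1), Nat.factorial_succ l]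
    push_cast
    norm_num at h
    linear_combination ((2 * l + 2) * ((2 * l + 1).factorial : ℝ)) * h + (2 * l + 2) ^ 2 * ih

theorem natDegree_sq_sub_one_pow (l : ℕ) : ((X ^ 2 - 1 : ℝ[X]) ^ l).natDegree = 2 * l := by
  have : (X ^ 2 - 1 : ℝ[X]).natDegree = 2 := by
    simpa using natDegree_X_pow_sub_C (n := 2) (r := (1 : ℝ))
  rw [natDegree_pow, this, mul_comm]

theorem legendreDeriv_self (l : ℕ) : legendreDeriv l l = C ((2 * l).factorial : ℝ) := by
  have hm : (X ^ 2 - 1 : ℝ[X]).Monic := by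
    simpa using monic_X_pow_sub_C (1 : ℝ) two_ne_zero
  have hd := natDegree_sq_sub_one_pow l
  have h0 : (legendreDeriv l l).natDegree = 0 := by
    have := natDegree_iterate_derivative ((X ^ 2 - 1 : ℝ[X]) ^ l) (l + l)
    rw [legendreDeriv]
    omega
  rw [eq_C_of_natDegree_eq_zero h0, legendreDeriv, coeff_iterate_derivative, zero_add]
  have hc : ((X ^ 2 - 1 : ℝ[X]) ^ l).coeff (l + l) = 1 := by
    rw [← two_mul, ← hd]
    exact (hm.pow l).coeff_natDegree
  rw [hc, ← two_mul, Nat.descFactorial_self, nsmul_eq_mul, mul_one]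

/-- The level is raised from `0` to `l`, where the derivative is the constant `(2l)!` and only the
integral of `(1 - z²)^l` remains. -/
theorem profileInt_zero_self (σ : ℝ) (hσ : σ ^ 2 = 1) (l : ℕ) :
    (2 * l + 1) * profileInt σ 0 0 l l = 2 * (2 ^ l * l.factorial : ℝ) ^ 2 := by
  have h := profileInt_factorial σ hσ 0 l l l le_rfl
  have h1 : profileInt σ 0 l l l =
      ((2 * l).factorial : ℝ) ^ 2 * ∫ z in (-1 : ℝ)..1, (1 - z ^ 2) ^ l := by
    rw [profileInt, ← intervalIntegral.integral_const_mul]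
    congr 1
    funext z
    rw [profileProd, profileQuot_of_zero, legendreDeriv_self]
    simp
    ring
  have h2 := integral_one_sub_sq_pow l
  have h3 : ((2 * l).factorial : ℝ) ≠ 0 := by positivity
  rw [Nat.sub_self, Nat.factorial_zero, Nat.cast_one, one_mul, h1, ← two_mul, sq, mul_assoc] at h
  have h4 := mul_left_cancel₀ h3 h
  rw [Nat.factorial_succ] at h2
  push_cast at h2
  rw [← h4, ← h2]
  ring

/-- Order `k` at level `0` and order `0` at level `k` give the same integrand, `(1 - z²)^k` times
the square of `legendreDeriv l k`. Hence the norm comes from two climbs in the level: to `k` at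
order `0`, then to `n` at order `k`. -/
theorem profileInt_self (σ : ℝ) (hσ : σ ^ 2 = 1) (k n l : ℕ) (hk : k ≤ l) (hn : n ≤ l) :
    (2 * l + 1) * ((l - k).factorial * ((l - n).factorial * profileInt σ k n l l)) =
      2 * (2 ^ l * l.factorial : ℝ) ^ 2 * ((l + k).factorial * (l + n).factorial) := by
  have h1 := profileInt_factorial σ hσ k l l n hn
  have h2 := profileInt_factorial σ hσ 0 l l k hk
  have h3 : profileInt σ k 0 l l = profileInt σ 0 k l l := by
    rw [profileInt, profileInt, profileProd, profileProd, profileQuot_of_zero, profileQuot_zero]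
    simp
  rw [← h3] at h2
  rw [h1, ← profileInt_zero_self σ hσ]
  linear_combination (2 * (l : ℝ) + 1) * ((l + n).factorial : ℝ) * h2

theorem natDegree_iterate_derivative_eq (p : ℝ[X]) (n : ℕ) :
    (derivative^[n] p).natDegree = p.natDegree - n := by
  induction n with
  | zero => rfl
  | succ n ih => rw [Function.iterate_succ_apply', natDegree_derivative, ih, Nat.sub_sub]

/-- The profile has degree `k + (l - k) = l`; differentiation removes `n` and the forced factor `k -
n` (truncated). Completeness rests on this: with `k` and `n` fixed, each degree occurs exactly once
as `l` grows. -/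
theorem natDegree_profileQuot (σ : ℝ) (hσ : σ ^ 2 = 1) (k l n : ℕ) (hk : k ≤ l) (hn : n ≤ l) :
    (profileQuot σ k l n).natDegree = l - max k n ∧ profileQuot σ k l n ≠ 0 := by
  have hσ0 : σ ≠ 0 := by rintro rfl; norm_num at hσ
  have hA : (1 + C σ * X : ℝ[X]).natDegree = 1 := by
    rw [add_comm, ← C_1]
    exact natDegree_linear hσ0
  have hA0 := one_add_C_mul_X_ne_zero σ
  have hL : (legendreDeriv l k).natDegree = l - k := by
    rw [legendreDeriv, natDegree_iterate_derivative_eq, natDegree_sq_sub_one_pow]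
    omega
  have hL0 : legendreDeriv l k ≠ 0 := by
    intro h
    have h1 : derivative^[l - k] (legendreDeriv l k) = legendreDeriv l l := by
      rw [legendreDeriv, ← Function.iterate_add_apply, legendreDeriv,
        show l - k + (l + k) = l + l by omega]
    rw [h, iterate_derivative_zero, legendreDeriv_self, eq_comm, C_eq_zero] at h1
    have : ((2 * l).factorial : ℝ) ≠ 0 := by positivity
    exact this h1
  have hg : (profilePoly σ k l).natDegree = l := by
    rw [profilePoly, natDegree_mul (pow_ne_zero _ hA0) hL0, natDegree_pow, hA, hL]
    omega
  have hd := natDegree_iterate_derivative_eq (profilePoly σ k l) n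
  have h0 : derivative^[n] (profilePoly σ k l) ≠ 0 := by
    intro h
    -- Differentiating `l` times in all leaves `l!` times the leading coefficient.
    have h1 : derivative^[l - n] (derivative^[n] (profilePoly σ k l)) ≠ 0 := by
      rw [← Function.iterate_add_apply, Nat.sub_add_cancel hn]
      intro h2
      have h3 := congrArg (fun q => q.coeff 0) h2
      simp only [coeff_iterate_derivative, zero_add, coeff_zero, nsmul_eq_mul,
        Nat.descFactorial_self] at h3
      have h4 : ((l.factorial : ℕ) : ℝ) ≠ 0 := by positivity
      have h5 := (mul_eq_zero.1 h3).resolve_left h4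
      have h6 : (profilePoly σ k l).leadingCoeff = 0 := by rwa [leadingCoeff, hg]
      exact mul_ne_zero (pow_ne_zero _ hA0) hL0 (leadingCoeff_eq_zero.1 h6)
    rw [h, iterate_derivative_zero] at h1
    exact h1 rfl
  rw [iterate_derivative_profilePoly] at h0 hd
  have hq := right_ne_zero_of_mul h0
  refine ⟨?_, hq⟩
  rw [natDegree_mul (pow_ne_zero _ hA0) hq, natDegree_pow, hA, hg] at hd
  omega

end ProfileIntegral

/-! ### Spin harmonics in the standard chart -/

theorem rot_one (p : S2) : rot 1 p = p :=
  Subtype.ext (congrArg (WithLp.toLp 2) (Matrix.one_mulVec p.1.ofLp))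

theorem chartPt_one_apply (θ φ : ℝ) (i : Fin 3) : (chartPt 1 θ φ).1 i = sphVec θ φ i := by
  rw [chartPt, rot_one]
  rfl

/-- `tan (θ / 2)` for `σ = 1`, `cot (θ / 2)` for `σ = -1`. -/
def halfTan (σ θ : ℝ) : ℝ := Real.sin θ / (1 + σ * Real.cos θ)

theorem one_add_mul_cos_pos (σ : ℝ) (hσ : σ ^ 2 = 1) {θ : ℝ} (hθ : θ ∈ Set.Ioo 0 Real.pi) :
    0 < 1 + σ * Real.cos θ := by
  have h1 := Real.sin_sq_add_cos_sq θ
  have h2 := pow_pos (Real.sin_pos_of_mem_Ioo hθ) 2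
  have h3 : (σ * Real.cos θ) ^ 2 < 1 := by rw [mul_pow, hσ]; linarith
  have h4 := (abs_lt.1 ((sq_lt_one_iff_abs_lt_one _).1 h3)).1
  linarith

theorem hasDerivAt_halfTan (σ : ℝ) (hσ : σ ^ 2 = 1) {θ : ℝ} (hθ : θ ∈ Set.Ioo 0 Real.pi) :
    HasDerivAt (halfTan σ) (σ * halfTan σ θ / Real.sin θ) θ := by
  have h0 := (one_add_mul_cos_pos σ hσ hθ).ne'
  have hs := (Real.sin_pos_of_mem_Ioo hθ).ne'
  refine ((Real.hasDerivAt_sin θ).div (((Real.hasDerivAt_cos θ).const_mul σ).const_add 1)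
    h0).congr_deriv ?_
  have h1 : σ * halfTan σ θ / Real.sin θ = σ / (1 + σ * Real.cos θ) := by
    rw [halfTan]
    field_simp
  rw [h1, div_eq_div_iff (pow_ne_zero 2 h0) h0]
  linear_combination (1 + σ * Real.cos θ) * (σ * Real.sin_sq_add_cos_sq θ - Real.cos θ * hσ)

/-- On `e^{imφ} T^k` the derivative `∂_ϑ` contributes `σ k / sin ϑ` and the longitudinal term `-ε m
/ sin ϑ`, which cancel by `hk`. Conjugation by `sin^n` removes that factor, so only `g(cos ϑ)` is
differentiated. The chain rule factor `-sin ϑ` absorbs the sign of the operator and raises the power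
of `sin ϑ`. -/
theorem edth_profile (ε σ : ℝ) (hσ : σ ^ 2 = 1) (m : ℤ) (k n : ℕ)
    (hk : σ * k = ε * m) (c : ℂ) (f : S2 → ℂ) (g : Polynomial ℝ)
    (hf : ∀ t ∈ Set.Ioo 0 Real.pi, ∀ u, f (chartPt 1 t u) = c * (Complex.exp (m * u * Complex.I) *
      ((Real.sin t ^ n * (halfTan σ t ^ k * g.eval (Real.cos t)) : ℝ) : ℂ)))
    (θ φ : ℝ) (hθ : θ ∈ Set.Ioo 0 Real.pi) :
    -((Real.sin θ : ℂ) ^ (n : ℤ)) *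
      (deriv (fun t : ℝ => (Real.sin t : ℂ) ^ (-(n : ℤ)) * f (chartPt 1 t φ)) θ +
        ε * Complex.I / (Real.sin θ : ℂ) *
          deriv (fun u : ℝ => (Real.sin θ : ℂ) ^ (-(n : ℤ)) * f (chartPt 1 θ u)) φ) =
      c * (Complex.exp (m * φ * Complex.I) *
        ((Real.sin θ ^ (n + 1) *
          (halfTan σ θ ^ k * g.derivative.eval (Real.cos θ)) : ℝ) : ℂ)) := by
  have hs0 := (Real.sin_pos_of_mem_Ioo hθ).ne'
  have hs : ∀ t ∈ Set.Ioo 0 Real.pi, (Real.sin t : ℂ) ≠ 0 := fun t ht =>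
    Complex.ofReal_ne_zero.2 (Real.sin_pos_of_mem_Ioo ht).ne'
  have e : ∀ t ∈ Set.Ioo 0 Real.pi, ∀ u, (Real.sin t : ℂ) ^ (-(n : ℤ)) * f (chartPt 1 t u) =
      c * (Complex.exp (m * u * Complex.I) *
        ((halfTan σ t ^ k * g.eval (Real.cos t) : ℝ) : ℂ)) := by
    intro t ht u
    rw [hf t ht u, zpow_neg, zpow_natCast]
    have := pow_ne_zero n (hs t ht)
    rw [Complex.ofReal_mul (Real.sin t ^ n), Complex.ofReal_pow]
    field_simp
  have hT : HasDerivAt (fun t => halfTan σ t ^ k) (k * σ * halfTan σ θ ^ k / Real.sin θ) θ := by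
    refine ((hasDerivAt_halfTan σ hσ hθ).pow k).congr_deriv ?_
    cases k with
    | zero => simp
    | succ k =>
      rw [Nat.add_sub_cancel]
      ring
  have hg : HasDerivAt (fun t => g.eval (Real.cos t))
      (g.derivative.eval (Real.cos θ) * -Real.sin θ) θ :=
    (g.hasDerivAt (Real.cos θ)).comp θ (Real.hasDerivAt_cos θ)
  have h1 : HasDerivAt (fun t : ℝ => (Real.sin t : ℂ) ^ (-(n : ℤ)) * f (chartPt 1 t φ))
      (c * (Complex.exp (m * φ * Complex.I) * ((k * σ * halfTan σ θ ^ k / Real.sin θ *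
        g.eval (Real.cos θ) + halfTan σ θ ^ k *
          (g.derivative.eval (Real.cos θ) * -Real.sin θ) : ℝ) : ℂ))) θ := by
    refine HasDerivAt.congr_of_eventuallyEq
      ((((hT.fun_mul hg).ofReal_comp).const_mul _).const_mul c) ?_
    filter_upwards [isOpen_Ioo.mem_nhds hθ] with t ht
    exact e t ht φ
  have h2 : HasDerivAt (fun u : ℝ => (Real.sin θ : ℂ) ^ (-(n : ℤ)) * f (chartPt 1 θ u))
      (c * (Complex.exp (m * φ * Complex.I) * (m * Complex.I) *
        ((halfTan σ θ ^ k * g.eval (Real.cos θ) : ℝ) : ℂ))) φ := by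
    have h3 : HasDerivAt (fun u : ℝ => Complex.exp (m * u * Complex.I))
        (Complex.exp (m * φ * Complex.I) * (m * Complex.I)) φ := by
      have h4 : HasDerivAt (fun u : ℝ => (m : ℂ) * u * Complex.I) (m * Complex.I) φ := by
        simpa using ((hasDerivAt_id φ).ofReal_comp.const_mul (m : ℂ)).mul_const Complex.I
      exact h4.cexp
    refine HasDerivAt.congr_of_eventuallyEq ((h3.mul_const _).const_mul c) ?_
    exact Filter.Eventually.of_forall fun u => e θ hθ u
  have hk' : (σ : ℂ) * k = ε * m := by exact_mod_cast hk
  have hsθ := hs θ hθ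
  rw [h1.deriv, h2.deriv, zpow_natCast]
  generalize Real.sin θ = S at *
  generalize halfTan σ θ ^ k = T at *
  generalize g.eval (Real.cos θ) = G at *
  generalize g.derivative.eval (Real.cos θ) = G' at *
  push_cast
  field_simp
  linear_combination (-(S : ℂ) ^ n * c * T * G) * hk' -
    ((S : ℂ) ^ n * c * T * ε * m * G) * Complex.I_sq

/-- Needed because `lon` recovers the longitude only modulo `2π`. -/
theorem exp_int_mul_congr (m : ℤ) {u v : ℝ} (hc : Real.cos u = Real.cos v)
    (hs : Real.sin u = Real.sin v) :
    Complex.exp (m * u * Complex.I) = Complex.exp (m * v * Complex.I) := by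
  have h : ∀ w : ℝ, Complex.exp (m * w * Complex.I) =
      ((Real.cos w : ℂ) + Real.sin w * Complex.I) ^ m := by
    intro w
    rw [mul_assoc, Complex.exp_int_mul, Complex.exp_mul_I, Complex.ofReal_cos, Complex.ofReal_sin]
  rw [h, h, hc, hs]

theorem ethPow_profile (σ : ℝ) (hσ : σ ^ 2 = 1) (m : ℤ) (k : ℕ) (hk : σ * k = m) (c : ℂ)
    (f : S2 → ℂ) (g : Polynomial ℝ)
    (hf : ∀ t ∈ Set.Ioo 0 Real.pi, ∀ u, f (chartPt 1 t u) = c * (Complex.exp (m * u * Complex.I) *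
      ((halfTan σ t ^ k * g.eval (Real.cos t) : ℝ) : ℂ))) (n : ℕ) :
    ∀ t ∈ Set.Ioo 0 Real.pi, ∀ u, ethPow 1 f n (chartPt 1 t u) =
      c * (Complex.exp (m * u * Complex.I) * ((Real.sin t ^ n *
        (halfTan σ t ^ k * (Polynomial.derivative^[n] g).eval (Real.cos t)) : ℝ) : ℂ)) := by
  induction n with
  | zero =>
    intro t ht u
    simpa [ethPow] using hf t ht u
  | succ n ih =>
    intro t ht u
    obtain ⟨h1, h2, h3⟩ := angles_chartPt 1 t u ht
    have h := edth_profile 1 σ hσ m k n (by rw [hk, one_mul]) c _ _ ih t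
      (lon 1 (chartPt 1 t u)) ht
    rw [exp_int_mul_congr m h2 h3] at h
    rw [ethPow, eth, h1, Function.iterate_succ_apply', ← h, Complex.ofReal_one, one_mul]

/-- On spin `-n` the operator `ð̄` carries the same powers of `sin ϑ` as `ð` on spin `n`, so
`edth_profile` applies with `ε = -1`. Each extra minus sign in `-ð̄` contributes a factor `-1`. -/
theorem negEthBarPow_profile (σ : ℝ) (hσ : σ ^ 2 = 1) (m : ℤ) (k : ℕ) (hk : σ * k = -m) (c : ℂ)
    (f : S2 → ℂ) (g : Polynomial ℝ)
    (hf : ∀ t ∈ Set.Ioo 0 Real.pi, ∀ u, f (chartPt 1 t u) = c * (Complex.exp (m * u * Complex.I) *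
      ((halfTan σ t ^ k * g.eval (Real.cos t) : ℝ) : ℂ))) (n : ℕ) :
    ∀ t ∈ Set.Ioo 0 Real.pi, ∀ u, negEthBarPow 1 f n (chartPt 1 t u) =
      ((-1) ^ n * c) * (Complex.exp (m * u * Complex.I) * ((Real.sin t ^ n *
        (halfTan σ t ^ k * (Polynomial.derivative^[n] g).eval (Real.cos t)) : ℝ) : ℂ)) := by
  induction n with
  | zero =>
    intro t ht u
    simpa [negEthBarPow] using hf t ht u
  | succ n ih =>
    intro t ht u
    obtain ⟨h1, h2, h3⟩ := angles_chartPt 1 t u ht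
    have h := edth_profile (-1) σ hσ m k n (by rw [hk, neg_one_mul]) _ _ _ ih t
      (lon 1 (chartPt 1 t u)) ht
    rw [exp_int_mul_congr m h2 h3] at h
    rw [negEthBarPow, Pi.neg_apply, ethBar, h1, Function.iterate_succ_apply', pow_succ,
      mul_neg_one]
    simp only [neg_neg, Complex.ofReal_neg, Complex.ofReal_one] at h ⊢
    linear_combination -h

/-- The normalizing constant of the scalar spherical harmonics. -/
def harmonicConst (l k : ℕ) : ℝ :=
  √((2 * l + 1) / (4 * Real.pi) * ((l - k).factorial / (l + k).factorial)) / (2 ^ l * l.factorial)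

/-- As `T (1 + σ cos ϑ) = sin ϑ`, the factor `sin^{|m|} ϑ` can be split off with either sign `σ`.
This freedom is used to meet the sign condition of `edth_profile`. -/
theorem scalarHarmonic_profile (σ : ℝ) (hσ : σ ^ 2 = 1) (l : ℕ) (m : ℤ) :
    ∀ t ∈ Set.Ioo 0 Real.pi, ∀ u, scalarHarmonic l m (chartPt 1 t u) =
      (harmonicConst l m.natAbs * (if 0 ≤ m then (-1) ^ m.natAbs else 1)) *
        (Complex.exp (m * u * Complex.I) * ((halfTan σ t ^ m.natAbs *
          (profilePoly σ m.natAbs l).eval (Real.cos t) : ℝ) : ℂ)) := by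
  intro t ht u
  have h0 := (one_add_mul_cos_pos σ hσ ht).ne'
  have h1 : halfTan σ t ^ m.natAbs * (profilePoly σ m.natAbs l).eval (Real.cos t) =
      Real.sin t ^ m.natAbs * (legendreDeriv l m.natAbs).eval (Real.cos t) := by
    simp only [profilePoly, Polynomial.eval_mul, Polynomial.eval_pow, Polynomial.eval_add,
      Polynomial.eval_one, Polynomial.eval_C, Polynomial.eval_X]
    rw [← mul_assoc, ← mul_pow, halfTan, div_mul_cancel₀ _ h0]
  rw [h1, scalarHarmonic, chartPt_one_apply, chartPt_one_apply, chartPt_one_apply]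
  simp only [sphVec, Matrix.cons_val]
  rw [← harmonicConst, ← legendreDeriv, mul_assoc, mul_assoc]
  congr 1
  have he : ∀ a : ℤ, Complex.exp (a * u * Complex.I) =
      (Complex.exp (u * Complex.I)) ^ a := by
    intro a
    rw [mul_assoc, Complex.exp_int_mul]
  push_cast
  split_ifs with hm
  · have e1 : (Real.sin t : ℂ) * Real.cos u + Complex.I * (Real.sin t * Real.sin u) =
        Real.sin t * Complex.exp (u * Complex.I) := by
      rw [Complex.exp_mul_I, ← Complex.ofReal_cos, ← Complex.ofReal_sin]
      ring
    have e2 : (Complex.exp (u * Complex.I)) ^ m = Complex.exp (u * Complex.I) ^ m.natAbs := by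
      rw [← zpow_natCast, Int.natAbs_of_nonneg hm]
    push_cast at e1
    rw [he, e2, e1, neg_pow, mul_pow]
    ring
  · have e1 : (Real.sin t : ℂ) * Real.cos u - Complex.I * (Real.sin t * Real.sin u) =
        Real.sin t * (Complex.exp (u * Complex.I))⁻¹ := by
      rw [← Complex.exp_neg, ← neg_mul, Complex.exp_mul_I, Complex.cos_neg, Complex.sin_neg,
        ← Complex.ofReal_cos, ← Complex.ofReal_sin]
      ring
    have e2 : (Complex.exp (u * Complex.I)) ^ m =
        (Complex.exp (u * Complex.I))⁻¹ ^ m.natAbs := by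
      rw [inv_pow, ← zpow_natCast, Int.ofNat_natAbs_of_nonpos (by omega), zpow_neg, inv_inv]
    push_cast at e1
    rw [he, e2, e1, mul_pow]
    ring

/-- The sign of `s m`. -/
def spinSign (s m : ℤ) : ℝ := (if 0 ≤ s then 1 else -1) * (if 0 ≤ m then 1 else -1)

theorem spinSign_sq (s m : ℤ) : spinSign s m ^ 2 = 1 := by
  unfold spinSign
  split_ifs <;> norm_num

/-- The phase `e^{iφ}` of a point of the sphere. -/
def phase (p : S2) : ℂ := ((p.1 0 : ℂ) + Complex.I * (p.1 1 : ℂ)) / (√(1 - p.1 2 ^ 2) : ℝ)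

/-- The weight of the profiles of spin harmonics. -/
def profileWeight (s m : ℤ) (z : ℝ) : ℝ :=
  √(1 - z ^ 2) ^ ((s.natAbs - m.natAbs) + (m.natAbs - s.natAbs)) *
    (1 - spinSign s m * z) ^ min s.natAbs m.natAbs

/-- The normalizing constant of the spin harmonics. -/
def spinConst (s : ℤ) (l : ℕ) (m : ℤ) : ℝ :=
  √((l - s.natAbs).factorial / (l + s.natAbs).factorial) * harmonicConst l m.natAbs *
    ((if 0 ≤ m then (-1) ^ m.natAbs else 1) * (if 0 ≤ s then 1 else (-1) ^ s.natAbs))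

/-- The degree `l - max(|m|, |s|)` polynomial factor in the profile of a spin harmonic. -/
def spinQuot (s : ℤ) (l : ℕ) (m : ℤ) : Polynomial ℝ :=
  profileQuot (spinSign s m) m.natAbs l s.natAbs

theorem phase_chartPt {θ : ℝ} (hθ : θ ∈ Set.Ioo 0 Real.pi) (φ : ℝ) :
    phase (chartPt 1 θ φ) = Complex.exp (φ * Complex.I) := by
  have hs := Real.sin_pos_of_mem_Ioo hθ
  have h0 : (Real.sin θ : ℂ) ≠ 0 := Complex.ofReal_ne_zero.2 hs.ne'
  rw [phase, chartPt_one_apply, chartPt_one_apply, chartPt_one_apply, Complex.exp_mul_I]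
  simp only [sphVec, Matrix.cons_val]
  rw [← Real.abs_sin_eq_sqrt_one_sub_cos_sq, abs_of_pos hs]
  push_cast at h0 ⊢
  field_simp

/-- The relations `T sin ϑ = 1 - σ cos ϑ` and `T (1 + σ cos ϑ) = sin ϑ` eliminate `T`, leaving an
expression that is bounded near both poles. With truncated subtraction, `(n - k) + (k - n)` is `|n -
k|`. -/
theorem sin_pow_mul_halfTan_pow (σ : ℝ) (hσ : σ ^ 2 = 1) (k l n : ℕ) {θ : ℝ}
    (hθ : θ ∈ Set.Ioo 0 Real.pi) :
    Real.sin θ ^ n * (halfTan σ θ ^ k *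
      (Polynomial.derivative^[n] (profilePoly σ k l)).eval (Real.cos θ)) =
    Real.sin θ ^ ((n - k) + (k - n)) * (1 - σ * Real.cos θ) ^ min n k *
      (profileQuot σ k l n).eval (Real.cos θ) := by
  have h0 := (one_add_mul_cos_pos σ hσ hθ).ne'
  rw [iterate_derivative_profilePoly]
  simp only [Polynomial.eval_mul, Polynomial.eval_pow, Polynomial.eval_add,
      Polynomial.eval_one, Polynomial.eval_C, Polynomial.eval_X]
  have h1 : Real.sin θ * halfTan σ θ = 1 - σ * Real.cos θ := by
    rw [halfTan]
    field_simp
    linear_combination Real.sin_sq_add_cos_sq θ + Real.cos θ ^ 2 * hσ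
  have h2 : halfTan σ θ * (1 + σ * Real.cos θ) = Real.sin θ := div_mul_cancel₀ _ h0
  rcases le_total k n with h | h
  · obtain ⟨d, rfl⟩ := Nat.exists_eq_add_of_le h
    rw [Nat.sub_eq_zero_of_le h, Nat.add_sub_cancel_left, min_eq_right h, ← h1]
    ring
  · obtain ⟨d, rfl⟩ := Nat.exists_eq_add_of_le h
    rw [Nat.sub_eq_zero_of_le h, Nat.add_sub_cancel_left, min_eq_left h, ← h1, zero_add]
    have h3 : Real.sin θ ^ d = halfTan σ θ ^ d * (1 + σ * Real.cos θ) ^ d := by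
      rw [← mul_pow, h2]
    rw [h3]
    ring

/-- The sign `spinSign s m` makes `σ |m|` equal to `m` for `s ≥ 0` and to `-m` for `s < 0`, as the
profile formulas for `ð` and `-ð̄` require. The four cases are the signs of `s` and `m`. -/
theorem spinHarmonicFun_chartPt (s : ℤ) (l : ℕ) (m : ℤ) {θ : ℝ} (hθ : θ ∈ Set.Ioo 0 Real.pi)
    (φ : ℝ) : spinHarmonicFun s l m 1 (chartPt 1 θ φ) =
      spinConst s l m * (phase (chartPt 1 θ φ) ^ m *
        ((profileWeight s m ((chartPt 1 θ φ).1 2) *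
          (spinQuot s l m).eval ((chartPt 1 θ φ).1 2) : ℝ) : ℂ)) := by
  have hσ := spinSign_sq s m
  have hb := scalarHarmonic_profile (spinSign s m) hσ l m
  have hz : (chartPt 1 θ φ).1 2 = Real.cos θ := chartPt_one_apply θ φ 2
  have hp := sin_pow_mul_halfTan_pow (spinSign s m) hσ m.natAbs l s.natAbs hθ
  have hsin : Real.sin θ = √(1 - Real.cos θ ^ 2) := by
    rw [← Real.abs_sin_eq_sqrt_one_sub_cos_sq, abs_of_pos (Real.sin_pos_of_mem_Ioo hθ)]
  have he : Complex.exp (m * φ * Complex.I) = Complex.exp (φ * Complex.I) ^ m := by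
    rw [mul_assoc, Complex.exp_int_mul]
  rw [hz, phase_chartPt hθ, profileWeight, spinQuot, ← hsin, ← hp, spinHarmonicFun, spinConst]
  split_ifs with hs hm hm
  · rw [if_pos hm] at hb
    have hk : spinSign s m * m.natAbs = m := by
      rw [spinSign, if_pos hs, if_pos hm, ← Int.cast_natCast, Int.natAbs_of_nonneg hm]
      ring
    rw [ethPow_profile _ hσ m _ hk _ _ _ hb s.natAbs θ hθ φ, he]
    push_cast
    ring
  · rw [if_neg hm] at hb
    have hk : spinSign s m * m.natAbs = m := by
      rw [spinSign, if_pos hs, if_neg hm, ← Int.cast_natCast, Int.ofNat_natAbs_of_nonpos (by omega)]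
      push_cast
      ring
    rw [ethPow_profile _ hσ m _ hk _ _ _ hb s.natAbs θ hθ φ, he]
    push_cast
    ring
  · rw [if_pos hm] at hb
    have hk : spinSign s m * m.natAbs = -m := by
      rw [spinSign, if_neg hs, if_pos hm, ← Int.cast_natCast, Int.natAbs_of_nonneg hm]
      ring
    rw [negEthBarPow_profile _ hσ m _ hk _ _ _ hb s.natAbs θ hθ φ, he]
    push_cast
    ring
  · rw [if_neg hm] at hb
    have hk : spinSign s m * m.natAbs = -m := by
      rw [spinSign, if_neg hs, if_neg hm, ← Int.cast_natCast, Int.ofNat_natAbs_of_nonpos (by omega)]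
      push_cast
      ring
    rw [negEthBarPow_profile _ hσ m _ hk _ _ _ hb s.natAbs θ hθ φ, he]
    push_cast
    ring

theorem spinHarmonicFun_ae_eq_profile (s : ℤ) (l : ℕ) (m : ℤ) :
    ∀ᵐ p ∂surf, spinHarmonicFun s l m 1 p = spinConst s l m * (phase p ^ m *
      ((profileWeight s m (p.1 2) * (spinQuot s l m).eval (p.1 2) : ℝ) : ℂ)) := by
  filter_upwards [ae_colat 1] with p hp
  have h := spinHarmonicFun_chartPt s l m hp (lon 1 p)
  rwa [chartPt_colat_lon] at h

/-! ### Orthonormality -/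

theorem spinHarmonic_comp_one_ae_eq (s : ℤ) (l : ℕ) (m : ℤ) :
    ∀ᵐ p ∂surf, SpinL2.comp 1 (spinHarmonic s l m) p = spinConst s l m * (phase p ^ m *
      ((profileWeight s m (p.1 2) * (spinQuot s l m).eval (p.1 2) : ℝ) : ℂ)) := by
  filter_upwards [(memLp_spinHarmonicFun s l m 1).coeFn_toLp, spinHarmonicFun_ae_eq_profile s l m]
    with p h1 h2
  exact h1.trans h2

theorem spinHarmonicFun_zero (l : ℕ) (m : ℤ) (R : SO3) :
    spinHarmonicFun 0 l m R = scalarHarmonic l m := by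
  funext p
  have h : ((l.factorial : ℕ) : ℝ) ≠ 0 := by positivity
  simp [spinHarmonicFun, ethPow, h]

theorem scalarHarmonicL2_eq (l : ℕ) (m : ℤ) :
    scalarHarmonicL2 l m = SpinL2.comp 1 (spinHarmonic 0 l m) := by
  refine (MemLp.toLp_eq_toLp_iff (memLp_scalarHarmonic l m) (memLp_spinHarmonicFun 0 l m 1)).2 ?_
  rw [spinHarmonicFun_zero]

/-- The rotation by the angle `α` about the polar axis. -/
def axialRot (α : ℝ) : SO3 :=
  ⟨!![Real.cos α, -Real.sin α, 0; Real.sin α, Real.cos α, 0; 0, 0, 1], by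
    rw [Matrix.mem_specialOrthogonalGroup_iff, Matrix.mem_orthogonalGroup_iff]
    have h := Real.sin_sq_add_cos_sq α
    constructor
    · ext i j
      fin_cases i <;> fin_cases j <;>
        simp [Matrix.mul_apply, Fin.sum_univ_three] <;> nlinarith
    · rw [Matrix.det_fin_three]
      simp
      linarith⟩

theorem axialRot_apply (α : ℝ) (p : S2) :
    (rot (axialRot α) p).1 0 = Real.cos α * p.1 0 - Real.sin α * p.1 1 ∧
    (rot (axialRot α) p).1 1 = Real.sin α * p.1 0 + Real.cos α * p.1 1 ∧
    (rot (axialRot α) p).1 2 = p.1 2 := by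
  simp [rot, axialRot, dotProduct, Fin.sum_univ_three, sub_eq_add_neg]

theorem phase_axialRot (α : ℝ) (p : S2) :
    phase (rot (axialRot α) p) = Complex.exp (α * Complex.I) * phase p := by
  obtain ⟨h0, h1, h2⟩ := axialRot_apply α p
  rw [phase, phase, h0, h1, h2, ← mul_div_assoc, Complex.exp_mul_I, ← Complex.ofReal_cos,
    ← Complex.ofReal_sin]
  congr 1
  push_cast
  linear_combination (-(Complex.sin α) * p.1 1) * Complex.I_sq

theorem norm_phase_ae : ∀ᵐ p ∂surf, ‖phase p‖ = 1 := by
  filter_upwards [ae_colat 1] with p hp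
  have h := phase_chartPt hp (lon 1 p)
  rw [chartPt_colat_lon] at h
  rw [h, Complex.norm_exp_ofReal_mul_I]

theorem measurableEmbedding_rot (R : SO3) : MeasurableEmbedding (rot R) :=
  ((continuous_rot R).isClosedEmbedding
    (Function.LeftInverse.injective (rot_inv_rot R))).measurableEmbedding

/-- Rotation by `π / (m' - m)` about the axis preserves the measure and `z`, and multiplies the
integrand by `e^{iπ} = -1`. The integral thus equals its own negative, whatever `f` is. -/
theorem integral_phase_of_ne {m m' : ℤ} (h : m ≠ m') (f : ℝ → ℂ) :
    ∫ p, (starRingEnd ℂ) (phase p ^ m) * phase p ^ m' * f (p.1 2) ∂surf = 0 := by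
  have hd : (m' : ℂ) - m ≠ 0 := sub_ne_zero.2 (by exact_mod_cast h.symm)
  set α : ℝ := Real.pi / (m' - m) with hα
  have h1 := (measurePreserving_rot (axialRot α)).integral_comp (measurableEmbedding_rot _)
    (fun p => (starRingEnd ℂ) (phase p ^ m) * phase p ^ m' * f (p.1 2))
  have h2 : (starRingEnd ℂ) (Complex.exp (α * Complex.I) ^ m) * Complex.exp (α * Complex.I) ^ m' =
      -1 := by
    rw [← Complex.exp_int_mul, ← Complex.exp_int_mul, ← Complex.exp_conj, ← Complex.exp_add,
      ← Complex.exp_pi_mul_I]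
    congr 1
    simp only [map_mul, Complex.conj_I, Complex.conj_ofReal, hα, map_intCast]
    push_cast
    field_simp
    ring
  have h3 : ∀ p, (starRingEnd ℂ) (phase (rot (axialRot α) p) ^ m) *
      phase (rot (axialRot α) p) ^ m' * f ((rot (axialRot α) p).1 2) =
      -1 * ((starRingEnd ℂ) (phase p ^ m) * phase p ^ m' * f (p.1 2)) := by
    intro p
    rw [phase_axialRot, (axialRot_apply α p).2.2, mul_zpow, mul_zpow, map_mul, ← h2]
    ring
  simp only [h3] at h1
  rw [integral_const_mul] at h1
  have h4 : (2 : ℂ) ≠ 0 := two_ne_zero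
  apply mul_left_cancel₀ h4
  linear_combination -h1

theorem coord_two_sq_le (p : S2) : p.1 2 ^ 2 ≤ 1 := by
  have hx := (mem_S2_iff p.1).1 p.2
  simp only [dotProduct, Fin.sum_univ_three] at hx
  nlinarith [sq_nonneg (p.1 0), sq_nonneg (p.1 1)]

theorem profileWeight_mul_spinQuot (s m : ℤ) (l l' : ℕ) {z : ℝ} (hz : z ^ 2 ≤ 1) :
    (profileWeight s m z * (spinQuot s l m).eval z) *
      (profileWeight s m z * (spinQuot s l' m).eval z) =
    (profileProd (spinSign s m) m.natAbs s.natAbs l l').eval z := by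
  have h : ∀ e, (1 - z ^ 2) ^ e = (√(1 - z ^ 2) ^ 2) ^ e := fun e => by
    rw [Real.sq_sqrt (by linarith)]
  rw [profileProd, profileWeight, spinQuot, spinQuot]
  simp only [Polynomial.eval_mul, Polynomial.eval_pow, Polynomial.eval_sub,
    Polynomial.eval_one, Polynomial.eval_C, Polynomial.eval_X]
  rw [h]
  ring

theorem spinConst_sq (s : ℤ) (l : ℕ) (m : ℤ) (hs : s.natAbs ≤ l) (hm : m.natAbs ≤ l) :
    spinConst s l m * spinConst s l m *
      (2 * Real.pi * profileInt (spinSign s m) m.natAbs s.natAbs l l) = 1 := by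
  have h := profileInt_self (spinSign s m) (spinSign_sq s m) m.natAbs s.natAbs l hm hs
  have h1 : ((if 0 ≤ m then (-1 : ℝ) ^ m.natAbs else 1) *
      (if 0 ≤ s then 1 else (-1) ^ s.natAbs)) ^ 2 = 1 := by
    rw [mul_pow]
    split_ifs <;> simp [← pow_mul, mul_comm _ 2]
  have h2 : √(((l - s.natAbs).factorial : ℝ) / (l + s.natAbs).factorial) ^ 2 =
      ((l - s.natAbs).factorial : ℝ) / (l + s.natAbs).factorial := Real.sq_sqrt (by positivity)
  have h3 : harmonicConst l m.natAbs ^ 2 = ((2 * l + 1) / (4 * Real.pi) *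
      ((l - m.natAbs).factorial / (l + m.natAbs).factorial)) / (2 ^ l * l.factorial) ^ 2 := by
    rw [harmonicConst, div_pow, Real.sq_sqrt (by positivity)]
  rw [← sq, spinConst, mul_pow, h1, mul_pow, h2, h3, mul_one]
  have hp := Real.pi_ne_zero
  have f1 : ((l + s.natAbs).factorial : ℝ) ≠ 0 := by positivity
  have f2 : ((l + m.natAbs).factorial : ℝ) ≠ 0 := by positivity
  have f3 : (2 ^ l * l.factorial : ℝ) ≠ 0 := by positivity
  generalize (2 ^ l * l.factorial : ℝ) = N at *
  field_simp
  linear_combination 2 * h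

/-- The indices `(l, m)` of the spin `s` spherical harmonics. -/
abbrev HarmonicIndex (s : ℤ) : Type := {x : ℕ × ℤ // s.natAbs ≤ x.1 ∧ x.2.natAbs ≤ x.1}

/-- Different `m` are separated by axial rotations. For equal `m` the phases cancel, and Archimedes'
theorem reduces the inner product to `2π` times `profileInt`. -/
theorem orthonormal_spinHarmonic (s : ℤ) :
    Orthonormal ℂ (fun x : HarmonicIndex s => spinHarmonic s x.1.1 x.1.2) := by
  rw [orthonormal_iff_ite]
  rintro ⟨⟨l, m⟩, hs, hm⟩ ⟨⟨l', m'⟩, hs', hm'⟩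
  change ⟪SpinL2.comp 1 (spinHarmonic s l m), SpinL2.comp 1 (spinHarmonic s l' m')⟫_ℂ = _
  rw [L2.inner_def]
  simp only [Subtype.mk.injEq, Prod.mk.injEq] at *
  have h1 : ∀ᵐ p ∂surf, ⟪SpinL2.comp 1 (spinHarmonic s l m) p,
      SpinL2.comp 1 (spinHarmonic s l' m') p⟫_ℂ =
      (starRingEnd ℂ) (phase p ^ m) * phase p ^ m' *
        ((spinConst s l m * spinConst s l' m' *
          ((profileWeight s m (p.1 2) * (spinQuot s l m).eval (p.1 2)) *
          (profileWeight s m' (p.1 2) * (spinQuot s l' m').eval (p.1 2))) : ℝ) : ℂ) := by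
    filter_upwards [spinHarmonic_comp_one_ae_eq s l m, spinHarmonic_comp_one_ae_eq s l' m']
      with p h1 h2
    rw [h1, h2, RCLike.inner_apply, map_mul, map_mul, Complex.conj_ofReal, Complex.conj_ofReal]
    push_cast
    ring
  rw [integral_congr_ae h1]
  by_cases hmm : m = m'
  · subst hmm
    have h2 : ∀ᵐ p ∂surf, (starRingEnd ℂ) (phase p ^ m) * phase p ^ m *
        ((spinConst s l m * spinConst s l' m *
          ((profileWeight s m (p.1 2) * (spinQuot s l m).eval (p.1 2)) *
          (profileWeight s m (p.1 2) * (spinQuot s l' m).eval (p.1 2))) : ℝ) : ℂ) =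
        ((spinConst s l m * spinConst s l' m *
          (profileProd (spinSign s m) m.natAbs s.natAbs l l').eval (p.1 2) : ℝ) : ℂ) := by
      filter_upwards [norm_phase_ae] with p hp
      have e : (starRingEnd ℂ) (phase p ^ m) * phase p ^ m = 1 := by
        rw [Complex.conj_mul', norm_zpow, hp, one_zpow]
        simp
      rw [e, one_mul, profileWeight_mul_spinQuot s m l l' (coord_two_sq_le p)]
    rw [integral_congr_ae h2, integral_complex_ofReal, integral_const_mul, integral_eval_coord_two,
      ← profileInt]
    by_cases hll : l = l'
    · subst hll
      rw [spinConst_sq s l m hs hm]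
      simp
    · rw [profileInt_of_ne _ (spinSign_sq s m) _ _ hll]
      simp [hll]
  · rw [if_neg fun h => hmm h.2]
    exact integral_phase_of_ne hmm (fun z => ((spinConst s l m * spinConst s l' m' *
          ((profileWeight s m z * (spinQuot s l m).eval z) *
          (profileWeight s m' z * (spinQuot s l' m').eval z)) : ℝ) : ℂ))

/-! ### Completeness -/

theorem integrable_continuous_coord_mul {G : S2 → ℂ} (hG : Integrable G surf) {h : ℝ → ℝ}
    (hh : Continuous h) : Integrable (fun p : S2 => (h (p.1 2) : ℂ) * G p) surf := by
  have hc : Continuous fun p : S2 => (h (p.1 2) : ℂ) := by fun_prop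
  obtain ⟨K, hK⟩ := isCompact_univ.exists_bound_of_continuousOn hc.continuousOn
  exact hG.bdd_mul hc.aestronglyMeasurable
    (Filter.Eventually.of_forall fun p => hK p (Set.mem_univ p))

theorem integral_continuous_coord_mul_eq_zero {G : S2 → ℂ} (hG : Integrable G surf)
    (h : ∀ q : Polynomial ℝ, ∫ p, ((q.eval (p.1 2) : ℝ) : ℂ) * G p ∂surf = 0) {r : ℝ → ℝ}
    (hr : Continuous r) : ∫ p, (r (p.1 2) : ℂ) * G p ∂surf = 0 := by
  rw [← norm_le_zero_iff]
  refine le_of_forall_pos_le_add fun ε hε => ?_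
  set M := ∫ p, ‖G p‖ ∂surf with hM
  have hM0 : 0 ≤ M := integral_nonneg fun p => norm_nonneg _
  -- The error is at most the tolerance times `M`; using `M + 1` keeps the tolerance meaningful when
  -- `M = 0`.
  obtain ⟨q, hq⟩ := exists_polynomial_near_of_continuousOn (-1) 1 r hr.continuousOn (ε / (M + 1))
    (by positivity)
  have h1 : ∫ p, (r (p.1 2) : ℂ) * G p ∂surf =
      ∫ p, ((r (p.1 2) - q.eval (p.1 2) : ℝ) : ℂ) * G p ∂surf := by
    rw [← sub_zero (∫ p, (r (p.1 2) : ℂ) * G p ∂surf), ← h q,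
      ← integral_sub (integrable_continuous_coord_mul hG hr)
        (integrable_continuous_coord_mul hG q.continuous)]
    congr 1
    funext p
    push_cast
    ring
  rw [h1, zero_add]
  calc ‖∫ p, ((r (p.1 2) - q.eval (p.1 2) : ℝ) : ℂ) * G p ∂surf‖
      ≤ ∫ p, ε / (M + 1) * ‖G p‖ ∂surf := by
        refine norm_integral_le_of_norm_le (hG.norm.const_mul _)
          (Filter.Eventually.of_forall fun p => ?_)
        rw [norm_mul, Complex.norm_real, Real.norm_eq_abs, abs_sub_comm]
        have hp := abs_le.1 ((sq_le_one_iff_abs_le_one _).1 (coord_two_sq_le p))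
        exact mul_le_mul_of_nonneg_right (hq _ hp).le (norm_nonneg _)
    _ = ε * (M / (M + 1)) := by
        rw [integral_const_mul, ← hM]
        ring
    _ ≤ ε * 1 := by
        refine mul_le_mul_of_nonneg_left ?_ hε.le
        rw [div_le_one (by positivity)]
        linarith
    _ = ε := mul_one ε

theorem coord_two_sq_lt_ae : ∀ᵐ p : S2 ∂surf, p.1 2 ^ 2 < 1 := by
  filter_upwards [ae_colat 1] with p hp
  have h : (chartPt 1 (colat 1 p) (lon 1 p)).1 2 = Real.cos (colat 1 p) := chartPt_one_apply _ _ 2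
  rw [chartPt_colat_lon] at h
  rw [h]
  have h1 := pow_pos (Real.sin_pos_of_mem_Ioo hp) 2
  linarith [Real.sin_sq_add_cos_sq (colat 1 p)]

/-- The quotient `r / κ` may blow up at the poles, so it is replaced by the continuous function `κ r
/ (κ² + δ)`. Times `κ`, this is `r` multiplied by `κ² / (κ² + δ) ≤ 1`, which tends to `1` off the
poles; dominated convergence applies. -/
theorem integral_coord_mul_eq_zero_of_weight {G : S2 → ℂ} (hG : Integrable G surf) {κ : ℝ → ℝ}
    (hκ : Continuous κ) (hκ0 : ∀ z : ℝ, z ^ 2 < 1 → κ z ≠ 0)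
    (h : ∀ q : Polynomial ℝ, ∫ p, ((κ (p.1 2) * q.eval (p.1 2) : ℝ) : ℂ) * G p ∂surf = 0)
    {r : ℝ → ℝ} (hr : Continuous r) : ∫ p, (r (p.1 2) : ℂ) * G p ∂surf = 0 := by
  have hκG := integrable_continuous_coord_mul hG hκ
  have hδ : ∀ n : ℕ, (0 : ℝ) < 1 / (n + 1) := fun n => by positivity
  have h0 : ∀ n : ℕ, ∫ p, ((κ (p.1 2) * r (p.1 2) / (κ (p.1 2) ^ 2 + 1 / (n + 1)) : ℝ) : ℂ) *
      ((κ (p.1 2) : ℂ) * G p) ∂surf = 0 := by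
    intro n
    refine integral_continuous_coord_mul_eq_zero hκG (fun q => ?_)
      (r := fun z => κ z * r z / (κ z ^ 2 + 1 / (n + 1))) ?_
    · rw [← h q]
      congr 1
      funext p
      push_cast
      ring
    · refine (hκ.mul hr).div (by fun_prop) fun z => ?_
      have := hδ n
      positivity
  have hlim : Filter.Tendsto (fun n : ℕ => ∫ p,
      ((κ (p.1 2) * r (p.1 2) / (κ (p.1 2) ^ 2 + 1 / (n + 1)) : ℝ) : ℂ) *
      ((κ (p.1 2) : ℂ) * G p) ∂surf) Filter.atTop
      (nhds (∫ p, (r (p.1 2) : ℂ) * G p ∂surf)) := by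
    refine tendsto_integral_of_dominated_convergence (fun p => ‖(r (p.1 2) : ℂ) * G p‖)
      (fun n => ?_) (integrable_continuous_coord_mul hG hr).norm (fun n => ?_) ?_
    · refine (integrable_continuous_coord_mul hκG
        (h := fun z => κ z * r z / (κ z ^ 2 + 1 / (n + 1))) ?_).aestronglyMeasurable
      refine (hκ.mul hr).div (by fun_prop) fun z => ?_
      have := hδ n
      positivity
    · refine Filter.Eventually.of_forall fun p => ?_
      have hδ := hδ n
      generalize (1 / ((n : ℝ) + 1)) = δ at *
      have e : ((κ (p.1 2) * r (p.1 2) / (κ (p.1 2) ^ 2 + δ) : ℝ) : ℂ) * ((κ (p.1 2) : ℂ) * G p) =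
          ((κ (p.1 2) ^ 2 / (κ (p.1 2) ^ 2 + δ) : ℝ) : ℂ) * ((r (p.1 2) : ℂ) * G p) := by
        push_cast
        ring
      rw [e, norm_mul _ ((r (p.1 2) : ℂ) * G p)]
      refine mul_le_of_le_one_left (norm_nonneg _) ?_
      rw [Complex.norm_real, Real.norm_of_nonneg (by positivity), div_le_one (by positivity)]
      linarith
    · filter_upwards [coord_two_sq_lt_ae] with p hp
      have hk := hκ0 _ hp
      have e : (r (p.1 2) : ℂ) * G p = ((κ (p.1 2) * r (p.1 2) / (κ (p.1 2) ^ 2 + 0) : ℝ) : ℂ) *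
          ((κ (p.1 2) : ℂ) * G p) := by
        have hk' : (κ (p.1 2) : ℂ) ≠ 0 := Complex.ofReal_ne_zero.2 hk
        push_cast
        field_simp
        ring
      rw [e]
      refine Filter.Tendsto.mul_const _ ((Complex.continuous_ofReal.tendsto _).comp ?_)
      refine Filter.Tendsto.div tendsto_const_nhds
        (tendsto_const_nhds.add tendsto_one_div_add_atTop_nhds_zero_nat) ?_
      simpa using hk
  simp only [h0] at hlim
  exact (tendsto_nhds_unique hlim tendsto_const_nhds)

theorem linearMap_eq_zero_of_natDegree {V : Type*} [AddCommGroup V] [Module ℝ V]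
    (L : Polynomial ℝ →ₗ[ℝ] V) (q : ℕ → Polynomial ℝ) (hq : ∀ d, (q d).natDegree = d)
    (hq0 : ∀ d, q d ≠ 0) (h : ∀ d, L (q d) = 0) : L = 0 := by
  let S : Polynomial.Sequence ℝ := ⟨q, fun d => by rw [Polynomial.degree_eq_natDegree (hq0 d), hq]⟩
  refine LinearMap.ext_on (S.span fun i => ?_) ?_
  · exact isUnit_iff_ne_zero.2 (Polynomial.leadingCoeff_ne_zero.2 (hq0 i))
  · rintro _ ⟨d, rfl⟩
    exact h d

theorem continuous_profileWeight (s m : ℤ) : Continuous (profileWeight s m) := by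
  unfold profileWeight
  fun_prop

theorem profileWeight_ne_zero (s m : ℤ) (z : ℝ) (hz : z ^ 2 < 1) : profileWeight s m z ≠ 0 := by
  have h1 : 0 < 1 - z ^ 2 := by linarith
  have h2 : 1 - spinSign s m * z ≠ 0 := by
    intro h
    have h3 : (spinSign s m * z) ^ 2 = 1 := by
      rw [← sub_eq_zero.1 h, one_pow]
    rw [mul_pow, spinSign_sq, one_mul] at h3
    linarith
  exact mul_ne_zero (pow_ne_zero _ (Real.sqrt_pos.2 h1).ne') (pow_ne_zero _ h2)

theorem measurable_phase : Measurable phase := by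
  unfold phase
  have : ∀ i, Measurable fun p : S2 => p.1 i := fun i => (continuous_coord i).measurable
  exact ((Complex.measurable_ofReal.comp (this 0)).add
    ((Complex.measurable_ofReal.comp (this 1)).const_mul _)).div
    (Complex.measurable_ofReal.comp (Real.continuous_sqrt.measurable.comp
      (((this 2).pow_const 2).const_sub 1)))

theorem spinConst_ne_zero (s : ℤ) (l : ℕ) (m : ℤ) (hs : s.natAbs ≤ l) (hm : m.natAbs ≤ l) :
    spinConst s l m ≠ 0 := by
  intro h
  have := spinConst_sq s l m hs hm
  rw [h] at this
  simp at this

theorem integrable_phase_mul (f : ScalarL2) (m : ℤ) :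
    Integrable (fun p => (starRingEnd ℂ) (phase p ^ m) * f p) surf := by
  have hf : Integrable f surf := (Lp.memLp f).integrable one_le_two
  refine hf.bdd_mul (c := 1)
    (Complex.continuous_conj.measurable.comp
      (measurable_phase.pow_const m)).aestronglyMeasurable ?_
  filter_upwards [norm_phase_ae] with p hp
  rw [RCLike.norm_conj, norm_zpow, hp, one_zpow]

/-- For fixed `m`, orthogonality to the harmonics of all degrees `l ≥ max(|m|, |s|)` annihilates the
weight times one polynomial of each degree, hence times every polynomial. The weight is then
removed. -/
theorem integral_phase_mul_eq_zero (s : ℤ) (f : ScalarL2)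
    (h : ∀ x : HarmonicIndex s, ⟪SpinL2.comp 1 (spinHarmonic s x.1.1 x.1.2), f⟫_ℂ = 0) (m : ℤ)
    {r : ℝ → ℝ} (hr : Continuous r) :
    ∫ p, (r (p.1 2) : ℂ) * ((starRingEnd ℂ) (phase p ^ m) * f p) ∂surf = 0 := by
  have hG := integrable_phase_mul f m
  have hκ := continuous_profileWeight s m
  refine integral_coord_mul_eq_zero_of_weight hG hκ (profileWeight_ne_zero s m) ?_ hr
  have hi : ∀ q : Polynomial ℝ, Integrable (fun p : S2 => ((profileWeight s m (p.1 2) *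
      q.eval (p.1 2) : ℝ) : ℂ) * ((starRingEnd ℂ) (phase p ^ m) * f p)) surf := fun q =>
    integrable_continuous_coord_mul hG (hκ.mul q.continuous)
  let L : Polynomial ℝ →ₗ[ℝ] ℂ :=
    { toFun := fun q => ∫ p, ((profileWeight s m (p.1 2) * q.eval (p.1 2) : ℝ) : ℂ) *
        ((starRingEnd ℂ) (phase p ^ m) * f p) ∂surf
      map_add' := fun q q' => by
        rw [← integral_add (hi q) (hi q')]
        congr 1
        funext p
        rw [Polynomial.eval_add]
        push_cast
        ring
      map_smul' := fun c q => by
        rw [RingHom.id_apply, Complex.real_smul, ← integral_const_mul]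
        congr 1
        funext p
        rw [Polynomial.eval_smul, smul_eq_mul]
        push_cast
        ring }
  have hL : L = 0 := by
    refine linearMap_eq_zero_of_natDegree L
      -- The shift by the maximum gives the `d`-th polynomial degree exactly `d`.
      (fun d => spinQuot s (max m.natAbs s.natAbs + d) m) (fun d => ?_) (fun d => ?_) fun d => ?_
    · rw [spinQuot, (natDegree_profileQuot _ (spinSign_sq s m) _ _ _ (by omega) (by omega)).1]
      omega
    · exact (natDegree_profileQuot _ (spinSign_sq s m) _ _ _ (by omega) (by omega)).2
    · have hs : s.natAbs ≤ max m.natAbs s.natAbs + d := by omega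
      have hm : m.natAbs ≤ max m.natAbs s.natAbs + d := by omega
      generalize max m.natAbs s.natAbs + d = l at *
      have h1 := h ⟨(l, m), hs, hm⟩
      rw [L2.inner_def] at h1
      have hc : (spinConst s l m : ℂ) ≠ 0 := Complex.ofReal_ne_zero.2 (spinConst_ne_zero s l m hs hm)
      apply mul_left_cancel₀ hc
      rw [mul_zero, ← h1]
      change _ * ∫ p, _ ∂surf = _
      rw [← integral_const_mul]
      refine integral_congr_ae ?_
      filter_upwards [spinHarmonic_comp_one_ae_eq s l m] with p hp
      rw [hp, RCLike.inner_apply, map_mul, map_mul, Complex.conj_ofReal, Complex.conj_ofReal]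
      ring
  intro q
  exact DFunLike.congr_fun hL q

/-- The coordinate function `x + i y`. -/
def coordW : C(S2, ℂ) := ⟨fun p => (p.1 0 : ℂ) + Complex.I * (p.1 1 : ℂ), by fun_prop⟩

/-- The coordinate function `z`. -/
def coordZ : C(S2, ℂ) := ⟨fun p => (p.1 2 : ℂ), by fun_prop⟩

theorem coordW_ae : ∀ᵐ p ∂surf, coordW p = (√(1 - p.1 2 ^ 2) : ℝ) * phase p := by
  filter_upwards [coord_two_sq_lt_ae] with p hp
  have h : ((√(1 - p.1 2 ^ 2) : ℝ) : ℂ) ≠ 0 :=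
    Complex.ofReal_ne_zero.2 (Real.sqrt_pos.2 (by linarith)).ne'
  exact (mul_div_cancel₀ _ h).symm

/-- With `W = x + iy = sin ϑ e^{iφ}`, the monomial `W^a W̄^b z^c` is the phase to the power `a - b`
times a continuous function of `z`. -/
theorem integral_monomial_mul_eq_zero (s : ℤ) (f : ScalarL2)
    (h : ∀ x : HarmonicIndex s, ⟪SpinL2.comp 1 (spinHarmonic s x.1.1 x.1.2), f⟫_ℂ = 0)
    (a b c : ℕ) :
    ∫ p, (starRingEnd ℂ) ((coordW ^ a * star coordW ^ b * coordZ ^ c : C(S2, ℂ)) p) * f p ∂surf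
      = 0 := by
  rw [← integral_phase_mul_eq_zero s f h ((a : ℤ) - b)
    (r := fun z => √(1 - z ^ 2) ^ (a + b) * z ^ c) (by fun_prop)]
  refine integral_congr_ae ?_
  filter_upwards [coordW_ae, norm_phase_ae] with p hp h1
  have h0 : phase p ≠ 0 := norm_ne_zero_iff.1 (by rw [h1]; exact one_ne_zero)
  have h2 : (starRingEnd ℂ) (phase p) = (phase p)⁻¹ := by
    apply eq_inv_of_mul_eq_one_left
    rw [Complex.conj_mul', h1]
    simp
  have hz : coordZ p = (p.1 2 : ℂ) := rfl
  simp only [ContinuousMap.mul_apply, ContinuousMap.pow_apply, ContinuousMap.star_apply, hp, hz,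
    RCLike.star_def, map_mul, map_pow, Complex.conj_ofReal, map_zpow₀, h2, inv_inv, map_inv₀]
  rw [sub_eq_add_neg (a : ℤ), zpow_add₀ (inv_ne_zero h0), zpow_neg, zpow_natCast, zpow_natCast, inv_pow,
    inv_pow, inv_inv]
  push_cast
  ring

/-- The star algebra generated by the coordinate functions. -/
def coordAlgebra : StarSubalgebra ℂ C(S2, ℂ) := StarAlgebra.adjoin ℂ {coordW, coordZ}

theorem coordAlgebra_topologicalClosure : coordAlgebra.topologicalClosure = ⊤ := by
  apply ContinuousMap.starSubalgebra_topologicalClosure_eq_top_of_separatesPoints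
  intro p q hpq
  by_contra! hne
  apply hpq
  have hW := hne coordW ⟨coordW, StarAlgebra.subset_adjoin ℂ _ (by simp), rfl⟩
  have hZ := hne coordZ ⟨coordZ, StarAlgebra.subset_adjoin ℂ _ (by simp), rfl⟩
  have h0 := congrArg Complex.re hW
  have h1 := congrArg Complex.im hW
  have h2 := congrArg Complex.re hZ
  simp [coordW, coordZ] at h0 h1 h2
  apply Subtype.ext
  ext i
  fin_cases i
  exacts [h0, h1, h2]

theorem mem_span_of_mem_coordAlgebra {g : C(S2, ℂ)} (hg : g ∈ coordAlgebra) :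
    g ∈ Submodule.span ℂ (Set.range fun x : ℕ × ℕ × ℕ =>
      (coordW ^ x.1 * star coordW ^ x.2.1 * coordZ ^ x.2.2 : C(S2, ℂ))) := by
  have hz : star coordZ = coordZ := by
    ext p
    exact Complex.conj_ofReal _
  have h1 : g ∈ Subalgebra.toSubmodule
      (Algebra.adjoin ℂ ({coordW, coordZ} ∪ star {coordW, coordZ} : Set C(S2, ℂ))) := hg
  rw [Algebra.adjoin_eq_span] at h1
  refine Submodule.span_mono ?_ h1
  intro u hu
  induction hu using Submonoid.closure_induction with
  | mem u hu =>
    simp only [Set.mem_union, Set.mem_insert_iff, Set.mem_singleton_iff, Set.mem_star] at hu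
    rcases hu with (rfl | rfl) | (h | h)
    · exact ⟨(1, 0, 0), by simp⟩
    · exact ⟨(0, 0, 1), by simp⟩
    · exact ⟨(0, 1, 0), by simp [← h]⟩
    · exact ⟨(0, 0, 1), by
        rw [← star_star u, h, hz]
        simp⟩
  | one => exact ⟨(0, 0, 0), by simp⟩
  | mul u v _ _ hu hv =>
    obtain ⟨⟨a, b, c⟩, rfl⟩ := hu
    obtain ⟨⟨a', b', c'⟩, rfl⟩ := hv
    refine ⟨(a + a', b + b', c + c'), ?_⟩
    dsimp only
    ring

/-- The monomials in `W`, `W̄`, `z` span a star algebra separating points, dense in the continuous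
functions by Stone–Weierstrass and so in `L²`; `f` is orthogonal to all of them. -/
theorem eq_zero_of_inner_spinHarmonic_eq_zero (s : ℤ) (f : ScalarL2)
    (h : ∀ x : HarmonicIndex s, ⟪SpinL2.comp 1 (spinHarmonic s x.1.1 x.1.2), f⟫_ℂ = 0) :
    f = 0 := by
  let T : C(S2, ℂ) →L[ℂ] ScalarL2 := ContinuousMap.toLp 2 surf ℂ
  let K : Submodule ℂ C(S2, ℂ) := ((ℂ ∙ f)ᗮ).comap T.toLinearMap
  have hKmem : ∀ g, g ∈ K ↔ ⟪T g, f⟫_ℂ = 0 := by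
    intro g
    change T g ∈ (ℂ ∙ f)ᗮ ↔ _
    rw [Submodule.mem_orthogonal_singleton_iff_inner_left]
  have hKclosed : IsClosed (K : Set C(S2, ℂ)) :=
    (Submodule.isClosed_orthogonal _).preimage T.continuous
  have hsub : (coordAlgebra : Set C(S2, ℂ)) ⊆ K := by
    intro g hg
    refine Submodule.span_le.2 ?_ (mem_span_of_mem_coordAlgebra hg)
    rintro _ ⟨⟨a, b, c⟩, rfl⟩
    refine (hKmem _).2 ?_
    rw [L2.inner_def, ← integral_monomial_mul_eq_zero s f h a b c]
    refine integral_congr_ae ?_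
    filter_upwards [ContinuousMap.coeFn_toLp (E := ℂ) (p := 2) (𝕜 := ℂ) surf
      (coordW ^ a * star coordW ^ b * coordZ ^ c)] with p hp
    rw [RCLike.inner_apply, mul_comm]
    change (starRingEnd ℂ) (ContinuousMap.toLp 2 surf ℂ _ p) * _ = _
    rw [hp]
  have hall : ∀ g : C(S2, ℂ), ⟪T g, f⟫_ℂ = 0 := by
    intro g
    have h1 : g ∈ coordAlgebra.topologicalClosure := by
      rw [coordAlgebra_topologicalClosure]
      trivial
    exact (hKmem g).1 (closure_minimal hsub hKclosed h1)
  have hd : DenseRange T := ContinuousMap.toLp_denseRange ℂ surf ℂ (by simp)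
  have h2 : ∀ g : ScalarL2, ⟪g, f⟫_ℂ = 0 := fun g =>
    hd.induction_on g (isClosed_eq (by fun_prop) continuous_const) hall
  exact inner_self_eq_zero.1 (h2 f)

/-! ### The component isometry and the unitary map -/

theorem exists_frameAt_ne_zero (R : SO3) (p : S2) : ∃ i, frameAt 1 R p (Sum.inr i) ≠ 0 := by
  by_contra! h
  have h0 : refDir R p = 0 := by
    funext i
    have h1 := congrArg Complex.im (h i)
    rw [frameAt_inr] at h1
    simpa using h1
  have h2 := refDir_dot_self R p
  rw [h0] at h2
  simp at h2

/-- A change of chart multiplies the complex tangent vector `ρ × p + i ρ` by `e^{iψ}`. Passing from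
`R₁` to `R₃` directly or through `R₂` and comparing a nonzero component gives the cocycle rule. -/
theorem exp_spinAngle_mul (R₁ R₂ R₃ : SO3) (p : S2) :
    Complex.exp (Complex.I * spinAngle p R₃ R₂) * Complex.exp (Complex.I * spinAngle p R₂ R₁) =
      Complex.exp (Complex.I * spinAngle p R₃ R₁) := by
  obtain ⟨i, hi⟩ := exists_frameAt_ne_zero R₁ p
  have h1 := frameAt_change 1 (Or.inl rfl) R₁ R₂ p i
  have h2 := frameAt_change 1 (Or.inl rfl) R₂ R₃ p i
  have h3 := frameAt_change 1 (Or.inl rfl) R₁ R₃ p i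
  rw [h1, h3, Complex.ofReal_one, one_mul, one_mul, one_mul, ← mul_assoc] at h2
  exact (mul_right_cancel₀ hi h2).symm

theorem exp_spin_mul_spinAngle (s : ℤ) (R₁ R₂ : SO3) (p : S2) :
    Complex.exp (Complex.I * s * spinAngle p R₂ R₁) =
      Complex.exp (Complex.I * spinAngle p R₂ R₁) ^ s := by
  rw [← Complex.exp_int_mul]
  congr 1
  ring

theorem measurable_refDir (R : SO3) (i : Fin 3) : Measurable fun p => refDir R p i := by
  have h : Continuous fun x : ℝ => (R.1 *ᵥ ![-Real.sin x, Real.cos x, 0]) i := by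
    simp only [Matrix.mulVec, dotProduct, Fin.sum_univ_three, Matrix.cons_val]
    fun_prop
  exact h.measurable.comp (measurable_lon R)

theorem measurable_exp_spinAngle (R₁ R₂ : SO3) :
    Measurable fun p => Complex.exp (Complex.I * spinAngle p R₂ R₁) := by
  have h : (fun p => Complex.exp (Complex.I * spinAngle p R₂ R₁)) = fun p =>
      ((refDir R₁ p ⬝ᵥ refDir R₂ p : ℝ) : ℂ) +
        (((refDir R₁ p ⨯₃ p.1.ofLp) ⬝ᵥ refDir R₂ p : ℝ) : ℂ) * Complex.I := by
    funext p
    rw [exp_spinAngle, Complex.mk_eq_add_mul_I]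
  rw [h]
  simp only [cross_apply, dotProduct, Fin.sum_univ_three, Matrix.cons_val]
  have h1 := measurable_refDir R₁
  have h2 := measurable_refDir R₂
  have h3 : ∀ i, Measurable fun p : S2 => p.1.ofLp i := fun i => (continuous_coord i).measurable
  refine (Complex.measurable_ofReal.comp ?_).add ((Complex.measurable_ofReal.comp ?_).mul_const _)
  · exact (((h1 0).mul (h2 0)).add ((h1 1).mul (h2 1))).add ((h1 2).mul (h2 2))
  · exact ((((((h1 1).mul (h3 2)).sub ((h1 2).mul (h3 1))).mul (h2 0)).add
      ((((h1 2).mul (h3 0)).sub ((h1 0).mul (h3 2))).mul (h2 1)))).add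
      ((((h1 0).mul (h3 1)).sub ((h1 1).mul (h3 0))).mul (h2 2))

theorem norm_exp_I_mul (x : ℝ) : ‖Complex.exp (Complex.I * x)‖ = 1 := by
  rw [mul_comm, Complex.norm_exp_ofReal_mul_I]

theorem memLp_exp_spinAngle_mul (s : ℤ) (R : SO3) (f : ScalarL2) :
    MemLp (fun p => Complex.exp (Complex.I * s * spinAngle p R 1) * f p) 2 surf := by
  simp only [exp_spin_mul_spinAngle]
  refine MemLp.of_le (Lp.memLp f) ((((measurable_exp_spinAngle 1 R).pow_const
    s).aestronglyMeasurable).mul (Lp.memLp f).aestronglyMeasurable)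
    (Filter.Eventually.of_forall fun p => ?_)
  rw [norm_mul, norm_zpow, norm_exp_I_mul, one_zpow, one_mul]

/-- A prescribed component `f` in the standard chart extends by `F_R = e^{isψ} f`, and the cocycle
rule makes this family compatible. -/
theorem SpinL2.comp_one_surjective (s : ℤ) : Function.Surjective (SpinL2.comp (s := s) 1) := by
  intro f
  refine ⟨⟨fun R => (memLp_exp_spinAngle_mul s R f).toLp _, fun R₁ R₂ => ?_⟩, ?_⟩
  · filter_upwards [(memLp_exp_spinAngle_mul s R₁ f).coeFn_toLp,
      (memLp_exp_spinAngle_mul s R₂ f).coeFn_toLp] with p h1 h2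
    rw [h1, h2, ← mul_assoc, exp_spin_mul_spinAngle, exp_spin_mul_spinAngle,
      exp_spin_mul_spinAngle, ← mul_zpow, exp_spinAngle_mul]
  · refine Lp.ext ?_
    change (memLp_exp_spinAngle_mul s 1 f).toLp _ =ᵐ[surf] f
    filter_upwards [(memLp_exp_spinAngle_mul s 1 f).coeFn_toLp] with p h1
    -- The cocycle rule with three equal rotations says `z · z = z` with `z ≠ 0`.
    have h2 : Complex.exp (Complex.I * spinAngle p 1 1) = 1 :=
      mul_left_cancel₀ (Complex.exp_ne_zero (Complex.I * spinAngle p 1 1))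
        ((exp_spinAngle_mul 1 1 1 p).trans (mul_one _).symm)
    rw [h1, exp_spin_mul_spinAngle, h2, one_zpow, one_mul]

/-- The component in the standard chart, as an isometry of `L²_s` onto `L²`. -/
def SpinL2.compEquiv (s : ℤ) : SpinL2 s ≃ₗᵢ[ℂ] ScalarL2 :=
  LinearIsometryEquiv.ofSurjective ⟨SpinL2.comp 1, fun _ => rfl⟩ (SpinL2.comp_one_surjective s)

instance (s : ℤ) : CompleteSpace (SpinL2 s) :=
  (completeSpace_congr (e := (SpinL2.compEquiv s).toEquiv)
    (SpinL2.compEquiv s).isometry.isUniformEmbedding).2 inferInstance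

/-- The Hilbert basis of spin spherical harmonics. -/
def spinBasis (s : ℤ) : HilbertBasis (HarmonicIndex s) ℂ (SpinL2 s) :=
  HilbertBasis.mkOfOrthogonalEqBot (orthonormal_spinHarmonic s) <| by
    rw [Submodule.eq_bot_iff]
    intro F hF
    apply SpinL2.comp_one_injective s
    rw [map_zero]
    refine eq_zero_of_inner_spinHarmonic_eq_zero s _ fun x => ?_
    exact (Submodule.mem_orthogonal _ _).1 hF _ (Submodule.subset_span ⟨x, rfl⟩)

theorem spinBasis_apply (s : ℤ) (x : HarmonicIndex s) :
    spinBasis s x = spinHarmonic s x.1.1 x.1.2 := by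
  rw [spinBasis, HilbertBasis.coe_mkOfOrthogonalEqBot]

theorem scalarHarmonicL2_mem (s : ℤ) (x : HarmonicIndex s) :
    scalarHarmonicL2 x.1.1 x.1.2 ∈ scalarHighDegree s := by
  refine Submodule.le_topologicalClosure _ ?_
  refine Submodule.mem_iSup_of_mem ⟨x.1.1, x.2.1⟩ (Submodule.subset_span ⟨x.1.2, ?_, rfl⟩)
  have := x.2.2
  rw [Set.mem_Icc]
  dsimp only
  omega

instance (s : ℤ) : CompleteSpace (scalarHighDegree s) :=
  (Submodule.isClosed_topologicalClosure _).completeSpace_coe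

/-- The scalar harmonics are those of spin `0`, restricted here to degrees at least `|s|`. -/
theorem orthonormal_scalarHarmonicL2 (s : ℤ) : Orthonormal ℂ
    (fun x : HarmonicIndex s => (⟨_, scalarHarmonicL2_mem s x⟩ : scalarHighDegree s)) := by
  have h := (orthonormal_spinHarmonic 0).comp
    (fun x : HarmonicIndex s => (⟨x.1, by simp, x.2.2⟩ : HarmonicIndex 0))
    (fun x y h => Subtype.ext (congrArg (fun z : HarmonicIndex 0 => z.1) h))
  rw [orthonormal_iff_ite] at h ⊢
  intro x y
  rw [← h x y, Submodule.coe_inner]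
  change ⟪scalarHarmonicL2 x.1.1 x.1.2, scalarHarmonicL2 y.1.1 y.1.2⟫_ℂ = _
  rw [scalarHarmonicL2_eq, scalarHarmonicL2_eq]
  rfl

/-- The Hilbert basis of scalar spherical harmonics of degree at least `|s|`. -/
def scalarBasis (s : ℤ) : HilbertBasis (HarmonicIndex s) ℂ (scalarHighDegree s) :=
  HilbertBasis.mkOfOrthogonalEqBot (orthonormal_scalarHarmonicL2 s) <| by
    rw [Submodule.eq_bot_iff]
    intro F hF
    have h1 : scalarHighDegree s ≤ (ℂ ∙ (F : ScalarL2))ᗮ := by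
      refine Submodule.topologicalClosure_minimal _ (iSup_le fun l => Submodule.span_le.2 ?_)
        (Submodule.isClosed_orthogonal _)
      rintro _ ⟨m, hm, rfl⟩
      rw [Set.mem_Icc] at hm
      refine (Submodule.mem_orthogonal_singleton_iff_inner_left).2 ?_
      exact (Submodule.mem_orthogonal _ _).1 hF _
        (Submodule.subset_span ⟨⟨(l.1, m), l.2, by dsimp only; omega⟩, rfl⟩)
    exact Subtype.ext (inner_self_eq_zero.1
      ((Submodule.mem_orthogonal_singleton_iff_inner_left).1 (h1 F.2)))

theorem scalarBasis_apply (s : ℤ) (x : HarmonicIndex s) :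
    (scalarBasis s x : ScalarL2) = scalarHarmonicL2 x.1.1 x.1.2 := by
  rw [scalarBasis, HilbertBasis.coe_mkOfOrthogonalEqBot]

/-- The unitary map taking `Y_{lm}` to `Y_{lm,s}`. -/
def spinUnitary (s : ℤ) : scalarHighDegree s ≃ₗᵢ[ℂ] SpinL2 s :=
  (scalarBasis s).repr.trans (spinBasis s).repr.symm

theorem spinUnitary_symm_spinHarmonic (s : ℤ) (x : HarmonicIndex s) :
    ((spinUnitary s).symm (spinHarmonic s x.1.1 x.1.2) : ScalarL2) =
      scalarHarmonicL2 x.1.1 x.1.2 := by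
  classical
  rw [← spinBasis_apply, ← scalarBasis_apply, spinUnitary, LinearIsometryEquiv.symm_trans,
    LinearIsometryEquiv.trans_apply, LinearIsometryEquiv.symm_symm, HilbertBasis.repr_self,
    HilbertBasis.repr_symm_single]

/-! ### Cubature -/

/-- By Carathéodory, at most `dim E + 1` points suffice, so the hull is a finite union of continuous
images of compact sets `simplex × t^n`. -/
theorem isCompact_convexHull_of_finiteDimensional {E : Type*} [NormedAddCommGroup E]
    [NormedSpace ℝ E] [FiniteDimensional ℝ E] {t : Set E} (ht : IsCompact t) :
    IsCompact (convexHull ℝ t) := by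
  have h : convexHull ℝ t = ⋃ n ∈ Finset.range (Module.finrank ℝ E + 2),
      (fun x : (Fin n → ℝ) × (Fin n → E) => ∑ i, x.1 i • x.2 i) ''
        (stdSimplex ℝ (Fin n) ×ˢ Set.univ.pi fun _ => t) := by
    apply Set.Subset.antisymm
    · intro x hx
      obtain ⟨ι, _, z, w, hz, hind, hw, hw1, rfl⟩ := eq_pos_convex_span_of_mem_convexHull hx
      have hcard := hind.card_le_finrank_succ
      have hcard2 := Submodule.finrank_le (vectorSpan ℝ (Set.range z))
      let e := (Fintype.equivFin ι).symm
      refine Set.mem_iUnion₂.2 ⟨Fintype.card ι, Finset.mem_range.2 (by omega),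
        ⟨(fun i => w (e i), fun i => z (e i)), ⟨⟨fun i => (hw _).le, ?_⟩, ?_⟩, ?_⟩⟩
      · rw [← hw1]
        exact e.sum_comp w
      · exact fun i _ => hz ⟨e i, rfl⟩
      · exact e.sum_comp fun i => w i • z i
    · refine Set.iUnion₂_subset fun n _ => ?_
      rintro _ ⟨⟨w, z⟩, ⟨⟨hw, hw1⟩, hz⟩, rfl⟩
      exact (convex_convexHull ℝ t).sum_mem (fun i _ => hw i) hw1
        fun i _ => subset_convexHull ℝ t (hz i trivial)
  rw [h]
  refine (Finset.range _).isCompact_biUnion fun n _ => IsCompact.image ?_ (by fun_prop)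
  exact (isCompact_stdSimplex ℝ (Fin n)).prod (isCompact_univ_pi fun _ => ht)

/-- Tchakaloff's argument: `Φ` lists the monomials with all exponents at most `d`. Its mean lies in
the convex hull of its range, which is closed because it is compact. The coefficients of a convex
combination, times the total mass, are the weights. -/
theorem exists_isCubature (d : ℕ) : ∃ (n : ℕ) (ξ : Fin n → S2) (w : Fin n → ℝ),
    IsCubature d ξ w := by
  let Φ : S2 → (Fin 3 → Fin (d + 1)) → ℝ := fun p e => ∏ i, p.1 i ^ (e i : ℕ)
  have hΦ : Continuous Φ := by fun_prop
  have hne : surf ≠ 0 := Measure.toSphere_ne_zero _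
  have : NeZero surf := ⟨hne⟩
  have hM : 0 < surf.real Set.univ := by
    rw [measureReal_def]
    exact ENNReal.toReal_pos (fun h => hne (Measure.measure_univ_eq_zero.1 h)) (measure_ne_top _ _)
  have havg := (convex_convexHull ℝ (Set.range Φ)).average_mem
    (isCompact_convexHull_of_finiteDimensional (isCompact_range hΦ)).isClosed
    (Filter.Eventually.of_forall fun p => subset_convexHull ℝ _ ⟨p, rfl⟩)
    (integrable_of_continuous hΦ)
  rw [average_eq] at havg
  obtain ⟨ι, _, z, w, hz, -, hw, -, hs⟩ := eq_pos_convex_span_of_mem_convexHull havg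
  choose ξ hξ using fun i => hz ⟨i, rfl⟩
  let e := (Fintype.equivFin ι).symm
  refine ⟨Fintype.card ι, fun k => ξ (e k), fun k => surf.real Set.univ * w (e k), ?_, ?_⟩
  · exact fun k => mul_nonneg hM.le (hw _).le
  · intro q hq
    rw [e.sum_comp fun i => surf.real Set.univ * w i * MvPolynomial.eval (ξ i).1.ofLp q]
    have hmono : ∀ a ∈ q.support, ∫ p : S2, ∏ i, p.1 i ^ (a i) ∂surf =
        ∑ k, surf.real Set.univ * w k * ∏ i, (ξ k).1 i ^ (a i) := by
      intro a ha
      have hle : ∀ i, a i < d + 1 := by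
        intro i
        have h1 := MvPolynomial.le_totalDegree ha
        have h2 : a i ≤ a.sum fun _ e => e := by
          rw [Finsupp.sum_fintype _ _ fun _ => rfl]
          exact Finset.single_le_sum (f := fun j => a j) (fun j _ => Nat.zero_le _)
            (Finset.mem_univ i)
        omega
      have h := congrFun hs fun i => ⟨a i, hle i⟩
      rw [Pi.smul_apply, eval_integral fun j => integrable_of_continuous
        (f := fun p => Φ p j) ((continuous_apply j).comp hΦ), smul_eq_mul, eq_inv_mul_iff_mul_eq₀ hM.ne'] at h
      rw [← h, Finset.sum_apply, Finset.mul_sum]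
      refine Finset.sum_congr rfl fun k _ => ?_
      rw [Pi.smul_apply, ← hξ k, smul_eq_mul, mul_assoc]
    simp only [MvPolynomial.eval_eq', Finset.mul_sum]
    rw [Finset.sum_comm, integral_finsetSum _ fun a _ => integrable_of_continuous (by fun_prop)]
    refine Finset.sum_congr rfl fun a ha => ?_
    rw [integral_const_mul, hmono a ha, Finset.mul_sum]
    exact Finset.sum_congr rfl fun k _ => by ring

/-! ### Polynomial functions on the sphere and exactness of cubature for harmonics -/

/-- Restrictions to the sphere of complex polynomials of degree at most `d`. -/
def IsPolyFun (d : ℕ) (f : S2 → ℂ) : Prop :=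
  ∃ q₁ q₂ : MvPolynomial (Fin 3) ℝ, q₁.totalDegree ≤ d ∧ q₂.totalDegree ≤ d ∧
    ∀ p, f p = ((MvPolynomial.eval p.1.ofLp q₁ : ℝ) : ℂ) +
      ((MvPolynomial.eval p.1.ofLp q₂ : ℝ) : ℂ) * Complex.I

theorem IsPolyFun.of_real {d : ℕ} (q : MvPolynomial (Fin 3) ℝ) (hq : q.totalDegree ≤ d) :
    IsPolyFun d fun p => ((MvPolynomial.eval p.1.ofLp q : ℝ) : ℂ) :=
  ⟨q, 0, hq, by simp, fun p => by simp⟩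

theorem IsPolyFun.mul {d e : ℕ} {f g : S2 → ℂ} (hf : IsPolyFun d f) (hg : IsPolyFun e g) :
    IsPolyFun (d + e) fun p => f p * g p := by
  obtain ⟨a, b, ha, hb, hf⟩ := hf
  obtain ⟨a', b', ha', hb', hg⟩ := hg
  have hmul : ∀ x y : MvPolynomial (Fin 3) ℝ, x.totalDegree ≤ d → y.totalDegree ≤ e →
      (x * y).totalDegree ≤ d + e := fun x y hx hy =>
    (MvPolynomial.totalDegree_mul x y).trans (add_le_add hx hy)
  refine ⟨a * a' - b * b', a * b' + b * a', ?_, ?_, fun p => ?_⟩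
  · exact (MvPolynomial.totalDegree_sub _ _).trans (max_le (hmul _ _ ha ha') (hmul _ _ hb hb'))
  · exact (MvPolynomial.totalDegree_add _ _).trans (max_le (hmul _ _ ha hb') (hmul _ _ hb ha'))
  · dsimp only
    rw [hf, hg]
    simp only [map_sub, map_add, map_mul]
    push_cast
    linear_combination ((MvPolynomial.eval p.1.ofLp b : ℝ) : ℂ) *
      ((MvPolynomial.eval p.1.ofLp b' : ℝ) : ℂ) * Complex.I_sq

theorem IsPolyFun.conj {d : ℕ} {f : S2 → ℂ} (hf : IsPolyFun d f) :
    IsPolyFun d fun p => (starRingEnd ℂ) (f p) := by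
  obtain ⟨a, b, ha, hb, hf⟩ := hf
  refine ⟨a, -b, ha, by rwa [MvPolynomial.totalDegree_neg], fun p => ?_⟩
  dsimp only
  rw [hf]
  simp

theorem IsPolyFun.const (c : ℂ) : IsPolyFun 0 fun _ => c :=
  ⟨MvPolynomial.C c.re, MvPolynomial.C c.im, by simp, by simp, fun p => by simp⟩

theorem IsPolyFun.pow {f : S2 → ℂ} (hf : IsPolyFun 1 f) (n : ℕ) :
    IsPolyFun n fun p => f p ^ n := by
  induction n with
  | zero => simpa using IsPolyFun.const 1
  | succ n ih => simpa only [pow_succ] using ih.mul hf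

theorem IsPolyFun.integral_eq {d n : ℕ} {ξ : Fin n → S2} {w : Fin n → ℝ} (h : IsCubature d ξ w)
    {f : S2 → ℂ} (hf : IsPolyFun d f) : ∫ p, f p ∂surf = ∑ k, (w k : ℂ) * f (ξ k) := by
  obtain ⟨a, b, ha, hb, hf⟩ := hf
  have hi : ∀ q : MvPolynomial (Fin 3) ℝ,
      Integrable (fun p : S2 => ((MvPolynomial.eval p.1.ofLp q : ℝ) : ℂ)) surf := fun q =>
    integrable_of_continuous (Complex.continuous_ofReal.comp
      ((MvPolynomial.continuous_eval q).comp (by fun_prop)))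
  simp only [hf]
  rw [integral_add (hi a) ((hi b).mul_const _), integral_mul_const, integral_complex_ofReal,
    integral_complex_ofReal, h.exact_poly a ha, h.exact_poly b hb]
  push_cast
  simp only [mul_add, Finset.sum_add_distrib, Finset.sum_mul, mul_assoc]

/-- The power of `x ± iy` contributes degree `|m|` and the Legendre factor `l - |m|`. -/
theorem isPolyFun_scalarHarmonic (l : ℕ) (m : ℤ) (hm : m.natAbs ≤ l) :
    IsPolyFun l (scalarHarmonic l m) := by
  have hX : ∀ i : Fin 3, (MvPolynomial.X i : MvPolynomial (Fin 3) ℝ).totalDegree ≤ 1 := fun i =>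
    (MvPolynomial.totalDegree_X i).le
  have h1 : IsPolyFun 1 fun p => -((p.1 0 : ℂ) + Complex.I * (p.1 1 : ℂ)) :=
    ⟨-MvPolynomial.X 0, -MvPolynomial.X 1, by simp, by simp, fun p => by
      simp
      ring⟩
  have h2 : IsPolyFun 1 fun p => (p.1 0 : ℂ) - Complex.I * (p.1 1 : ℂ) :=
    ⟨MvPolynomial.X 0, -MvPolynomial.X 1, hX 0, by simp, fun p => by
      simp
      ring⟩
  have h3 : IsPolyFun (l - m.natAbs) fun p =>
      (((legendreDeriv l m.natAbs).eval (p.1 2) : ℝ) : ℂ) := by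
    have hd : (legendreDeriv l m.natAbs).natDegree ≤ l - m.natAbs := by
      rw [legendreDeriv, natDegree_iterate_derivative_eq, natDegree_sq_sub_one_pow]
      omega
    have hev : ∀ p : S2, (legendreDeriv l m.natAbs).eval (p.1 2) = MvPolynomial.eval p.1.ofLp
        (∑ i ∈ Finset.range ((legendreDeriv l m.natAbs).natDegree + 1),
          MvPolynomial.C ((legendreDeriv l m.natAbs).coeff i) * MvPolynomial.X 2 ^ i) := by
      intro p
      rw [Polynomial.eval_eq_sum_range]
      simp
    simp only [hev]
    refine IsPolyFun.of_real _ ((MvPolynomial.totalDegree_finsetSum _ _).trans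
      (Finset.sup_le fun i hi => ?_))
    refine (MvPolynomial.totalDegree_mul _ _).trans ?_
    rw [MvPolynomial.totalDegree_C, MvPolynomial.totalDegree_X_pow]
    rw [Finset.mem_range] at hi
    omega
  have h4 : IsPolyFun m.natAbs fun p : S2 =>
      if 0 ≤ m then (-((p.1 0 : ℂ) + Complex.I * (p.1 1 : ℂ))) ^ m.natAbs
      else ((p.1 0 : ℂ) - Complex.I * (p.1 1 : ℂ)) ^ m.natAbs := by
    split_ifs
    · exact h1.pow _
    · exact h2.pow _
  have h5 := ((IsPolyFun.const (harmonicConst l m.natAbs : ℂ)).mul h4).mul h3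
  rw [show 0 + m.natAbs + (l - m.natAbs) = l by omega] at h5
  exact h5

/-- Discrete orthonormality of the spherical harmonics at the cubature points. -/
theorem IsCubature.sum_scalarHarmonic {d n : ℕ} {ξ : Fin n → S2} {w : Fin n → ℝ}
    (h : IsCubature d ξ w) {s : ℤ} (x y : HarmonicIndex s) (hd : x.1.1 + y.1.1 ≤ d) :
    ∑ k, (w k : ℂ) * ((starRingEnd ℂ) (scalarHarmonic x.1.1 x.1.2 (ξ k)) *
      scalarHarmonic y.1.1 y.1.2 (ξ k)) = if x = y then 1 else 0 := by
  have hP := (isPolyFun_scalarHarmonic x.1.1 x.1.2 x.2.2).conj.mul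
    (isPolyFun_scalarHarmonic y.1.1 y.1.2 y.2.2)
  have hP' : IsPolyFun d fun p => (starRingEnd ℂ) (scalarHarmonic x.1.1 x.1.2 p) *
      scalarHarmonic y.1.1 y.1.2 p := by
    obtain ⟨a, b, ha, hb, hf⟩ := hP
    exact ⟨a, b, ha.trans hd, hb.trans hd, hf⟩
  rw [← hP'.integral_eq h, ← (orthonormal_iff_ite.1 (orthonormal_scalarHarmonicL2 s)) x y,
    Submodule.coe_inner, L2.inner_def]
  refine integral_congr_ae ?_
  filter_upwards [(memLp_scalarHarmonic x.1.1 x.1.2).coeFn_toLp,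
    (memLp_scalarHarmonic y.1.1 y.1.2).coeFn_toLp] with p h1 h2
  rw [RCLike.inner_apply, mul_comm]
  rw [← h1, ← h2]
  rfl

/-! ### Needlet windows -/

/-- If `B ≤ 1`, then `φ(1) = 1` while `φ` vanishes to the right of `1`, against continuity. -/
theorem IsNeedletWindow.one_lt {B : ℝ} {φ b : ℝ → ℝ} (hb : IsNeedletWindow B φ b) (hB : 0 < B) :
    1 < B := by
  by_contra! h
  have h1 : φ 1 = 1 := hb.eq_one 1 (by rw [abs_one, le_div_iff₀ hB]; linarith)
  have h2 : Filter.Tendsto φ (nhdsWithin 1 (Set.Ioi 1)) (nhds (φ 1)) :=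
    (hb.smooth.continuous.tendsto 1).mono_left nhdsWithin_le_nhds
  have h3 : Filter.Tendsto φ (nhdsWithin 1 (Set.Ioi 1)) (nhds 0) := by
    refine tendsto_const_nhds.congr' ?_
    filter_upwards [self_mem_nhdsWithin] with x hx
    exact (hb.supp x (lt_of_lt_of_le hx (le_abs_self x))).symm
  have h4 := tendsto_nhds_unique h2 h3
  rw [h1] at h4
  exact one_ne_zero h4

theorem IsNeedletWindow.zero {B : ℝ} {φ b : ℝ → ℝ} (hb : IsNeedletWindow B φ b) : b 0 = 0 := by
  have h := hb.sq_eq 0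
  rw [zero_div, sub_self] at h
  exact pow_eq_zero_iff two_ne_zero |>.1 h

theorem IsNeedletWindow.eq_zero_of_lt {B : ℝ} {φ b : ℝ → ℝ} (hb : IsNeedletWindow B φ b)
    (hB : 0 < B) {x : ℝ} (hx : B < x) : b x = 0 := by
  have hB1 := hb.one_lt hB
  have h := hb.sq_eq x
  have h1 : 1 < x / B := by rwa [lt_div_iff₀ hB, one_mul]
  rw [hb.supp (x / B) (lt_of_lt_of_le h1 (le_abs_self _)),
    hb.supp x (lt_of_lt_of_le (hB1.trans hx) (le_abs_self _)), sub_self] at h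
  exact pow_eq_zero_iff two_ne_zero |>.1 h

theorem hasSum_int_sub_of_eventually {u : ℤ → ℝ} {a c : ℝ} {M : ℕ} (h1 : ∀ j : ℤ, j ≤ -M → u j = a)
    (h2 : ∀ j : ℤ, (M : ℤ) ≤ j → u j = c) : HasSum (fun j => u (j + 1) - u j) (c - a) := by
  have h : ∑ j ∈ Finset.Ico (-(M : ℤ)) M, (u (j + 1) - u j) = c - a := by
    have h3 : ∀ n : ℕ, ∑ j ∈ Finset.Ico (-(M : ℤ)) (-(M : ℤ) + n), (u (j + 1) - u j) =
        u (-(M : ℤ) + n) - u (-M) := by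
      intro n
      induction n with
      | zero => simp
      | succ n ih =>
        have e : Finset.Ico (-(M : ℤ)) (-(M : ℤ) + (n + 1 : ℕ)) =
            insert (-(M : ℤ) + n) (Finset.Ico (-(M : ℤ)) (-(M : ℤ) + n)) := by
          ext j
          simp only [Finset.mem_Ico, Finset.mem_insert]
          omega
        rw [e, Finset.sum_insert (by simp), ih]
        push_cast
        rw [add_assoc (-(M : ℤ))]
        ring
    have h4 := h3 (2 * M)
    rw [show -(M : ℤ) + (2 * M : ℕ) = M by push_cast; ring, h1 _ le_rfl, h2 _ le_rfl] at h4
    exact h4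
  rw [← h]
  refine hasSum_sum_of_ne_finset_zero fun j hj => ?_
  rw [Finset.mem_Ico, not_and_or] at hj
  rcases hj with hj | hj
  · rw [h1 _ (by omega), h1 _ (by omega), sub_self]
  · rw [h2 _ (by omega), h2 _ (by omega), sub_self]

/-- The terms are `u(j+1) - u(j)` with `u(j) = φ(x / B^j)`, which is `0` for very negative `j` and
`1` for large `j`. -/
theorem IsNeedletWindow.hasSum_sq {B : ℝ} {φ b : ℝ → ℝ} (hb : IsNeedletWindow B φ b) (hB : 0 < B)
    {x : ℝ} (hx : 0 < x) : HasSum (fun j : ℤ => b (x / B ^ j) ^ 2) 1 := by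
  have hB1 := hb.one_lt hB
  -- `M₁` ensures `x / B^j ≤ 1 / B` for `j ≥ M₁`, and `M₂` ensures `x / B^j > 1` for `j ≤ -M₂`.
  obtain ⟨M₁, hM₁⟩ := pow_unbounded_of_one_lt (x * B) hB1
  obtain ⟨M₂, hM₂⟩ := pow_unbounded_of_one_lt (1 / x) hB1
  have hpos : ∀ j : ℤ, 0 < B ^ j := fun j => zpow_pos hB j
  have h := hasSum_int_sub_of_eventually (u := fun j : ℤ => φ (x / B ^ j)) (a := 0) (c := 1)
    (M := max M₁ M₂) ?_ ?_
  · rw [sub_zero] at h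
    refine h.congr_fun fun j => ?_
    rw [hb.sq_eq, div_div, zpow_add_one₀ hB.ne']
  · intro j hj
    apply hb.supp
    refine lt_of_lt_of_le ?_ (le_abs_self _)
    rw [lt_div_iff₀ (hpos j), one_mul]
    have h1 : B ^ j ≤ B ^ (-(M₂ : ℤ)) := zpow_le_zpow_right₀ hB1.le (by omega)
    refine h1.trans_lt ?_
    rw [zpow_neg, zpow_natCast, inv_lt_comm₀ (pow_pos hB _) hx]
    rwa [one_div] at hM₂
  · intro j hj
    apply hb.eq_one
    rw [abs_of_pos (div_pos hx (hpos j)), div_le_div_iff₀ (hpos j) hB, one_mul]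
    have h1 : B ^ (M₁ : ℤ) ≤ B ^ j := zpow_le_zpow_right₀ hB1.le (by omega)
    rw [zpow_natCast] at h1
    linarith

theorem eigenvalue_self (s : ℤ) : eigenvalue s.natAbs s = 0 := by
  rw [eigenvalue, Nat.cast_natAbs, Int.cast_abs, sub_self, zero_mul]

theorem sub_le_eigenvalue {s : ℤ} {l : ℕ} (h : s.natAbs ≤ l) :
    (l : ℝ) - s.natAbs ≤ eigenvalue l s := by
  have h1 : (s.natAbs : ℝ) = |(s : ℝ)| := by rw [Nat.cast_natAbs, Int.cast_abs]
  have h2 : (s.natAbs : ℝ) ≤ l := by exact_mod_cast h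
  rw [eigenvalue, ← h1]
  have h3 : (0 : ℝ) ≤ s.natAbs := Nat.cast_nonneg _
  nlinarith

theorem le_needletDegree (B : ℝ) {s : ℤ} (j : ℤ) {l : ℕ} (h : s.natAbs ≤ l)
    (hl : eigenvalue l s ≤ B ^ (2 * (j + 1))) : l ≤ needletDegree B s j := by
  -- Boundedness matters: the `sSup` of an unbounded set of naturals is `0`. The bound comes from `l
  -- - |s| ≤ e_{ls}`.
  refine le_csSup ⟨s.natAbs + ⌈B ^ (2 * (j + 1))⌉₊, ?_⟩ ⟨h, hl⟩
  rintro l' ⟨h1, h2⟩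
  have h3 := (sub_le_eigenvalue h1).trans (h2.trans (Nat.le_ceil _))
  have h4 : (l' : ℝ) ≤ s.natAbs + ⌈B ^ (2 * (j + 1))⌉₊ := by linarith
  exact_mod_cast h4

/-- A nonzero value of `b` forces `√e_{ls} ≤ B · B^j`, that is `e_{ls} ≤ B^{2(j+1)}`, hence `l ≤
L_j`. -/
theorem IsNeedletWindow.eq_zero_of_needletDegree_lt {B : ℝ} {φ b : ℝ → ℝ}
    (hb : IsNeedletWindow B φ b) (hB : 0 < B) {s : ℤ} (j : ℤ) {l : ℕ} (h : s.natAbs ≤ l)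
    (hl : needletDegree B s j < l) : b (√(eigenvalue l s) / B ^ j) = 0 := by
  apply hb.eq_zero_of_lt hB
  by_contra! hle
  have hp : 0 < B ^ j := zpow_pos hB j
  rw [div_le_iff₀ hp] at hle
  have he : B * B ^ j = B ^ (j + 1) := by rw [zpow_add_one₀ hB.ne', mul_comm]
  rw [he, Real.sqrt_le_left (zpow_pos hB _).le, ← zpow_natCast, ← zpow_mul] at hle
  have h1 := le_needletDegree B j h (l := l) (by rwa [mul_comm (j + 1)] at hle)
  omega

/-- The indices of the harmonics of degree at most `L`. -/
def harmonicIndexLE (s : ℤ) (L : ℕ) : Finset (HarmonicIndex s) :=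
  (Finset.range (L + 1) ×ˢ Finset.Icc (-(L : ℤ)) L).subtype
    fun x => s.natAbs ≤ x.1 ∧ x.2.natAbs ≤ x.1

theorem mem_harmonicIndexLE {s : ℤ} {L : ℕ} {x : HarmonicIndex s} :
    x ∈ harmonicIndexLE s L ↔ x.1.1 ≤ L := by
  have := x.2.2
  rw [harmonicIndexLE, Finset.mem_subtype, Finset.mem_product, Finset.mem_range, Finset.mem_Icc]
  omega

/-- Only finitely many terms are nonzero, so no convergence is involved. The general `V` serves
scalar needlets, mixed needlets and their coefficients alike. -/
theorem tsum_harmonic {V : Type*} [AddCommGroup V] [Module ℂ V] [TopologicalSpace V] (s : ℤ)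
    (L : ℕ) (c : ℕ → ℂ) (hc : ∀ l, s.natAbs ≤ l → L < l → c l = 0) (g : ℕ → ℤ → V) :
    ∑' l : Set.Ici s.natAbs, c l • ∑ m ∈ Finset.Icc (-((l : ℕ) : ℤ)) (l : ℕ), g l m =
      ∑ x ∈ harmonicIndexLE s L, c x.1.1 • g x.1.1 x.1.2 := by
  classical
  rw [tsum_eq_sum (s := (Finset.range (L + 1)).subtype (fun l => l ∈ Set.Ici s.natAbs))]
  · rw [Finset.sum_subtype_eq_sum_filter (f := fun l : ℕ => c l •
      ∑ m ∈ Finset.Icc (-(l : ℤ)) l, g l m), harmonicIndexLE,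
      Finset.sum_subtype_eq_sum_filter (f := fun x : ℕ × ℤ => c x.1 • g x.1 x.2),
      Finset.sum_filter, Finset.sum_filter, Finset.sum_product]
    refine Finset.sum_congr rfl fun l hl => ?_
    rw [Finset.mem_range] at hl
    by_cases hs : s.natAbs ≤ l
    · rw [if_pos (show l ∈ Set.Ici s.natAbs from hs), Finset.smul_sum, ← Finset.sum_filter]
      refine Finset.sum_congr ?_ fun _ _ => rfl
      ext m
      simp only [Finset.mem_filter, Finset.mem_Icc, hs, true_and]
      omega
    · rw [if_neg (show ¬ l ∈ Set.Ici s.natAbs from hs)]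
      exact (Finset.sum_eq_zero fun m _ => if_neg fun h => hs h.1).symm
  · rintro ⟨l, hl⟩ h
    rw [Finset.mem_subtype, Finset.mem_range] at h
    rw [hc l hl (by dsimp only at h; omega), zero_smul]

/-! ### Tight frames -/

/-- A family satisfying the Parseval identity satisfies the reconstruction formula. -/
theorem hasSum_inner_smul_of_parseval {ι H : Type*} [NormedAddCommGroup H]
    [InnerProductSpace ℂ H] [CompleteSpace H] (ψ : ι → H)
    (h : ∀ F, HasSum (fun i => ‖⟪ψ i, F⟫_ℂ‖ ^ 2) (‖F‖ ^ 2)) (F : H) :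
    HasSum (fun i => ⟪ψ i, F⟫_ℂ • ψ i) F := by
  classical
  have hmem : ∀ F, Memℓp (fun i => ⟪ψ i, F⟫_ℂ) 2 := fun F => by
    refine memℓp_gen ?_
    simpa using (h F).summable
  let T₀ : H →ₗ[ℂ] lp (fun _ : ι => ℂ) 2 :=
    { toFun := fun F => ⟨fun i => ⟪ψ i, F⟫_ℂ, hmem F⟩
      map_add' := fun F G => by
        ext i
        exact inner_add_right _ _ _
      map_smul' := fun c F => by
        ext i
        exact inner_smul_right _ _ _ }
  let T : H →ₗᵢ[ℂ] lp (fun _ : ι => ℂ) 2 :=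
    { T₀ with
      norm_map' := fun F => by
        have h1 : ‖T₀ F‖ ^ 2 = ‖F‖ ^ 2 := by
          have h2 := lp.norm_rpow_eq_tsum (p := 2) (by simp) (T₀ F)
          have h3 : ∑' i, ‖T₀ F i‖ ^ 2 = ‖F‖ ^ 2 := (h F).tsum_eq
          rw [← h3]
          simpa using h2
        exact (pow_left_inj₀ (norm_nonneg _) (norm_nonneg _) two_ne_zero).1 h1 }
  -- The analysis operator `T` is an isometry, so `A T = 1`, and `A` sends the `i`-th unit vector to
  -- `ψ i`. Applying `A` to the unconditionally convergent expansion of `T F` gives the claim.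
  let A := ContinuousLinearMap.adjoint T.toContinuousLinearMap
  have h1 : ∀ i (c : ℂ), A (lp.single 2 i c) = c • ψ i := fun i c => by
    refine ext_inner_left ℂ fun G => ?_
    rw [ContinuousLinearMap.adjoint_inner_right, lp.inner_single_right, inner_smul_right]
    change ⟪⟪ψ i, G⟫_ℂ, c⟫_ℂ = _
    rw [RCLike.inner_apply, inner_conj_symm]
  have h2 : A (T F) = F := by
    refine ext_inner_left ℂ fun G => ?_
    rw [ContinuousLinearMap.adjoint_inner_right]
    exact T.inner_map_map G F
  have h3 := (lp.hasSum_single (p := 2) (by simp) (T F)).mapL A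
  rw [h2] at h3
  simp only [h1] at h3
  exact h3

/-! ### Needlets as finite sums -/

/-- The multiplier of the needlets at scale `j`. -/
def multiplier (s : ℤ) (B : ℝ) (b : ℝ → ℝ) (j : ℤ) (l : ℕ) : ℝ := b (√(eigenvalue l s) / B ^ j)

section Needlets

variable {B : ℝ} {φ b : ℝ → ℝ}

theorem IsNeedletWindow.tsum_harmonic (hb : IsNeedletWindow B φ b) (hB : 0 < B) {V : Type*}
    [AddCommGroup V] [Module ℂ V] [TopologicalSpace V] (s j : ℤ) (g : ℕ → ℤ → V) :
    ∑' l : Set.Ici s.natAbs, ((b (√(eigenvalue l s) / B ^ j) : ℝ) : ℂ) •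
        ∑ m ∈ Finset.Icc (-((l : ℕ) : ℤ)) (l : ℕ), g l m =
      ∑ x ∈ harmonicIndexLE s (needletDegree B s j),
        (multiplier s B b j x.1.1 : ℂ) • g x.1.1 x.1.2 := by
  refine MixedNeedlets.tsum_harmonic s _ (fun l => (multiplier s B b j l : ℂ))
    (fun l h1 h2 => ?_) g
  rw [multiplier, hb.eq_zero_of_needletDegree_lt hB j h1 h2, Complex.ofReal_zero]

theorem mixedNeedlet_eq (hb : IsNeedletWindow B φ b) (hB : 0 < B) (s j : ℤ) (ξ : S2) (w : ℝ) :
    mixedNeedlet s B b j ξ w = ((√w : ℝ) : ℂ) •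
      ∑ x ∈ harmonicIndexLE s (needletDegree B s j), (multiplier s B b j x.1.1 : ℂ) •
        (starRingEnd ℂ) (scalarHarmonic x.1.1 x.1.2 ξ) • spinHarmonic s x.1.1 x.1.2 := by
  rw [mixedNeedlet, hb.tsum_harmonic hB s j
    fun l m => (starRingEnd ℂ) (scalarHarmonic l m ξ) • spinHarmonic s l m]

/-- The inverse map is used because `scalarNeedlet` is an element of the ambient `L²`, not of
`scalarHighDegree s`. -/
theorem spinUnitary_symm_mixedNeedlet (hb : IsNeedletWindow B φ b) (hB : 0 < B) (s j : ℤ) (ξ : S2)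
    (w : ℝ) : ((spinUnitary s).symm (mixedNeedlet s B b j ξ w) : ScalarL2) =
      scalarNeedlet s B b j ξ w := by
  rw [mixedNeedlet_eq hb hB, scalarNeedlet, hb.tsum_harmonic hB s j
    fun l m => (starRingEnd ℂ) (scalarHarmonic l m ξ) • scalarHarmonicL2 l m]
  simp only [map_smul, map_sum, Submodule.coe_smul, Submodule.coe_sum,
    spinUnitary_symm_spinHarmonic]

theorem inner_mixedNeedlet (hb : IsNeedletWindow B φ b) (hB : 0 < B) (s j : ℤ) (ξ : S2)
    (w : ℝ) (F : SpinL2 s) : ⟪mixedNeedlet s B b j ξ w, F⟫_ℂ = ((√w : ℝ) : ℂ) *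
      ∑ x ∈ harmonicIndexLE s (needletDegree B s j), (multiplier s B b j x.1.1 : ℂ) *
        (⟪spinHarmonic s x.1.1 x.1.2, F⟫_ℂ * scalarHarmonic x.1.1 x.1.2 ξ) := by
  rw [mixedNeedlet_eq hb hB, inner_smul_left, Complex.conj_ofReal, sum_inner]
  congr 1
  refine Finset.sum_congr rfl fun x _ => ?_
  rw [inner_smul_left, inner_smul_left, Complex.conj_ofReal, Complex.conj_conj]
  ring

/-! ### Parseval identity and reconstruction for mixed needlets -/

theorem IsNeedletWindow.multiplier_self (hb : IsNeedletWindow B φ b) (s j : ℤ) :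
    multiplier s B b j s.natAbs = 0 := by
  rw [multiplier, eigenvalue_self, Real.sqrt_zero, zero_div, hb.zero]

theorem IsNeedletWindow.hasSum_multiplier_sq (hb : IsNeedletWindow B φ b) (hB : 0 < B) {s : ℤ}
    {l : ℕ} (h : s.natAbs < l) : HasSum (fun j => multiplier s B b j l ^ 2) 1 := by
  refine hb.hasSum_sq hB (Real.sqrt_pos.2 (lt_of_lt_of_le ?_ (sub_le_eigenvalue h.le)))
  rw [sub_pos]
  exact_mod_cast h

theorem mem_spinHighFreq_iff {s : ℤ} {F : SpinL2 s} : F ∈ spinHighFreq s ↔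
    ∀ x : HarmonicIndex s, x.1.1 = s.natAbs → ⟪spinHarmonic s x.1.1 x.1.2, F⟫_ℂ = 0 := by
  constructor
  · rintro h ⟨⟨l, m⟩, hl, hm⟩ hx
    dsimp only at hx hm
    subst hx
    refine (Submodule.mem_orthogonal _ _).1 h _ (Submodule.subset_span ⟨m, ?_, rfl⟩)
    rw [Set.mem_Icc]
    omega
  · intro h
    rw [spinHighFreq, spinEigenspace, Submodule.mem_orthogonal]
    intro G hG
    induction hG using Submodule.span_induction with
    | mem G hG =>
      obtain ⟨m, hm, rfl⟩ := hG
      rw [Set.mem_Icc] at hm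
      exact h ⟨(s.natAbs, m), le_rfl, by dsimp only; omega⟩ rfl
    | zero => exact inner_zero_left _
    | add G G' _ _ h1 h2 => rw [inner_add_left, h1, h2, add_zero]
    | smul c G _ h1 => rw [inner_smul_left, h1, mul_zero]

/-- Terms of degree `|s|` have multiplier `b(0) = 0`; the others are orthogonal to that eigenspace.
-/
theorem mixedNeedlet_mem_spinHighFreq (hb : IsNeedletWindow B φ b) (hB : 0 < B) (s j : ℤ) (ξ : S2)
    (w : ℝ) : mixedNeedlet s B b j ξ w ∈ spinHighFreq s := by
  rw [mixedNeedlet_eq hb hB]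
  refine Submodule.smul_mem _ _ (Submodule.sum_mem _ fun x _ => ?_)
  by_cases hx : x.1.1 = s.natAbs
  · rw [hx, hb.multiplier_self, Complex.ofReal_zero, zero_smul]
    exact Submodule.zero_mem _
  · refine Submodule.smul_mem _ _ (Submodule.smul_mem _ _ (mem_spinHighFreq_iff.2 fun y hy => ?_))
    exact (orthonormal_spinHarmonic s).2 fun h => hx (h ▸ hy)

/-- The energy of the needlet coefficients at a fixed scale. -/
theorem sum_norm_inner_mixedNeedlet_sq (hb : IsNeedletWindow B φ b) (hB : 0 < B) (s j : ℤ) {n : ℕ}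
    {ξ : Fin n → S2} {w : Fin n → ℝ} (h : IsCubature (2 * needletDegree B s j) ξ w)
    (F : SpinL2 s) : ∑ k, ‖⟪mixedNeedlet s B b j (ξ k) (w k), F⟫_ℂ‖ ^ 2 =
      ∑ x ∈ harmonicIndexLE s (needletDegree B s j),
        multiplier s B b j x.1.1 ^ 2 * ‖⟪spinHarmonic s x.1.1 x.1.2, F⟫_ℂ‖ ^ 2 := by
  classical
  set S := harmonicIndexLE s (needletDegree B s j) with hS
  set d : HarmonicIndex s → ℂ := fun x =>
    (multiplier s B b j x.1.1 : ℂ) * ⟪spinHarmonic s x.1.1 x.1.2, F⟫_ℂ with hd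
  set Y : HarmonicIndex s → Fin n → ℂ := fun x k => scalarHarmonic x.1.1 x.1.2 (ξ k) with hY
  have h1 : ∀ k, ((‖⟪mixedNeedlet s B b j (ξ k) (w k), F⟫_ℂ‖ ^ 2 : ℝ) : ℂ) =
      ∑ x ∈ S, ∑ y ∈ S, (starRingEnd ℂ) (d x) * d y *
        ((w k : ℂ) * ((starRingEnd ℂ) (Y x k) * Y y k)) := fun k => by
    have h2 : ⟪mixedNeedlet s B b j (ξ k) (w k), F⟫_ℂ =
        ((√(w k) : ℝ) : ℂ) * ∑ x ∈ S, d x * Y x k := by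
      rw [inner_mixedNeedlet hb hB]
      simp only [hd, hY, mul_assoc, ← hS]
    have h3 : ((√(w k) : ℝ) : ℂ) * ((√(w k) : ℝ) : ℂ) = (w k : ℂ) := by
      rw [← Complex.ofReal_mul, Real.mul_self_sqrt (h.weight_nonneg k)]
    rw [h2, Complex.ofReal_pow, ← Complex.conj_mul', map_mul, Complex.conj_ofReal, map_sum,
      mul_mul_mul_comm, h3, Finset.sum_mul_sum, Finset.mul_sum]
    refine Finset.sum_congr rfl fun x _ => ?_
    rw [Finset.mul_sum]
    refine Finset.sum_congr rfl fun y _ => ?_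
    rw [map_mul]
    ring
  -- Summing over the cubature points first leaves the diagonal: the two degrees add up to at most
  -- `2 L_j`, so discrete orthonormality applies.
  have h2 : ∑ k, ((‖⟪mixedNeedlet s B b j (ξ k) (w k), F⟫_ℂ‖ ^ 2 : ℝ) : ℂ) =
      ∑ x ∈ S, (starRingEnd ℂ) (d x) * d x := by
    simp only [h1]
    rw [Finset.sum_comm]
    refine Finset.sum_congr rfl fun x hx => ?_
    rw [Finset.sum_comm, Finset.sum_eq_single_of_mem x hx]
    · rw [← Finset.mul_sum, h.sum_scalarHarmonic x x, if_pos rfl, mul_one]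
      have := mem_harmonicIndexLE.1 hx
      omega
    · intro y hy hyx
      rw [← Finset.mul_sum, h.sum_scalarHarmonic x y, if_neg hyx.symm, mul_zero]
      have h4 := mem_harmonicIndexLE.1 hx
      have h5 := mem_harmonicIndexLE.1 hy
      omega
  rw [← Complex.ofReal_sum] at h2
  rw [← Complex.ofReal_inj, h2, Complex.ofReal_sum]
  refine Finset.sum_congr rfl fun x _ => ?_
  rw [Complex.conj_mul', ← Complex.ofReal_pow, hd, norm_mul, mul_pow, Complex.norm_real,
    Real.norm_eq_abs, sq_abs]

/-- The Parseval identity of the mixed needlets. -/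
theorem hasSum_norm_inner_mixedNeedlet_sq (hb : IsNeedletWindow B φ b) (hB : 0 < B) {s : ℤ}
    {N : ℤ → ℕ} {ξ : (j : ℤ) → Fin (N j) → S2} {w : (j : ℤ) → Fin (N j) → ℝ}
    (h : ∀ j, IsCubature (2 * needletDegree B s j) (ξ j) (w j)) {F : SpinL2 s}
    (hF : F ∈ spinHighFreq s) :
    HasSum (fun i : (j : ℤ) × Fin (N j) =>
      ‖⟪mixedNeedlet s B b i.1 (ξ i.1 i.2) (w i.1 i.2), F⟫_ℂ‖ ^ 2) (‖F‖ ^ 2) := by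
  set a : HarmonicIndex s → ℝ := fun x => ‖⟪spinHarmonic s x.1.1 x.1.2, F⟫_ℂ‖ ^ 2 with ha
  have h0 : ∀ x, 0 ≤ a x := fun x => sq_nonneg _
  have h1 : HasSum a (‖F‖ ^ 2) := by
    have h2 := (spinBasis s).hasSum_inner_mul_inner F F
    have h3 : (fun x => ⟪F, spinBasis s x⟫_ℂ * ⟪spinBasis s x, F⟫_ℂ) =
        fun x => ((a x : ℝ) : ℂ) := by
      funext x
      rw [← inner_conj_symm, Complex.conj_mul', spinBasis_apply, ← Complex.ofReal_pow]
    rw [h3, inner_self_eq_norm_sq_to_K] at h2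
    refine Complex.hasSum_ofReal.1 ?_
    rw [Complex.ofReal_pow]
    exact h2
  -- At degree `|s|` all multipliers vanish, but so does `a x` because `F` lies in `(I - P) L²_s`;
  -- in higher degrees the squared multipliers sum to `1`.
  have h2 : ∀ x, HasSum (fun j => multiplier s B b j x.1.1 ^ 2 * a x) (a x) := fun x => by
    rcases (x.2.1).eq_or_lt with hx | hx
    · have : a x = 0 := by
        rw [ha]
        dsimp only
        rw [mem_spinHighFreq_iff.1 hF x hx.symm, norm_zero, zero_pow two_ne_zero]
      simp only [this, mul_zero]
      exact hasSum_zero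
    · simpa using (hb.hasSum_multiplier_sq hB hx).mul_right (a x)
  -- Tonelli: the terms are nonnegative, so the double series may be summed over `j` first, giving
  -- `‖F‖²`, or over the harmonics first, giving the energy at each scale.
  have h3 : HasSum (fun y : HarmonicIndex s × ℤ => multiplier s B b y.2 y.1.1.1 ^ 2 * a y.1)
      (‖F‖ ^ 2) := by
    have h4 : Summable fun y : HarmonicIndex s × ℤ =>
        multiplier s B b y.2 y.1.1.1 ^ 2 * a y.1 := by
      refine (summable_prod_of_nonneg fun y => mul_nonneg (sq_nonneg _) (h0 _)).2
        ⟨fun x => (h2 x).summable, ?_⟩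
      simpa only [(h2 _).tsum_eq] using h1.summable
    rw [h1.unique (h4.hasSum.prod_fiberwise h2)]
    exact h4.hasSum
  have h4 : ∀ j, HasSum (fun x : HarmonicIndex s => multiplier s B b j x.1.1 ^ 2 * a x)
      (∑ k, ‖⟪mixedNeedlet s B b j (ξ j k) (w j k), F⟫_ℂ‖ ^ 2) := fun j => by
    rw [sum_norm_inner_mixedNeedlet_sq hb hB s j (h j)]
    refine hasSum_sum_of_ne_finset_zero fun x hx => ?_
    rw [mem_harmonicIndexLE, not_le] at hx
    rw [multiplier, hb.eq_zero_of_needletDegree_lt hB j x.2.1 hx, zero_pow two_ne_zero, zero_mul]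
  have h5 : HasSum (fun j => ∑ k, ‖⟪mixedNeedlet s B b j (ξ j k) (w j k), F⟫_ℂ‖ ^ 2) (‖F‖ ^ 2) :=
    ((Equiv.prodComm ℤ (HarmonicIndex s)).hasSum_iff.2 h3).prod_fiberwise h4
  have h6 : Summable (fun i : (j : ℤ) × Fin (N j) =>
      ‖⟪mixedNeedlet s B b i.1 (ξ i.1 i.2) (w i.1 i.2), F⟫_ℂ‖ ^ 2) := by
    refine (summable_sigma_of_nonneg fun i => sq_nonneg _).2 ⟨fun j => (hasSum_fintype _).summable,
      ?_⟩
    simpa only [tsum_fintype] using h5.summable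
  rw [h5.unique (h6.hasSum.sigma fun j => hasSum_fintype _)]
  exact h6.hasSum

/-- The reconstruction formula of the mixed needlets. -/
theorem hasSum_inner_smul_mixedNeedlet (hb : IsNeedletWindow B φ b) (hB : 0 < B) {s : ℤ}
    {N : ℤ → ℕ} {ξ : (j : ℤ) → Fin (N j) → S2} {w : (j : ℤ) → Fin (N j) → ℝ}
    (h : ∀ j, IsCubature (2 * needletDegree B s j) (ξ j) (w j)) {F : SpinL2 s}
    (hF : F ∈ spinHighFreq s) :
    HasSum (fun i : (j : ℤ) × Fin (N j) =>
      ⟪mixedNeedlet s B b i.1 (ξ i.1 i.2) (w i.1 i.2), F⟫_ℂ •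
        mixedNeedlet s B b i.1 (ξ i.1 i.2) (w i.1 i.2)) F := by
  -- Parseval holds only on `(I - P) L²_s`, so the abstract reconstruction is applied in this closed
  -- subspace, which contains the needlets, and then mapped into `L²_s`.
  have : CompleteSpace (spinHighFreq s) := (Submodule.isClosed_orthogonal _).completeSpace_coe
  let ψ : (j : ℤ) × Fin (N j) → spinHighFreq s := fun i =>
    ⟨_, mixedNeedlet_mem_spinHighFreq hb hB s i.1 (ξ i.1 i.2) (w i.1 i.2)⟩
  have h1 : ∀ G, HasSum (fun i => ‖⟪ψ i, G⟫_ℂ‖ ^ 2) (‖G‖ ^ 2) := fun G => by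
    simp only [Submodule.coe_inner, ← Submodule.norm_coe]
    exact hasSum_norm_inner_mixedNeedlet_sq hb hB h G.2
  have h2 := (hasSum_inner_smul_of_parseval ψ h1 ⟨F, hF⟩).mapL (spinHighFreq s).subtypeL
  simp only [map_smul, Submodule.subtypeL_apply, Submodule.coe_inner] at h2
  exact h2

end Needlets

end

end MixedNeedlets

theorem mainTheorem3 (s : ℤ) (B : ℝ) (hB : 0 < B) (φ b : ℝ → ℝ) (hb : IsNeedletWindow B φ b) :
    -- cubature points and weights of the required degrees exist
    (∃ (N : ℤ → ℕ) (ξ : (j : ℤ) → Fin (N j) → S2) (w : (j : ℤ) → Fin (N j) → ℝ),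
      ∀ j, IsCubature (2 * needletDegree B s j) (ξ j) (w j)) ∧
    -- the unitary map `U` with `U Y_{lm} = Y_{lm,s}`
    ∃ U : scalarHighDegree s ≃ₗᵢ[ℂ] SpinL2 s,
      (∀ (l : ℕ) (m : ℤ), s.natAbs ≤ l → -(l : ℤ) ≤ m → m ≤ l →
        (U.symm (spinHarmonic s l m) : ScalarL2) = scalarHarmonicL2 l m) ∧
      ∀ (N : ℤ → ℕ) (ξ : (j : ℤ) → Fin (N j) → S2) (w : (j : ℤ) → Fin (N j) → ℝ),
        (∀ j, IsCubature (2 * needletDegree B s j) (ξ j) (w j)) →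
        -- the mixed needlets are the images under `U` of the scalar needlets
        (∀ j k, (U.symm (mixedNeedlet s B b j (ξ j k) (w j k)) : ScalarL2) =
          scalarNeedlet s B b j (ξ j k) (w j k)) ∧
        -- they lie in `(I - P) L²_s`
        (∀ j k, mixedNeedlet s B b j (ξ j k) (w j k) ∈ spinHighFreq s) ∧
        -- the needlet coefficients in terms of the harmonic coefficients
        (∀ (F : SpinL2 s) (j : ℤ) (k : Fin (N j)),
          ⟪mixedNeedlet s B b j (ξ j k) (w j k), F⟫_ℂ =
            ((√(w j k) : ℝ) : ℂ) * ∑' l : Set.Ici s.natAbs,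
              ((b (√(eigenvalue l s) / B ^ j) : ℝ) : ℂ) *
                ∑ m ∈ Finset.Icc (-(l : ℤ)) l,
                  ⟪spinHarmonic s l m, F⟫_ℂ * scalarHarmonic l m (ξ j k)) ∧
        ∀ F ∈ spinHighFreq s,
          -- Parseval identity (tight frame with constant one)
          HasSum (fun i : (j : ℤ) × Fin (N j) =>
            ‖⟪mixedNeedlet s B b i.1 (ξ i.1 i.2) (w i.1 i.2), F⟫_ℂ‖ ^ 2) (‖F‖ ^ 2) ∧
          -- reconstruction formula, with unconditional convergence in `L²_s`
          HasSum (fun i : (j : ℤ) × Fin (N j) =>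
            ⟪mixedNeedlet s B b i.1 (ξ i.1 i.2) (w i.1 i.2), F⟫_ℂ •
              mixedNeedlet s B b i.1 (ξ i.1 i.2) (w i.1 i.2)) F := by
  refine ⟨?_, spinUnitary s, fun l m h1 h2 h3 =>
    spinUnitary_symm_spinHarmonic s ⟨(l, m), h1, by dsimp only; omega⟩,
    fun N ξ w h => ⟨fun j k => spinUnitary_symm_mixedNeedlet hb hB s j _ _,
      fun j k => mixedNeedlet_mem_spinHighFreq hb hB s j _ _, fun F j k => ?_, fun F hF =>
      ⟨hasSum_norm_inner_mixedNeedlet_sq hb hB h hF, hasSum_inner_smul_mixedNeedlet hb hB h hF⟩⟩⟩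
  · choose N ξ w h using fun j => exists_isCubature (2 * needletDegree B s j)
    exact ⟨N, ξ, w, h⟩
  · rw [inner_mixedNeedlet hb hB]
    congr 1
    exact (hb.tsum_harmonic hB s j fun l m =>
      ⟪spinHarmonic s l m, F⟫_ℂ * scalarHarmonic l m (ξ j k)).symm
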